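/- Let $\mathcal H:\mathbb R^2\to\mathbb R$ satisfy: (i) $\mathcal H\in C^4$ with bounded second derivative and $\min_{\mathbb R^2}\mathcal H=0$; (ii) $\mathcal H$ has finitely many critical points, the Hessian is non-degenerate at each of them, and $\mathcal H$ takes distinct values at distinct critical points; (iii) there are $\mathfrak a_1,\mathfrak a_2,\mathfrak a_3>0$ such that $\mathcal H(x)\ge\mathfrak a_1|x|^2$, $|\nabla\mathcal H(x)|\ge\mathfrak a_2|x|$ and $\Delta\mathcal H(x)\ge\mathfrak a_3$ for all $|x|$ large enough. Let $\Gamma$ be the graph obtained from $\mathbb R^2$ by identifying all points in the same connected component of a level set of $\mathcal H$, and $\Pi:\mathbb R^2\to\Gamma$ the projection. Its vertices are the images of the critical points. Its edges $I_1,\dots,I_m$ are the connected components of $\Gamma$ without its vertices; each $I_k$ is identified, through the value $z$ of $\mathcal H$, with an open interval $(a_k,b_k)$, and $(z,k)$ denotes the point of $I_k$ at which $\mathcal H=z$. Let $I_m$ be the unique unbounded edge, $b_m=\infty$. For $z\in(a_k,b_k)$ let $C_k(z)$ be the component of $\{\mathcal H=z\}$ corresponding to $(z,k)$, and put $$\alpha_k(z)=\oint_{C_k(z)}|\nabla\mathcal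 H|\,\mathrm dl,\qquad T_k(z)=\oint_{C_k(z)}\frac{1}{|\nabla\mathcal H|}\,\mathrm dl .$$ For a weight $w:\Gamma\to(0,\infty)$ let $\bar H_w=L^2(\Gamma,\mathrm d\nu_w)$, where $\nu_w$ is the image under $\Pi$ of the measure $w(\Pi(x))\,\mathrm dx$, and let $$\|f\|_{\bar{\mathbb W}^{1,2}_w}^2=\sum_{k=1}^m\int_{I_k}\big[|f(z,k)|^2T_k(z)+|f'(z,k)|^2\alpha_k(z)\big]w(z,k)\,\mathrm dz ,$$ where $f'(\cdot,k)$ is the weak derivative of $f$ along $I_k$ (the value is $\infty$ if it does not exist). For $T,M>0$ let $$\Lambda_{M,w}=\Big\{\Phi\in C([0,T];\bar H_w):\ \sup_{t\in[0,T]}\|\Phi(t)\|^2_{\bar{\mathbb W}^{1,2}_w}+\int_0^T\|\partial_t\Phi(t)\|^2_{\bar H_w}\,\mathrm dt\le M\Big\},$$ where $\partial_t\Phi$ is the weak time derivative of $\Phi$ as an $\bar H_w$-valued function. Let $\gamma(z,k)=\vartheta(z)$ on $\Gamma$, where $\vartheta:[0,\infty)\to(0,\infty)$ is bounded and twice differentiable,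 $z|\vartheta''(z)|+\sqrt z\,|\vartheta'(z)|\le C\vartheta(z)$ for all $z\ge0$ and some constant $C>0$, and $\sum_{k=1}^m\int_{I_k}\sqrt{\gamma(z,k)}\,T_k(z)\,\mathrm dz<\infty$. Suppose moreover that $\lim_{R\to\infty}\sup_{z>R}\gamma(z,m)=0$. Then, for all $T,M>0$, every element of $\Lambda_{M,\sqrt\gamma}$ belongs to $C([0,T];\bar H_\gamma)$, and $\Lambda_{M,\sqrt\gamma}$ is a precompact subset (a subset with compact closure) of $C([0,T];\bar H_\gamma)$. -/

import Mathlib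

open MeasureTheory Filter Set Topology
open scoped ENNReal

noncomputable section

/-- The plane `ℝ²` with its Euclidean norm. -/
abbrev Plane : Type := EuclideanSpace ℝ (Fin 2)

/-- Conditions on the Hamiltonian `ℋ : ℝ² → ℝ`. The derivative of the gradient is the Hessian. -/
structure HamiltonianHyp (ℋ : Plane → ℝ) : Prop where
  contDiff : ContDiff ℝ 4 ℋ
  bounded_hessian : ∃ C : ℝ, ∀ x, ‖fderiv ℝ (gradient ℋ) x‖ ≤ C
  min_eq_zero : IsLeast (range ℋ) 0
  finite_critical : {x | gradient ℋ x = 0}.Finite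
  nondegenerate : ∀ x, gradient ℋ x = 0 → (fderiv ℝ (gradient ℋ) x).det ≠ 0
  injOn_critical : InjOn ℋ {x | gradient ℋ x = 0}
  growth : ∃ a₁ a₂ a₃ R : ℝ, 0 < a₁ ∧ 0 < a₂ ∧ 0 < a₃ ∧ ∀ x : Plane, R ≤ ‖x‖ →
    a₁ * ‖x‖ ^ 2 ≤ ℋ x ∧ a₂ * ‖x‖ ≤ ‖gradient ℋ x‖ ∧ a₃ ≤ Laplacian.laplacian ℋ x

/-! ### The graph of connected components of level sets -/

/-- Two points are identified when they lie in the same connected component of the same level set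
of `ℋ`. -/
def levelSetoid (ℋ : Plane → ℝ) : Setoid Plane where
  r x y := ℋ y = ℋ x ∧ y ∈ connectedComponentIn {w | ℋ w = ℋ x} x
  iseqv :=
    { refl := fun x => ⟨rfl, mem_connectedComponentIn rfl⟩
      symm := by
        rintro x y ⟨h, hy⟩
        refine ⟨h.symm, ?_⟩
        rw [h, ← connectedComponentIn_eq hy]
        exact mem_connectedComponentIn rfl
      trans := by
        rintro x y z ⟨h, hy⟩ ⟨h', hz⟩
        refine ⟨h'.trans h, ?_⟩
        rw [h, ← connectedComponentIn_eq hy] at hz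
        exact hz }

/-- The graph `Γ`: the quotient of the plane that collapses every connected component of every
level set of `ℋ` to a point. -/
def LevelGraph (ℋ : Plane → ℝ) : Type := Quotient (levelSetoid ℋ)

namespace LevelGraph

variable (ℋ : Plane → ℝ)

instance : TopologicalSpace (LevelGraph ℋ) :=
  inferInstanceAs (TopologicalSpace (Quotient (levelSetoid ℋ)))

instance : MeasurableSpace (LevelGraph ℋ) := borel _

instance : BorelSpace (LevelGraph ℋ) := ⟨rfl⟩

/-- The projection `Π : ℝ² → Γ`. -/
def proj (x : Plane) : LevelGraph ℋ := Quotient.mk (levelSetoid ℋ) x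

instance : Nonempty (LevelGraph ℋ) := ⟨proj ℋ 0⟩

/-- The coordinate `z` of a point `(z, k)` of the graph: the value of `ℋ` on the corresponding
component. -/
def height : LevelGraph ℋ → ℝ := Quotient.lift ℋ (fun _ _ h => h.1.symm)

/-- The vertices: the points of `Γ` that correspond to the critical points of `ℋ`. -/
def vertices : Set (LevelGraph ℋ) := proj ℋ '' {x | gradient ℋ x = 0}

/-- The (open) edges: the connected components of the graph without its vertices. -/
def Edge : Type :=
  {E : Set (LevelGraph ℋ) // ∃ p ∉ vertices ℋ, E = connectedComponentIn (vertices ℋ)ᶜ p}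

variable {ℋ}

/-- The interval `I_k = (a_k, b_k)` of the values of `ℋ` along the edge `k`. -/
def Edge.interval (k : Edge ℋ) : Set ℝ := height ℋ '' k.1

/-- The point `(z, k)` of the graph, for `z ∈ I_k`. -/
def Edge.point (k : Edge ℋ) (z : ℝ) : LevelGraph ℋ := Function.invFunOn (height ℋ) k.1 z

/-- The connected component `C_k(z)` of the level set `{ℋ = z}` that corresponds to `(z, k)`. -/
def Edge.levelCurve (k : Edge ℋ) (z : ℝ) : Set Plane := {x | ℋ x = z ∧ proj ℋ x ∈ k.1}

/-- `α_k(z) = ∮_{C_k(z)} |∇ℋ| dl`, where the length element is the one-dimensional Hausdorff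
measure. -/
def Edge.alpha (k : Edge ℋ) (z : ℝ) : ℝ≥0∞ :=
  ∫⁻ x in k.levelCurve z, ‖gradient ℋ x‖ₑ ∂(Measure.hausdorffMeasure 1)

/-- `T_k(z) = ∮_{C_k(z)} 1 / |∇ℋ| dl`. -/
def Edge.period (k : Edge ℋ) (z : ℝ) : ℝ≥0∞ :=
  ∫⁻ x in k.levelCurve z, ‖gradient ℋ x‖ₑ⁻¹ ∂(Measure.hausdorffMeasure 1)

end LevelGraph

open LevelGraph

/-! ### Function spaces -/

/-- The measure `ν_w` on `Γ`: the image under `Π` of the measure `w(Π x) dx` on the plane. -/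
def graphMeasure {ℋ : Plane → ℝ} (w : LevelGraph ℋ → ℝ) : Measure (LevelGraph ℋ) :=
  Measure.map (proj ℋ)
    ((volume : Measure Plane).withDensity fun x => ENNReal.ofReal (w (proj ℋ x)))

/-- The weighted space `L²(Γ, dν_w)`. -/
abbrev GraphL2 {ℋ : Plane → ℝ} (w : LevelGraph ℋ → ℝ) : Type := Lp ℝ 2 (graphMeasure w)

/-- `v` is the weak derivative of `u` on the open set `I ⊆ ℝ` (functions with values in a Banach
space). -/
def HasWeakDerivOn {F : Type*} [NormedAddCommGroup F] [NormedSpace ℝ F]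
    (I : Set ℝ) (u v : ℝ → F) : Prop :=
  LocallyIntegrableOn u I ∧ LocallyIntegrableOn v I ∧
    ∀ φ : ℝ → ℝ, ContDiff ℝ (⊤ : ℕ∞) φ → HasCompactSupport φ → tsupport φ ⊆ I →
      ∫ s in I, deriv φ s • u s = -∫ s in I, φ s • v s

/-- The square of the norm of the weighted Sobolev space `W^{1,2}_w` on the graph,
`∑_k ∫_{I_k} (|f(z,k)|² T_k(z) + |f'(z,k)|² α_k(z)) w(z,k) dz`, where `f'(·,k)` is the weak
derivative along the edge `k`. It is `∞` when `f` has no weak derivative on some edge; otherwise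
the weak derivatives are unique almost everywhere and all members of the infimum are equal. -/
def sobolevNormSq {ℋ : Plane → ℝ} (w : LevelGraph ℋ → ℝ) (f : LevelGraph ℋ → ℝ) : ℝ≥0∞ :=
  ⨅ (g : Edge ℋ → ℝ → ℝ)
    (_ : ∀ k, HasWeakDerivOn k.interval (fun z => f (k.point z)) (g k)),
    ∑' k : Edge ℋ, ∫⁻ z in k.interval,
      (‖f (k.point z)‖ₑ ^ 2 * k.period z + ‖g k z‖ₑ ^ 2 * k.alpha z)
        * ENNReal.ofReal (w (k.point z))

/-- `∫_0^T ‖∂ₜΦ(t)‖² dt`, with `∂ₜΦ` the weak time derivative; it is `∞` when there is none. -/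
def timeEnergy {F : Type*} [NormedAddCommGroup F] [NormedSpace ℝ F]
    {T : ℝ} (hT : 0 ≤ T) (Φ : C(Icc (0 : ℝ) T, F)) : ℝ≥0∞ :=
  ⨅ (Ψ : ℝ → F) (_ : HasWeakDerivOn (Ioo 0 T) (IccExtend hT Φ) Ψ),
    ∫⁻ t in Ioo 0 T, ‖Ψ t‖ₑ ^ 2

/-- The set `Λ_{M,w}` of all `Φ ∈ C([0,T]; L²(Γ, dν_w))` with
`sup_t ‖Φ(t)‖²_{W^{1,2}_w} + ∫_0^T ‖∂ₜΦ(t)‖² dt ≤ M`. -/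
def energySet {ℋ : Plane → ℝ} {T : ℝ} (hT : 0 ≤ T) (M : ℝ) (w : LevelGraph ℋ → ℝ) :
    Set C(Icc (0 : ℝ) T, GraphL2 w) :=
  {Φ | (⨆ t, sobolevNormSq w (Φ t)) + timeEnergy hT Φ ≤ ENNReal.ofReal M}

/-! ### The weight -/

/-- `γ(z,k) = ϑ(z)` with `ϑ : [0,∞) → (0,∞)` bounded and twice differentiable (one-sidedly at
`0`), `∑_k ∫_{I_k} √γ T_k dz < ∞`, and `z |ϑ''(z)| + √z |ϑ'(z)| ≤ C ϑ(z)` for `z ≥ 0`. -/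
structure WeightHyp {ℋ : Plane → ℝ} (γ : LevelGraph ℋ → ℝ) : Prop where
  profile : ∃ ϑ ϑ' ϑ'' : ℝ → ℝ,
    (∀ p, γ p = ϑ (height ℋ p)) ∧
    (∀ z, 0 ≤ z → 0 < ϑ z) ∧
    (∃ B, ∀ z, 0 ≤ z → ϑ z ≤ B) ∧
    (∀ z, 0 ≤ z → HasDerivWithinAt ϑ (ϑ' z) (Ici 0) z) ∧
    (∀ z, 0 ≤ z → HasDerivWithinAt ϑ' (ϑ'' z) (Ici 0) z) ∧
    ∃ C : ℝ, 0 < C ∧ ∀ z, 0 ≤ z → z * |ϑ'' z| + √z * |ϑ' z| ≤ C * ϑ z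
  integrable_sqrt :
    ∑' k : Edge ℋ, ∫⁻ z in k.interval, ENNReal.ofReal √(γ (k.point z)) * k.period z < ∞

/-- `lim_{R → ∞} sup_{z > R} γ(z, m) = 0` along the unbounded edge `m` of the graph. -/
def VanishesAtInfinity {ℋ : Plane → ℝ} (γ : LevelGraph ℋ → ℝ) : Prop :=
  ∀ m : Edge ℋ, ¬ BddAbove m.interval →
    Tendsto (fun R : ℝ => ⨆ p : {p : LevelGraph ℋ // p ∈ m.1 ∧ R < height ℋ p}, γ p)
      atTop (𝓝 0)

end

/-! The proof is Arzelà–Ascoli in `C([0,T]; L²_γ)`. Equicontinuity in time is cheap: a weak time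
derivative in `L²` makes a curve Hölder continuous of exponent 1/2
(`norm_sub_sq_le_of_timeEnergy_lt`). Since `γ = √γ √γ ≤ √B √γ` when `γ ≤ B`, the inclusion `L²_√γ →
L²_γ` is Lipschitz and keeps this modulus. What remains is that a Sobolev ball for the weight `√γ`
is totally bounded in `L²_γ` (`totallyBounded_sobolevBall`), and this rests on
`exists_discretization`, which cuts the plane into three regions. At infinity `γ = √γ √γ` with one
factor small, and the other is absorbed by the `L²_√γ` norm. Near critical levels inside a sublevel
set, the danger is that functions concentrate at the vertices. A curve through a point with gradient
of size `g` contains an arc of length of order `g` on which the gradient is of order `g`. Hence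
`T_k` is bounded below, and `α_k(z)` is at least of the order of the distance of `z` to the critical
values, because nondegenerate critical points make the gradient grow linearly. By Cauchy–Schwarz,
increments along an edge are controlled by the integral of the inverse distance, which gives `F² ≤ C
(1 + dist^(-1/4))` (`exists_profile_bound`). A layer of thickness `δ` around a level has area of
order `√δ` (`volume_layer_le`), so this majorant is integrable and thin layers contribute uniformly
little. On the rest of the sublevel set the profiles are uniformly equicontinuous along each of the
finitely many edges, so finitely many sampled values determine them up to a small error. Two bridges
are needed. Off the vertices the height is a local coordinate of the graph, so edges are open
intervals whose ends can only be critical values. Integrals over the plane are bounded by integrals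
over heights through one half of the coarea formula, up to a factor 3 (`lintegral_comp_height_le`).
-/

noncomputable section

open LevelGraph

/-! ### Smooth steps and weak derivatives on the line -/

/-- The primitive of a normalised bump function centred at `0`: a smooth step from `0` to `1`. -/
def bumpStep (φ : ContDiffBump (0 : ℝ)) (x : ℝ) : ℝ := ∫ y in (-φ.rOut)..x, φ.normed volume y

namespace bumpStep

variable (φ : ContDiffBump (0 : ℝ))

lemma hasDerivAt (x : ℝ) : HasDerivAt (bumpStep φ) (φ.normed volume x) x :=
  intervalIntegral.integral_hasDerivAt_right (φ.continuous_normed.intervalIntegrable _ _)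
    (φ.continuous_normed.stronglyMeasurableAtFilter _ _) φ.continuous_normed.continuousAt

lemma contDiff : ContDiff ℝ (⊤ : ℕ∞) (bumpStep φ) := by
  rw [contDiff_infty_iff_deriv]
  refine ⟨fun x => (hasDerivAt φ x).differentiableAt, ?_⟩
  rw [funext fun x => (hasDerivAt φ x).deriv]
  exact φ.contDiff_normed

lemma normed_eq_zero {y : ℝ} (hy : φ.rOut ≤ |y|) : φ.normed volume y = 0 := by
  have : y ∉ Function.support (φ.normed volume) := by
    rw [φ.support_normed_eq]
    simpa using hy
  simpa using this

lemma eq_zero {x : ℝ} (hx : x ≤ -φ.rOut) : bumpStep φ x = 0 := by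
  have h0 := φ.rOut_pos
  rw [bumpStep, intervalIntegral.integral_symm, intervalIntegral.integral_of_le hx,
    setIntegral_eq_zero_of_forall_eq_zero, neg_zero]
  intro y hy
  refine normed_eq_zero φ ?_
  rw [abs_of_nonpos (by linarith [hy.2])]
  linarith [hy.2]

lemma eq_one {x : ℝ} (hx : φ.rOut ≤ x) : bumpStep φ x = 1 := by
  have h0 := φ.rOut_pos
  rw [bumpStep, ← φ.integral_normed (μ := volume), intervalIntegral.integral_of_le (by linarith)]
  refine setIntegral_eq_integral_of_forall_compl_eq_zero fun y hy => ?_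
  refine normed_eq_zero φ ?_
  rw [le_abs]
  by_contra! h
  exact hy ⟨by linarith [h.2], by linarith [h.1]⟩

lemma monotone : Monotone (bumpStep φ) :=
  monotone_of_deriv_nonneg (fun x => (hasDerivAt φ x).differentiableAt)
    fun x => by rw [(hasDerivAt φ x).deriv]; exact φ.nonneg_normed x

lemma nonneg (x : ℝ) : 0 ≤ bumpStep φ x := by
  rcases le_total x (-φ.rOut) with h | h
  · rw [eq_zero φ h]
  · exact (eq_zero φ le_rfl).symm.le.trans (monotone φ h)

lemma le_one (x : ℝ) : bumpStep φ x ≤ 1 := by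
  rcases le_total x φ.rOut with h | h
  · exact (monotone φ h).trans (eq_one φ le_rfl).le
  · rw [eq_one φ h]

end bumpStep

/-- A sequence of bump functions on the line whose supports shrink to `0`. -/
def bumpSeq (n : ℕ) : ContDiffBump (0 : ℝ) where
  rIn := 1 / (n + 1 : ℝ) / 2
  rOut := 1 / (n + 1 : ℝ)
  rIn_pos := by positivity
  rIn_lt_rOut := half_lt_self (by positivity)

lemma tendsto_bumpSeq_rOut : Tendsto (fun n => (bumpSeq n).rOut) atTop (𝓝 0) :=
  tendsto_one_div_add_atTop_nhds_zero_nat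

lemma LocallyIntegrableOn.intervalIntegrable_of_ordConnected {F : Type*} [NormedAddCommGroup F]
    {I : Set ℝ} {v : ℝ → F} (hc : I.OrdConnected)
    (hv : LocallyIntegrableOn v I) {s t : ℝ} (hs : s ∈ I) (ht : t ∈ I) :
    IntervalIntegrable v volume s t :=
  (hv.integrableOn_compact_subset (hc.uIcc_subset hs ht) isCompact_uIcc).intervalIntegrable

section WeakDerivative

variable {F : Type*} [NormedAddCommGroup F] [NormedSpace ℝ F]
  {I : Set ℝ} {u v : ℝ → F}

/-- A weak derivative tested against a smoothed indicator of `[s, t]`. -/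
lemma HasWeakDerivOn.bumpStep_identity (hI : IsOpen I) (h : HasWeakDerivOn I u v)
    {a b s t : ℝ} (hab : Icc a b ⊆ I) (hst : s < t) (φ : ContDiffBump (0 : ℝ))
    (hs : a < s - φ.rOut) (ht : t + φ.rOut < b) :
    (∫ x, φ.normed volume (s - x) • (Icc a b).indicator u x)
      - (∫ x, φ.normed volume (t - x) • (Icc a b).indicator u x)
      = -∫ x in Icc a b, (bumpStep φ (x - s) - bumpStep φ (x - t)) • v x := by
  have h0 := φ.rOut_pos
  set θ : ℝ → ℝ := fun x => bumpStep φ (x - s) - bumpStep φ (x - t) with hθ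
  have hθd : ∀ x, HasDerivAt θ (φ.normed volume (x - s) - φ.normed volume (x - t)) x := fun x =>
    (((bumpStep.hasDerivAt φ (x - s)).comp_sub_const x s)).sub
      ((bumpStep.hasDerivAt φ (x - t)).comp_sub_const x t)
  have hsupp : ∀ x, x ∉ Icc (s - φ.rOut) (t + φ.rOut) → θ x = 0 := by
    intro x hx
    simp only [mem_Icc, not_and_or, not_le] at hx
    simp only [hθ]
    rcases hx with hx | hx
    · rw [bumpStep.eq_zero φ (by linarith), bumpStep.eq_zero φ (by linarith), sub_zero]
    · rw [bumpStep.eq_one φ (by linarith), bumpStep.eq_one φ (by linarith), sub_self]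
  have htsupp : tsupport θ ⊆ Icc (s - φ.rOut) (t + φ.rOut) :=
    closure_minimal (fun x hx => by_contra fun hx' => hx (hsupp x hx')) isClosed_Icc
  have hsub : Icc (s - φ.rOut) (t + φ.rOut) ⊆ Icc a b := Icc_subset_Icc hs.le ht.le
  have key := h.2.2 θ
    ((bumpStep.contDiff φ).comp (contDiff_id.sub contDiff_const) |>.sub
      ((bumpStep.contDiff φ).comp (contDiff_id.sub contDiff_const)))
    (HasCompactSupport.of_support_subset_isCompact isCompact_Icc
      ((subset_tsupport θ).trans htsupp)) (htsupp.trans (hsub.trans hab))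
  have hint : IntegrableOn u (Icc a b) := h.1.integrableOn_compact_subset hab isCompact_Icc
  have hU : Integrable ((Icc a b).indicator u) := hint.integrable_indicator measurableSet_Icc
  obtain ⟨B, hB⟩ : ∃ B, ∀ x, ‖φ.normed volume x‖ ≤ B :=
    φ.hasCompactSupport_normed.exists_bound_of_continuous φ.continuous_normed
  have hconv : ∀ r, Integrable fun x => φ.normed volume (r - x) • (Icc a b).indicator u x := by
    intro r
    refine hU.bdd_smul B ?_ ?_
    · exact (φ.continuous_normed.comp (continuous_const.sub continuous_id)).aestronglyMeasurable
    · exact Eventually.of_forall fun x => hB _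
  have hsym : ∀ r x, φ.normed volume (r - x) = φ.normed volume (x - r) := fun r x => by
    rw [← φ.normed_neg, neg_sub]
  rw [← integral_sub (hconv s) (hconv t)]
  have hd : ∀ x, x ∉ Icc (s - φ.rOut) (t + φ.rOut) → deriv θ x = 0 := fun x hx =>
    Function.notMem_support.1 fun hx' => hx (htsupp (support_deriv_subset hx'))
  have e1 : ∫ x in I, deriv θ x • u x
      = ∫ x, φ.normed volume (s - x) • (Icc a b).indicator u x
          - φ.normed volume (t - x) • (Icc a b).indicator u x := by
    rw [setIntegral_eq_of_subset_of_forall_sdiff_eq_zero hI.measurableSet hab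
      fun x hx => by rw [hd x fun hx' => hx.2 (hsub hx'), zero_smul],
      ← integral_indicator measurableSet_Icc]
    refine integral_congr_ae (Eventually.of_forall fun x => ?_)
    beta_reduce
    rw [← sub_smul, hsym s, hsym t, ← (hθd x).deriv]
    by_cases hx : x ∈ Icc a b <;> simp [hx]
  have e2 : ∫ x in I, θ x • v x = ∫ x in Icc a b, θ x • v x :=
    setIntegral_eq_of_subset_of_forall_sdiff_eq_zero hI.measurableSet hab
      fun x hx => by rw [hsupp x fun hx' => hx.2 (hsub hx'), zero_smul]
  rw [← e1, key, e2]

variable [CompleteSpace F]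

/-- Testing with a smoothed indicator of `[s, t]` compares mollifications of `u` at `s` and `t` with
a smoothed integral of `v`. As the smoothing shrinks, the former converge at almost every point and
the latter converges by domination. -/
lemma HasWeakDerivOn.ae_sub_eq_integral_of_Icc (hI : IsOpen I) (h : HasWeakDerivOn I u v)
    {a b : ℝ} (hab : Icc a b ⊆ I) :
    ∃ N : Set ℝ, volume N = 0 ∧ ∀ s ∈ Ioo a b \ N, ∀ t ∈ Ioo a b \ N, s < t →
      u t - u s = ∫ x in s..t, v x := by
  have hint : IntegrableOn u (Icc a b) := h.1.integrableOn_compact_subset hab isCompact_Icc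
  have hintv : IntegrableOn v (Icc a b) := h.2.1.integrableOn_compact_subset hab isCompact_Icc
  have hU : LocallyIntegrable ((Icc a b).indicator u) :=
    (hint.integrable_indicator measurableSet_Icc).locallyIntegrable
  -- The exceptional set is where the mollifications fail to converge; it does not depend on `s` and
  -- `t`. `K = 2` is the ratio of the outer to the inner radius of `bumpSeq`.
  have hae := ContDiffBump.ae_convolution_tendsto_right_of_locallyIntegrable (φ := bumpSeq)
    (l := atTop) (K := 2) tendsto_bumpSeq_rOut
    (Eventually.of_forall fun n => by simp only [bumpSeq]; linarith) hU
  refine ⟨_, hae, fun s hs t ht hst => ?_⟩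
  have hs' : Tendsto _ _ _ := not_not.1 hs.2
  have ht' : Tendsto _ _ _ := not_not.1 ht.2
  simp only [convolution_eq_swap, ContinuousLinearMap.lsmul_apply,
    indicator_of_mem (Ioo_subset_Icc_self hs.1), indicator_of_mem (Ioo_subset_Icc_self ht.1)]
    at hs' ht'
  have hlim := hs'.sub ht'
  have hsmall : ∀ {ε : ℝ}, 0 < ε → ∀ᶠ n in atTop, (bumpSeq n).rOut < ε := fun hε =>
    tendsto_bumpSeq_rOut.eventually_lt_const hε
  have hlim2 : Tendsto (fun n => -∫ x in Icc a b,
      (bumpStep (bumpSeq n) (x - s) - bumpStep (bumpSeq n) (x - t)) • v x) atTop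
      (𝓝 (-∫ x in Icc a b, (Ioc s t).indicator v x)) := by
    refine (tendsto_integral_filter_of_dominated_convergence (fun x => ‖v x‖) ?_ ?_
      hintv.norm ?_).neg
    · refine Eventually.of_forall fun n => AEStronglyMeasurable.smul ?_ hintv.1
      exact (((bumpStep.contDiff _).continuous.comp (continuous_id.sub continuous_const)).sub
        ((bumpStep.contDiff _).continuous.comp
          (continuous_id.sub continuous_const))).aestronglyMeasurable
    · refine Eventually.of_forall fun n => Eventually.of_forall fun x => ?_
      rw [norm_smul]
      refine mul_le_of_le_one_left (norm_nonneg _) ?_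
      rw [Real.norm_eq_abs, abs_le]
      constructor <;> linarith [bumpStep.nonneg (bumpSeq n) (x - s),
        bumpStep.nonneg (bumpSeq n) (x - t), bumpStep.le_one (bumpSeq n) (x - s),
        bumpStep.le_one (bumpSeq n) (x - t)]
    · have hne : ∀ᵐ x ∂(volume.restrict (Icc a b)), x ≠ s ∧ x ≠ t :=
        ae_restrict_of_ae ((Measure.ae_ne _ s).and (Measure.ae_ne _ t))
      filter_upwards [hne] with x hx
      refine tendsto_const_nhds.congr' ?_
      filter_upwards [hsmall (abs_pos.2 (sub_ne_zero.2 hx.1)),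
        hsmall (abs_pos.2 (sub_ne_zero.2 hx.2))] with n h1 h2
      have hx1 := hx.1
      have hx2 := hx.2
      rcases lt_or_gt_of_ne hx.1 with h3 | h3
      · rw [abs_of_neg (by linarith)] at h1
        rw [abs_of_neg (by linarith)] at h2
        rw [bumpStep.eq_zero _ (by linarith), bumpStep.eq_zero _ (by linarith),
          indicator_of_notMem (show x ∉ Ioc s t from fun h => by linarith [h.1])]
        simp
      · rw [abs_of_pos (by linarith)] at h1
        rw [bumpStep.eq_one _ h1.le]
        rcases lt_or_gt_of_ne hx.2 with h4 | h4
        · rw [abs_of_neg (by linarith)] at h2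
          rw [bumpStep.eq_zero _ (by linarith), indicator_of_mem (show x ∈ Ioc s t from ⟨h3, h4.le⟩)]
          simp
        · rw [abs_of_pos (by linarith)] at h2
          rw [bumpStep.eq_one _ h2.le,
            indicator_of_notMem (show x ∉ Ioc s t from fun h => by linarith [h.2])]
          simp
  have heq : ∀ᶠ n in atTop, (∫ x, (bumpSeq n).normed volume (s - x) • (Icc a b).indicator u x)
      - (∫ x, (bumpSeq n).normed volume (t - x) • (Icc a b).indicator u x)
      = -∫ x in Icc a b, (bumpStep (bumpSeq n) (x - s) - bumpStep (bumpSeq n) (x - t)) • v x := by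
    filter_upwards [hsmall (sub_pos.2 hs.1.1), hsmall (sub_pos.2 ht.1.2)] with n h1 h2
    exact h.bumpStep_identity hI hab hst _ (by linarith) (by linarith)
  have huniq := tendsto_nhds_unique (hlim.congr' heq) hlim2
  have hsub : Ioc s t ⊆ Icc a b :=
    fun x hx => ⟨hs.1.1.le.trans hx.1.le, hx.2.trans ht.1.2.le⟩
  rw [setIntegral_indicator measurableSet_Ioc, inter_eq_self_of_subset_right hsub,
    ← intervalIntegral.integral_of_le hst.le] at huniq
  rw [← neg_sub, huniq, neg_neg]

/-- A function with a weak derivative on an open interval satisfies the fundamental theorem of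
calculus off a null set. -/
theorem HasWeakDerivOn.ae_sub_eq_integral (hI : IsOpen I) (hc : I.OrdConnected)
    (h : HasWeakDerivOn I u v) :
    ∃ N : Set ℝ, volume N = 0 ∧ ∀ s ∈ I \ N, ∀ t ∈ I \ N, u t - u s = ∫ x in s..t, v x := by
  -- There are countably many rational compact intervals, so their exceptional sets form one null
  -- set, and any two points of `I` are interior to one of them.
  choose! N hN hN' using fun (p : ℚ × ℚ) (hp : Icc (p.1 : ℝ) p.2 ⊆ I) =>
    h.ae_sub_eq_integral_of_Icc hI hp
  refine ⟨⋃ p ∈ {p : ℚ × ℚ | Icc (p.1 : ℝ) p.2 ⊆ I}, N p,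
    (measure_biUnion_null_iff (Set.to_countable _)).2 hN, ?_⟩
  have main : ∀ s ∈ I \ (⋃ p ∈ {p : ℚ × ℚ | Icc (p.1 : ℝ) p.2 ⊆ I}, N p),
      ∀ t ∈ I \ (⋃ p ∈ {p : ℚ × ℚ | Icc (p.1 : ℝ) p.2 ⊆ I}, N p), s < t →
      u t - u s = ∫ x in s..t, v x := by
    rintro s ⟨hs, hsN⟩ t ⟨ht, htN⟩ hst
    obtain ⟨l, hl, hl'⟩ := (mem_nhdsLE_iff_exists_Ioc_subset).1
      (mem_nhdsWithin_of_mem_nhds (hI.mem_nhds hs))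
    obtain ⟨r, hr, hr'⟩ := (mem_nhdsGE_iff_exists_Ico_subset).1
      (mem_nhdsWithin_of_mem_nhds (hI.mem_nhds ht))
    obtain ⟨p, hp1, hp2⟩ := exists_rat_btwn (mem_Iio.1 hl)
    obtain ⟨q, hq1, hq2⟩ := exists_rat_btwn (mem_Ioi.1 hr)
    have hpq : Icc (p : ℝ) q ⊆ I := hc.out (hl' ⟨hp1, hp2.le⟩) (hr' ⟨hq1.le, hq2⟩)
    simp only [mem_iUnion, not_exists] at hsN htN
    exact hN' (p, q) hpq s ⟨⟨hp2, hst.trans hq1⟩, hsN (p, q) hpq⟩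
      t ⟨⟨hp2.trans hst, hq1⟩, htN (p, q) hpq⟩ hst
  intro s hs t ht
  rcases lt_trichotomy s t with hst | rfl | hst
  · exact main s hs t ht hst
  · simp
  · rw [intervalIntegral.integral_symm, ← main t ht s hs hst, neg_sub]

/-- A function with a weak derivative on an open interval agrees almost everywhere with a
primitive of the weak derivative. -/
theorem HasWeakDerivOn.exists_primitive (hI : IsOpen I) (hc : I.OrdConnected)
    (h : HasWeakDerivOn I u v) :
    ∃ G : ℝ → F, ContinuousOn G I ∧ (∀ᵐ x, x ∈ I → u x = G x) ∧
      ∀ s ∈ I, ∀ t ∈ I, G t - G s = ∫ x in s..t, v x := by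
  obtain ⟨N, hN, hN'⟩ := h.ae_sub_eq_integral hI hc
  rcases I.eq_empty_or_nonempty with rfl | hne
  · exact ⟨u, by simp, by simp, by simp⟩
  -- The base point avoids `N`, so that `u c` itself is the right constant of integration.
  obtain ⟨c, hc', hcN⟩ : (I \ N).Nonempty := by
    refine nonempty_of_measure_ne_zero (μ := volume) ?_
    rw [measure_sdiff_null hN]
    exact (hI.measure_pos _ hne).ne'
  have hii : ∀ {s t}, s ∈ I → t ∈ I → IntervalIntegrable v volume s t := fun hs ht =>
    LocallyIntegrableOn.intervalIntegrable_of_ordConnected hc h.2.1 hs ht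
  refine ⟨fun x => u c + ∫ y in c..x, v y, ?_, ?_, ?_⟩
  · refine continuousOn_const.add fun x hx => ContinuousAt.continuousWithinAt ?_
    obtain ⟨l, r, hlr, hlr'⟩ := (mem_nhds_iff_exists_Ioo_subset).1 (hI.mem_nhds hx)
    obtain ⟨l', hl1, hl2⟩ := exists_between hlr.1
    obtain ⟨r', hr1, hr2⟩ := exists_between hlr.2
    have hcont := intervalIntegral.continuousOn_primitive_interval' (a := c)
      (hii (hlr' ⟨hl1, (hl2.trans hr1).trans hr2⟩) (hlr' ⟨hl1.trans (hl2.trans hr1), hr2⟩))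
    have : ∀ y ∈ Icc l' r', ∫ z in c..y, v z = (∫ z in c..x, v z) + ∫ z in x..y, v z := by
      intro y hy
      exact (intervalIntegral.integral_add_adjacent_intervals (hii hc' hx)
        (hii hx (hlr' ⟨hl1.trans_le hy.1, hy.2.trans_lt hr2⟩))).symm
    have hcont' := intervalIntegral.continuousOn_primitive_interval' (a := x)
      (hii (hlr' ⟨hl1, (hl2.trans hr1).trans hr2⟩) (hlr' ⟨hl1.trans (hl2.trans hr1), hr2⟩))
      (by rw [uIcc_of_le (hl2.trans hr1).le]; exact ⟨hl2.le, hr1.le⟩)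
    rw [uIcc_of_le (hl2.trans hr1).le] at hcont'
    exact ((continuousOn_const.add hcont').congr this).continuousAt (Icc_mem_nhds hl2 hr1)
  · filter_upwards [measure_eq_zero_iff_ae_notMem.1 hN] with x hx hxI
    rw [← hN' c ⟨hc', hcN⟩ x ⟨hxI, hx⟩, add_sub_cancel]
  · intro s hs t ht
    rw [add_sub_add_left_eq_sub, intervalIntegral.integral_interval_sub_left (hii hc' ht)
      (hii hc' hs)]

/-- The fundamental theorem of calculus for a continuous function with a weak derivative. -/
theorem HasWeakDerivOn.sub_eq_integral (hI : IsOpen I) (hc : I.OrdConnected)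
    (h : HasWeakDerivOn I u v) (hu : ContinuousOn u I) {s t : ℝ} (hs : s ∈ I) (ht : t ∈ I) :
    u t - u s = ∫ x in s..t, v x := by
  obtain ⟨G, hG, hGu, hG'⟩ := h.exists_primitive hI hc
  have : EqOn u G I := Measure.eqOn_open_of_ae_eq (μ := volume)
    ((ae_restrict_iff' hI.measurableSet).2 hGu) hI hu hG
  rw [this hs, this ht, hG' s hs t ht]

end WeakDerivative

end

noncomputable section

open LevelGraph

/-! ### First consequences of the hypotheses on the Hamiltonian -/

lemma range_fderiv_eq_top_of_gradient_ne_zero {ℋ : Plane → ℝ} {x : Plane}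
    (hx : gradient ℋ x ≠ 0) : (fderiv ℝ ℋ x).range = ⊤ := by
  refine LinearMap.range_eq_top.2 (LinearMap.surjective fun h => hx ?_)
  have : fderiv ℝ ℋ x = 0 := ContinuousLinearMap.coe_injective h
  rw [gradient, this, map_zero]

namespace HamiltonianHyp

variable {ℋ : Plane → ℝ} (hℋ : HamiltonianHyp ℋ)
include hℋ

lemma continuous : Continuous ℋ := hℋ.contDiff.continuous

lemma differentiable : Differentiable ℝ ℋ := hℋ.contDiff.differentiable (by norm_num)

lemma hasGradientAt (x : Plane) : HasGradientAt ℋ (gradient ℋ x) x :=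
  (hℋ.differentiable x).hasGradientAt

lemma contDiff_gradient : ContDiff ℝ 3 (gradient ℋ) := by
  have h : ContDiff ℝ 3 (fderiv ℝ ℋ) := hℋ.contDiff.fderiv_right (by norm_num)
  exact (InnerProductSpace.toDual ℝ Plane).symm.contDiff.comp h

lemma continuous_gradient : Continuous (gradient ℋ) := hℋ.contDiff_gradient.continuous

lemma differentiable_gradient : Differentiable ℝ (gradient ℋ) :=
  hℋ.contDiff_gradient.differentiable (by norm_num)

lemma nonneg (x : Plane) : 0 ≤ ℋ x := hℋ.min_eq_zero.2 (mem_range_self x)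

/-- The gradient is globally Lipschitz. -/
lemma exists_gradient_lipschitz :
    ∃ K : ℝ, 0 < K ∧ ∀ x y, ‖gradient ℋ y - gradient ℋ x‖ ≤ K * ‖y - x‖ := by
  obtain ⟨C, hC⟩ := hℋ.bounded_hessian
  refine ⟨max C 1, by positivity, fun x y => ?_⟩
  exact convex_univ.norm_image_sub_le_of_norm_fderiv_le
    (fun z _ => hℋ.differentiable_gradient z) (fun z _ => (hC z).trans (le_max_left _ _))
    (mem_univ x) (mem_univ y)

lemma isCompact_sublevel (R : ℝ) : IsCompact {x | ℋ x ≤ R} := by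
  obtain ⟨a₁, a₂, a₃, r, h1, -, -, h⟩ := hℋ.growth
  refine Metric.isCompact_of_isClosed_isBounded
    (isClosed_le hℋ.continuous continuous_const) ?_
  refine (Metric.isBounded_closedBall (x := (0 : Plane)) (r := max r (√(R / a₁)))).subset ?_
  intro x hx
  rw [mem_closedBall_zero_iff, le_max_iff]
  by_contra! hlt
  have h2 := (h x hlt.1.le).1
  have h3 : ‖x‖ ^ 2 ≤ R / a₁ := by
    rw [le_div_iff₀ h1]
    linarith [show ℋ x ≤ R from hx]
  have := Real.le_sqrt_of_sq_le h3
  linarith [hlt.2]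

lemma isCompact_level (z : ℝ) : IsCompact {x | ℋ x = z} :=
  (hℋ.isCompact_sublevel z).of_isClosed_subset (isClosed_eq hℋ.continuous continuous_const)
    fun _ hx => le_of_eq hx

lemma exists_le (z : ℝ) : ∃ x, z ≤ ℋ x := by
  obtain ⟨a₁, a₂, a₃, r, h1, -, -, h⟩ := hℋ.growth
  obtain ⟨e, he⟩ : ∃ e : Plane, ‖e‖ = 1 := ⟨EuclideanSpace.single 0 1, by simp⟩
  set s := max (max r 1) (z / a₁)
  have hs1 : 1 ≤ s := (le_max_right _ _).trans (le_max_left _ _)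
  have hn : ‖s • e‖ = s := by rw [norm_smul, he, mul_one, Real.norm_of_nonneg (by linarith)]
  refine ⟨s • e, ?_⟩
  have h2 := (h (s • e) (by rw [hn]; exact (le_max_left _ _).trans (le_max_left _ _))).1
  rw [hn] at h2
  have h3 : z / a₁ ≤ s := le_max_right _ _
  rw [div_le_iff₀ h1] at h3
  nlinarith [mul_le_mul_of_nonneg_left (le_self_pow₀ hs1 two_ne_zero) h1.le]

/-- Every value between `0` and any larger value is attained. -/
lemma exists_eq {z : ℝ} (hz : 0 ≤ z) : ∃ x, ℋ x = z := by
  obtain ⟨x₀, hx₀⟩ := hℋ.min_eq_zero.1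
  obtain ⟨x₁, hx₁⟩ := hℋ.exists_le z
  obtain ⟨x, -, hx⟩ := isPreconnected_univ.intermediate_value (mem_univ x₀) (mem_univ x₁)
    hℋ.continuous.continuousOn ⟨hx₀.trans_le hz, hx₁⟩
  exact ⟨x, hx⟩

lemma hasStrictFDerivAt (x : Plane) : HasStrictFDerivAt ℋ (fderiv ℝ ℋ x) x :=
  (hℋ.contDiff.contDiffAt).hasStrictFDerivAt (by norm_num)

/-- `ℋ` is open near a non-critical point. -/
lemma map_nhds_eq {x : Plane} (hx : gradient ℋ x ≠ 0) : map ℋ (𝓝 x) = 𝓝 (ℋ x) :=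
  (hℋ.hasStrictFDerivAt x).map_nhds_eq_of_surj (range_fderiv_eq_top_of_gradient_ne_zero hx)

/-- Near a non-critical point the level sets of `ℋ` are connected: there are arbitrarily small
neighbourhoods that meet every level set in a connected set. -/
lemma exists_box {x : Plane} (hx : gradient ℋ x ≠ 0) :
    ∃ B : Set Plane, IsOpen B ∧ x ∈ B ∧ (∀ y ∈ B, gradient ℋ y ≠ 0) ∧
      ∀ z, IsPreconnected (B ∩ {y | ℋ y = z}) := by
  have hs := hℋ.hasStrictFDerivAt x
  have hr := range_fderiv_eq_top_of_gradient_ne_zero hx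
  -- This chart straightens `ℋ` into its first coordinate, so inside a small ball of the target
  -- level sets are convex slices.
  set e := hs.implicitToOpenPartialHomeomorph ℋ _ hr
  have hxs : x ∈ e.source := hs.mem_implicitToOpenPartialHomeomorph_source hr
  have hfst : ∀ y, (e y).1 = ℋ y := fun y => hs.implicitToOpenPartialHomeomorph_fst hr y
  have hopen : IsOpen {y | gradient ℋ y ≠ 0} := isOpen_ne.preimage hℋ.continuous_gradient
  have hV : e.target ∩ e.symm ⁻¹' {y | gradient ℋ y ≠ 0} ∈ 𝓝 (e x) :=
    (e.isOpen_inter_preimage_symm hopen).mem_nhds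
      ⟨e.map_source hxs, by simpa [e.left_inv hxs] using hx⟩
  obtain ⟨r, hr0, hball⟩ := Metric.mem_nhds_iff.1 hV
  refine ⟨e.source ∩ e ⁻¹' Metric.ball (e x) r, e.isOpen_inter_preimage Metric.isOpen_ball,
    ⟨hxs, Metric.mem_ball_self hr0⟩, fun y hy => ?_, fun z => ?_⟩
  · have := (hball hy.2).2
    simpa [e.left_inv hy.1] using this
  · have himg : e.source ∩ e ⁻¹' Metric.ball (e x) r ∩ {y | ℋ y = z}
        = e.symm '' (({z} ×ˢ univ) ∩ Metric.ball (e x) r) := by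
      ext y
      constructor
      · rintro ⟨⟨h1, h2⟩, h3⟩
        exact ⟨e y, ⟨⟨by rw [mem_singleton_iff, hfst]; exact h3, trivial⟩, h2⟩, e.left_inv h1⟩
      · rintro ⟨p, ⟨h1, h2⟩, rfl⟩
        have hp := (hball h2).1
        refine ⟨⟨e.map_target hp, by simpa [e.right_inv hp] using h2⟩, ?_⟩
        have := hfst (e.symm p)
        rw [e.right_inv hp] at this
        exact this.symm.trans h1.1
    rw [himg]
    refine IsPreconnected.image ?_ _ (e.continuousOn_symm.mono fun p hp => (hball hp.2).1)
    exact (((convex_singleton z).prod convex_univ).inter (convex_ball _ _)).isPreconnected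

end HamiltonianHyp

end

noncomputable section

open LevelGraph

/-! ### The topology of the graph of level components -/

namespace LevelGraph

variable {ℋ : Plane → ℝ}

@[simp] lemma height_proj (x : Plane) : height ℋ (proj ℋ x) = ℋ x := rfl

lemma isQuotientMap_proj : IsQuotientMap (proj ℋ) := isQuotientMap_quotient_mk'

lemma continuous_proj : Continuous (proj ℋ) := isQuotientMap_proj.continuous

lemma surjective_proj : Function.Surjective (proj ℋ) := isQuotientMap_proj.surjective

lemma continuous_height (hc : Continuous ℋ) : Continuous (height ℋ) :=
  isQuotientMap_proj.continuous_iff.2 hc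

lemma proj_eq_iff {x y : Plane} :
    proj ℋ x = proj ℋ y ↔ ℋ y = ℋ x ∧ y ∈ connectedComponentIn {w | ℋ w = ℋ x} x :=
  Quotient.eq (r := levelSetoid ℋ)

lemma proj_eq_of_isPreconnected {S : Set Plane} {z : ℝ} (hS : IsPreconnected S)
    (hz : ∀ y ∈ S, ℋ y = z) {x y : Plane} (hx : x ∈ S) (hy : y ∈ S) : proj ℋ x = proj ℋ y :=
  proj_eq_iff.2 ⟨(hz y hy).trans (hz x hx).symm,
    hS.subset_connectedComponentIn hx (fun w hw => (hz w hw).trans (hz x hx).symm) hy⟩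

lemma gradient_ne_zero_of_proj {x : Plane} (hx : proj ℋ x ∉ vertices ℋ) : gradient ℋ x ≠ 0 :=
  fun h => hx (mem_image_of_mem _ h)

lemma isCompact_component (hℋ : HamiltonianHyp ℋ) (x : Plane) :
    IsCompact (connectedComponentIn {w | ℋ w = ℋ x} x) := by
  refine (hℋ.isCompact_level (ℋ x)).of_isClosed_subset ?_ (connectedComponentIn_subset _ _)
  rw [connectedComponentIn_eq_image (show x ∈ {w | ℋ w = ℋ x} from rfl)]
  exact (isClosed_eq hℋ.continuous continuous_const).isClosedEmbedding_subtypeVal.isClosedMap _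
    isClosed_connectedComponent

lemma eq_of_mem_component {x y : Plane} (hy : y ∈ connectedComponentIn {w | ℋ w = ℋ x} x) :
    ℋ y = ℋ x := by
  have : y ∈ {w | ℋ w = ℋ x} := connectedComponentIn_subset _ _ hy
  exact this

lemma proj_eq_of_mem_component {x y : Plane}
    (hy : y ∈ connectedComponentIn {w | ℋ w = ℋ x} x) : proj ℋ x = proj ℋ y :=
  proj_eq_iff.2 ⟨eq_of_mem_component hy, hy⟩

/-- Nearby points of the same height, close to two points of a component without critical
points, lie in the same component. -/
lemma eventually_proj_eq (hℋ : HamiltonianHyp ℋ) {x : Plane} (hx : proj ℋ x ∉ vertices ℋ)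
    {a b : Plane} (ha : a ∈ connectedComponentIn {w | ℋ w = ℋ x} x)
    (hb : b ∈ connectedComponentIn {w | ℋ w = ℋ x} x) :
    ∀ᶠ p in 𝓝 a ×ˢ 𝓝 b, ℋ p.1 = ℋ p.2 → proj ℋ p.1 = proj ℋ p.2 := by
  have hgrad : ∀ y ∈ connectedComponentIn {w | ℋ w = ℋ x} x, gradient ℋ y ≠ 0 := fun y hy => by
    refine gradient_ne_zero_of_proj ?_
    rwa [← proj_eq_of_mem_component hy]
  have hval : ∀ y ∈ connectedComponentIn {w | ℋ w = ℋ x} x, ℋ y = ℋ x := fun y hy =>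
    eq_of_mem_component hy
  -- On a connected set a relation that holds locally and is transitive holds everywhere. Locally it
  -- follows from a box.
  refine isPreconnected_connectedComponentIn.induction₂'
    (fun a b => ∀ᶠ p in 𝓝 a ×ˢ 𝓝 b, ℋ p.1 = ℋ p.2 → proj ℋ p.1 = proj ℋ p.2) ?_ ?_ ha hb
  · intro y hy
    obtain ⟨B, hB, hyB, -, hB'⟩ := hℋ.exists_box (hgrad y hy)
    have key : ∀ w ∈ B, ∀ w' ∈ B, ∀ᶠ p in 𝓝 w ×ˢ 𝓝 w', ℋ p.1 = ℋ p.2 →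
        proj ℋ p.1 = proj ℋ p.2 := fun w hw w' hw' => by
      filter_upwards [prod_mem_prod (hB.mem_nhds hw) (hB.mem_nhds hw')] with p hp hpe
      exact proj_eq_of_isPreconnected (hB' (ℋ p.1)) (fun y hy => hy.2) ⟨hp.1, rfl⟩
        ⟨hp.2, hpe.symm⟩
    filter_upwards [mem_nhdsWithin_of_mem_nhds (hB.mem_nhds hyB)] with w hw
    exact ⟨key y hyB w hw, key w hw y hyB⟩
  · intro a b c ha hb hc hab hbc
    obtain ⟨A, hA, B, hB, hAB⟩ := mem_prod_iff.1 hab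
    obtain ⟨B', hB', D, hD, hBD⟩ := mem_prod_iff.1 hbc
    -- Transitivity needs an intermediate point near `b` at the height of `p`; it exists because `ℋ`
    -- is open at `b`.
    have hopen : ℋ '' (B ∩ B') ∈ 𝓝 (ℋ b) := by
      rw [← hℋ.map_nhds_eq (hgrad b hb)]
      exact image_mem_map (inter_mem hB hB')
    have hA' : A ∩ ℋ ⁻¹' (ℋ '' (B ∩ B')) ∈ 𝓝 a := by
      refine inter_mem hA (hℋ.continuous.continuousAt ?_)
      rwa [hval a ha, ← hval b hb]
    filter_upwards [prod_mem_prod hA' hD] with p hp hpe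
    obtain ⟨⟨hpA, w, hw, hwe⟩, hpD⟩ := hp
    exact (hAB (mk_mem_prod hpA hw.1) hwe.symm).trans
      (hBD (mk_mem_prod hw.2 hpD) (hwe.trans hpe))

/-- A saturated neighbourhood of a component without critical points, inside a prescribed open
set, in which every level set is a single component. -/
lemma exists_saturated_nhds (hℋ : HamiltonianHyp ℋ) {x : Plane} (hx : proj ℋ x ∉ vertices ℋ)
    {O : Set Plane} (hO : IsOpen O) (hCO : connectedComponentIn {w | ℋ w = ℋ x} x ⊆ O) :
    ∃ W : Set Plane, IsOpen W ∧ W ⊆ O ∧ x ∈ W ∧ (∀ y ∈ W, gradient ℋ y ≠ 0) ∧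
      (∀ y ∈ W, ∀ y', proj ℋ y = proj ℋ y' → y' ∈ W) ∧
      (∀ y ∈ W, ∀ y' ∈ W, ℋ y = ℋ y' → proj ℋ y = proj ℋ y') ∧ IsPreconnected (ℋ '' W) := by
  set C := connectedComponentIn {w | ℋ w = ℋ x} x with hC
  have hCc : IsCompact C := isCompact_component hℋ x
  have hxC : x ∈ C := mem_connectedComponentIn rfl
  have hgrad : ∀ y ∈ C, gradient ℋ y ≠ 0 := fun y hy => by
    refine gradient_ne_zero_of_proj ?_
    rwa [← proj_eq_of_mem_component hy]
  -- Compactness of `C` turns the pointwise statement into one neighbourhood of `C` in which equal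
  -- height implies equal component.
  have hnear : {p : Plane × Plane | ℋ p.1 = ℋ p.2 → proj ℋ p.1 = proj ℋ p.2} ∈ 𝓝ˢ C ×ˢ 𝓝ˢ C := by
    rw [← hCc.nhdsSet_prod_eq hCc, mem_nhdsSet_iff_forall]
    rintro ⟨a, b⟩ ⟨ha, hb⟩
    rw [nhds_prod_eq]
    exact eventually_proj_eq hℋ hx ha hb
  obtain ⟨Q, hQ, hQ'⟩ := mem_prod_self_iff.1 hnear
  obtain ⟨N, hN, hCN, hNsub, hNc⟩ := exists_open_between_and_isCompact_closure hCc
    ((isOpen_interior (s := Q)).inter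
      (hO.inter (isOpen_ne.preimage hℋ.continuous_gradient)))
    (subset_inter (subset_interior_iff_mem_nhdsSet.2 hQ) (subset_inter hCO hgrad))
  have hNQ : ∀ y ∈ closure N, ∀ y' ∈ closure N, ℋ y = ℋ y' → proj ℋ y = proj ℋ y' :=
    fun y hy y' hy' => @hQ' (y, y')
      ⟨interior_subset (hNsub hy).1, interior_subset (hNsub hy').1⟩
  -- A frontier point at height `ℋ x` would belong to `C`, which lies inside the open set `N`.
  have hfr : ℋ x ∉ ℋ '' frontier N := by
    rintro ⟨y, hy, hyx⟩
    have := hNQ x (subset_closure (hCN hxC)) y (frontier_subset_closure hy) hyx.symm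
    rw [hN.frontier_eq] at hy
    exact hy.2 (hCN (proj_eq_iff.1 this).2)
  have hfrc : IsClosed (ℋ '' frontier N) :=
    ((hNc.of_isClosed_subset isClosed_frontier frontier_subset_closure).image
      hℋ.continuous).isClosed
  -- Heights within `ε` are avoided on the frontier, so components cannot leave `N` and the set is
  -- saturated; they are also attained in `N`, so the image of heights is a full interval.
  obtain ⟨ε, hε, hball⟩ := Metric.mem_nhds_iff.1 (inter_mem (hfrc.isOpen_compl.mem_nhds hfr)
    (show ℋ '' N ∈ 𝓝 (ℋ x) by
      rw [← hℋ.map_nhds_eq (hgrad x hxC)]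
      exact image_mem_map (hN.mem_nhds (hCN hxC))))
  refine ⟨N ∩ ℋ ⁻¹' Metric.ball (ℋ x) ε, hN.inter (Metric.isOpen_ball.preimage hℋ.continuous),
    fun y hy => (hNsub (subset_closure hy.1)).2.1, ⟨hCN hxC, Metric.mem_ball_self hε⟩,
    fun y hy => (hNsub (subset_closure hy.1)).2.2, fun y hy y' hyy' => ?_,
    fun y hy y' hy' => hNQ y (subset_closure hy.1) y' (subset_closure hy'.1), ?_⟩
  · rw [proj_eq_iff] at hyy'
    refine ⟨?_, by rw [mem_preimage, hyy'.1]; exact hy.2⟩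
    have hsub : connectedComponentIn {w | ℋ w = ℋ y} y ⊆ N := by
      refine isPreconnected_connectedComponentIn.subset_left_of_subset_union hN
        (isClosed_closure (s := N)).isOpen_compl ?_ ?_ ⟨y, mem_connectedComponentIn rfl, hy.1⟩
      · exact disjoint_compl_right.mono_left subset_closure
      · intro w hw
        by_contra hw'
        simp only [mem_union, mem_compl_iff, not_or, not_not] at hw'
        refine (hball hy.2).1 ⟨w, ?_, eq_of_mem_component hw⟩
        rw [hN.frontier_eq]
        exact ⟨hw'.2, hw'.1⟩
    exact hsub hyy'.2
  · have : ℋ '' (N ∩ ℋ ⁻¹' Metric.ball (ℋ x) ε) = Metric.ball (ℋ x) ε := by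
      rw [image_inter_preimage]
      exact inter_eq_self_of_subset_right fun z hz => (hball hz).2
    rw [this]
    exact (convex_ball _ _).isPreconnected

/-- Saturated open sets have open images in the graph. -/
lemma isOpen_proj_image {W : Set Plane} (hW : IsOpen W)
    (hsat : ∀ y ∈ W, ∀ y', proj ℋ y = proj ℋ y' → y' ∈ W) : IsOpen (proj ℋ '' W) := by
  rw [← isQuotientMap_proj.isOpen_preimage]
  convert hW using 1
  exact Subset.antisymm (fun y ⟨w, hw, hwy⟩ => hsat w hw y hwy) (subset_preimage_image _ _)

/-- The height is an open map off the vertices. -/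
lemma isOpen_height_image (hℋ : HamiltonianHyp ℋ) {U : Set (LevelGraph ℋ)} (hU : IsOpen U)
    (hUV : U ⊆ (vertices ℋ)ᶜ) : IsOpen (height ℋ '' U) := by
  rw [isOpen_iff_mem_nhds]
  rintro _ ⟨p, hp, rfl⟩
  obtain ⟨x, rfl⟩ := surjective_proj p
  rw [height_proj, ← hℋ.map_nhds_eq (gradient_ne_zero_of_proj (hUV hp))]
  filter_upwards [image_mem_map ((hU.preimage continuous_proj).mem_nhds hp)]
  rintro _ ⟨y, hy, rfl⟩
  exact ⟨_, hy, rfl⟩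

/-- An open connected piece of the graph without vertices on which the height is injective. -/
structure IsSheet (A : Set (LevelGraph ℋ)) : Prop where
  isOpen : IsOpen A
  subset : A ⊆ (vertices ℋ)ᶜ
  isPreconnected : IsPreconnected A
  injOn : InjOn (height ℋ) A

/-- On the image of a saturated neighbourhood the height is injective, continuous and open, so
connectedness is pulled back from the interval of heights. The control by `O` serves to separate
distinct components. -/
lemma exists_isSheet_subset (hℋ : HamiltonianHyp ℋ) {x : Plane} (hx : proj ℋ x ∉ vertices ℋ)
    {O : Set Plane} (hO : IsOpen O) (hCO : connectedComponentIn {w | ℋ w = ℋ x} x ⊆ O) :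
    ∃ A : Set (LevelGraph ℋ), IsSheet A ∧ proj ℋ x ∈ A ∧ proj ℋ ⁻¹' A ⊆ O := by
  obtain ⟨W, hW, hWO, hxW, hWg, hsat, hinj, hconn⟩ := exists_saturated_nhds hℋ hx hO hCO
  have hopen : IsOpen (proj ℋ '' W) := isOpen_proj_image hW hsat
  have hV : proj ℋ '' W ⊆ (vertices ℋ)ᶜ := by
    rintro _ ⟨y, hy, rfl⟩ ⟨c, hc, hcy⟩
    exact hWg c (hsat y hy c hcy.symm) hc
  have hinj' : InjOn (height ℋ) (proj ℋ '' W) := by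
    rintro _ ⟨y, hy, rfl⟩ _ ⟨y', hy', rfl⟩ h
    exact hinj y hy y' hy' h
  have him : height ℋ '' (proj ℋ '' W) = ℋ '' W := by
    rw [image_image]; rfl
  refine ⟨proj ℋ '' W, ⟨hopen, hV, ?_, hinj'⟩, mem_image_of_mem _ hxW, ?_⟩
  · rintro u v hu hv huv ⟨p, hp, hpu⟩ ⟨q, hq, hqv⟩
    rw [← him] at hconn
    obtain ⟨_, -, ⟨a, ha, rfl⟩, b, hb, hba⟩ := hconn _ _
      (isOpen_height_image hℋ (hopen.inter hu) (inter_subset_left.trans hV))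
      (isOpen_height_image hℋ (hopen.inter hv) (inter_subset_left.trans hV))
      (by rw [← image_union, ← inter_union_distrib_left, inter_eq_self_of_subset_left huv])
      ⟨_, mem_image_of_mem _ hp, mem_image_of_mem _ ⟨hp, hpu⟩⟩
      ⟨_, mem_image_of_mem _ hq, mem_image_of_mem _ ⟨hq, hqv⟩⟩
    rw [hinj' hb.1 ha.1 hba] at hb
    exact ⟨a, ha.1, ha.2, hb.2⟩
  · rintro y ⟨w, hw, hwy⟩
    exact hWO (hsat w hw y hwy)

lemma exists_isSheet (hℋ : HamiltonianHyp ℋ) {p : LevelGraph ℋ} (hp : p ∉ vertices ℋ) :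
    ∃ A : Set (LevelGraph ℋ), IsSheet A ∧ p ∈ A := by
  obtain ⟨x, rfl⟩ := surjective_proj p
  obtain ⟨A, hA, hxA, -⟩ := exists_isSheet_subset hℋ hp isOpen_univ (subset_univ _)
  exact ⟨A, hA, hxA⟩

/-- Distinct points of the same height that are not vertices have disjoint neighbourhoods. -/
lemma exists_disjoint_nhds (hℋ : HamiltonianHyp ℋ) {p q : LevelGraph ℋ} (hp : p ∉ vertices ℋ)
    (hq : q ∉ vertices ℋ) (hpq : p ≠ q) (hh : height ℋ p = height ℋ q) :
    ∃ A B : Set (LevelGraph ℋ), IsOpen A ∧ IsOpen B ∧ p ∈ A ∧ q ∈ B ∧ Disjoint A B := by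
  obtain ⟨x, rfl⟩ := surjective_proj p
  obtain ⟨y, rfl⟩ := surjective_proj q
  have hdisj : Disjoint (connectedComponentIn {w | ℋ w = ℋ x} x)
      (connectedComponentIn {w | ℋ w = ℋ y} y) := by
    rw [Set.disjoint_left]
    intro w hw hw'
    exact hpq ((proj_eq_of_mem_component hw).trans (proj_eq_of_mem_component hw').symm)
  obtain ⟨O, O', hO, hO', hCO, hCO', hOO⟩ := SeparatedNhds.of_isCompact_isCompact
    (isCompact_component hℋ x) (isCompact_component hℋ y) hdisj
  obtain ⟨A, hA, hxA, hAO⟩ := exists_isSheet_subset hℋ hp hO hCO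
  obtain ⟨B, hB, hyB, hBO⟩ := exists_isSheet_subset hℋ hq hO' hCO'
  refine ⟨A, B, hA.isOpen, hB.isOpen, hxA, hyB, Set.disjoint_left.2 fun r hr hr' => ?_⟩
  obtain ⟨w, rfl⟩ := surjective_proj r
  exact Set.disjoint_left.1 hOO (hAO hr) (hBO hr')

/-- Two sheets with a common point cannot branch. Over the heights between `r` and a supposed
branching, the heights where the sheets share a point and those where they carry distinct points are
both open, the latter because points off the vertices can be separated. They cover an interval, so
they meet, against injectivity on each sheet. -/
lemma IsSheet.union (hℋ : HamiltonianHyp ℋ) {A B : Set (LevelGraph ℋ)} (hA : IsSheet A)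
    (hB : IsSheet B) (hAB : (A ∩ B).Nonempty) : IsSheet (A ∪ B) := by
  obtain ⟨r, hrA, hrB⟩ := hAB
  have hcont := (continuous_height hℋ.continuous)
  have hsep : ∀ p ∈ A, ∀ q ∈ B, height ℋ p = height ℋ q → p = q := by
    intro p hp q hq hpq
    by_contra hne
    have hIA : uIcc (height ℋ r) (height ℋ p) ⊆ height ℋ '' A :=
      ((hA.isPreconnected.image _ hcont.continuousOn).ordConnected).uIcc_subset
        (mem_image_of_mem _ hrA) (mem_image_of_mem _ hp)
    have hIB : uIcc (height ℋ r) (height ℋ p) ⊆ height ℋ '' B :=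
      ((hB.isPreconnected.image _ hcont.continuousOn).ordConnected).uIcc_subset
        (mem_image_of_mem _ hrB) (hpq ▸ mem_image_of_mem _ hq)
    obtain ⟨z, -, ⟨c, hc, hcz⟩, a, ha, b, hb, hab, haz, hbz⟩ :=
      isPreconnected_uIcc (a := height ℋ r) (b := height ℋ p) (height ℋ '' (A ∩ B))
        {z | ∃ a ∈ A, ∃ b ∈ B, a ≠ b ∧ height ℋ a = z ∧ height ℋ b = z}
        (isOpen_height_image hℋ (hA.isOpen.inter hB.isOpen) (inter_subset_left.trans hA.subset))
        (by
          rw [isOpen_iff_mem_nhds]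
          rintro z ⟨a, ha, b, hb, hab, rfl, hba⟩
          obtain ⟨A', B', hA', hB', haA, hbB, hd⟩ := exists_disjoint_nhds hℋ (hA.subset ha)
            (hB.subset hb) hab hba.symm
          filter_upwards [(isOpen_height_image hℋ (hA.isOpen.inter hA')
            (inter_subset_left.trans hA.subset)).mem_nhds (mem_image_of_mem _ ⟨ha, haA⟩),
            (isOpen_height_image hℋ (hB.isOpen.inter hB')
            (inter_subset_left.trans hB.subset)).mem_nhds (hba ▸ mem_image_of_mem _ ⟨hb, hbB⟩)]
          rintro w ⟨a', ha', rfl⟩ ⟨b', hb', hw⟩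
          exact ⟨a', ha'.1, b', hb'.1, fun h => Set.disjoint_left.1 hd ha'.2 (h ▸ hb'.2), rfl, hw⟩)
        (by
          intro z hz
          obtain ⟨a, ha, haz⟩ := hIA hz
          obtain ⟨b, hb, hbz⟩ := hIB hz
          by_cases hab : a = b
          · exact Or.inl ⟨a, ⟨ha, hab ▸ hb⟩, haz⟩
          · exact Or.inr ⟨a, ha, b, hb, hab, haz, hbz⟩)
        ⟨_, left_mem_uIcc, r, ⟨hrA, hrB⟩, rfl⟩
        ⟨_, right_mem_uIcc, p, hp, q, hq, hne, rfl, hpq.symm⟩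
    exact hab ((hA.injOn ha hc.1 (haz.trans hcz.symm)).trans
      (hB.injOn hb hc.2 (hbz.trans hcz.symm)).symm)
  refine ⟨hA.isOpen.union hB.isOpen, union_subset hA.subset hB.subset,
    hA.isPreconnected.union r hrA hrB hB.isPreconnected, ?_⟩
  rintro p (hp | hp) q (hq | hq) h
  · exact hA.injOn hp hq h
  · exact hsep p hp q hq h
  · exact (hsep q hq p hp h.symm).symm
  · exact hB.injOn hp hq h

/-! ### Edges are open intervals parametrized by the height. -/

namespace Edge

variable (k : Edge ℋ)

lemma subset : k.1 ⊆ (vertices ℋ)ᶜ := by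
  obtain ⟨p, hp, hk⟩ := k.2
  rw [hk]
  exact connectedComponentIn_subset _ _

lemma isPreconnected : IsPreconnected k.1 := by
  obtain ⟨p, hp, hk⟩ := k.2
  rw [hk]
  exact isPreconnected_connectedComponentIn

lemma nonempty : k.1.Nonempty := by
  obtain ⟨p, hp, hk⟩ := k.2
  rw [hk]
  exact ⟨p, mem_connectedComponentIn hp⟩

variable {k}

lemma eq_component {p : LevelGraph ℋ} (hp : p ∈ k.1) :
    k.1 = connectedComponentIn (vertices ℋ)ᶜ p := by
  obtain ⟨q, hq, hk⟩ := k.2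
  rw [hk] at hp ⊢
  exact connectedComponentIn_eq hp

lemma eq_of_mem {k' : Edge ℋ} {p : LevelGraph ℋ} (hp : p ∈ k.1) (hp' : p ∈ k'.1) : k = k' :=
  Subtype.ext ((eq_component hp).trans (eq_component hp').symm)

lemma exists_mem {p : LevelGraph ℋ} (hp : p ∉ vertices ℋ) : ∃ k : Edge ℋ, p ∈ k.1 :=
  ⟨⟨_, p, hp, rfl⟩, mem_connectedComponentIn hp⟩

lemma sheet_subset {A : Set (LevelGraph ℋ)} (hA : IsSheet A) {p : LevelGraph ℋ} (hp : p ∈ A)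
    (hpk : p ∈ k.1) : A ⊆ k.1 := by
  rw [eq_component hpk]
  exact hA.isPreconnected.subset_connectedComponentIn hp hA.subset

variable (k)

lemma isOpen (hℋ : HamiltonianHyp ℋ) : IsOpen k.1 := by
  rw [isOpen_iff_mem_nhds]
  intro p hp
  obtain ⟨A, hA, hpA⟩ := exists_isSheet hℋ (k.subset hp)
  exact mem_of_superset (hA.isOpen.mem_nhds hpA) (sheet_subset hA hpA hp)

/-- The height is a coordinate along every edge. -/
lemma injOn_height (hℋ : HamiltonianHyp ℋ) : InjOn (height ℋ) k.1 := by
  intro p hp q hq hpq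
  -- By connectedness a chain of overlapping sheets joins `p` to `q`, and its union is again a
  -- sheet.
  obtain ⟨A, hA, hpA, hqA⟩ : ∃ A : Set (LevelGraph ℋ), IsSheet A ∧ p ∈ A ∧ q ∈ A := by
    refine k.isPreconnected.induction₂' (fun p q => ∃ A, IsSheet A ∧ p ∈ A ∧ q ∈ A)
      (fun p hp => ?_) ?_ hp hq
    · obtain ⟨A, hA, hpA⟩ := exists_isSheet hℋ (k.subset hp)
      filter_upwards [mem_nhdsWithin_of_mem_nhds (hA.isOpen.mem_nhds hpA)] with q hq
      exact ⟨⟨A, hA, hpA, hq⟩, ⟨A, hA, hq, hpA⟩⟩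
    · rintro p q r - - - ⟨A, hA, hpA, hqA⟩ ⟨B, hB, hqB, hrB⟩
      exact ⟨A ∪ B, hA.union hℋ hB ⟨q, hqA, hqB⟩, Or.inl hpA, Or.inr hrB⟩
  exact hA.injOn hpA hqA hpq

lemma isOpen_interval (hℋ : HamiltonianHyp ℋ) : IsOpen k.interval :=
  isOpen_height_image hℋ (k.isOpen hℋ) k.subset

lemma ordConnected_interval (hℋ : HamiltonianHyp ℋ) : k.interval.OrdConnected :=
  (k.isPreconnected.image _ (continuous_height hℋ.continuous).continuousOn).ordConnected

variable {k}

lemma point_mem {z : ℝ} (hz : z ∈ k.interval) : k.point z ∈ k.1 := Function.invFunOn_mem hz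

lemma height_point {z : ℝ} (hz : z ∈ k.interval) : height ℋ (k.point z) = z :=
  Function.invFunOn_eq hz

lemma point_height (hℋ : HamiltonianHyp ℋ) {p : LevelGraph ℋ} (hp : p ∈ k.1) :
    k.point (height ℋ p) = p :=
  k.injOn_height hℋ (point_mem (mem_image_of_mem _ hp)) hp
    (height_point (mem_image_of_mem _ hp))

/-- Edges are open and pairwise disjoint, so each is also relatively closed off the vertices. -/
lemma mem_of_mem_closure (hℋ : HamiltonianHyp ℋ) {p : LevelGraph ℋ} (hp : p ∈ closure k.1)
    (hpV : p ∉ vertices ℋ) : p ∈ k.1 := by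
  obtain ⟨k', hk'⟩ := exists_mem hpV
  obtain ⟨q, hq, hq'⟩ := mem_closure_iff.1 hp _ (k'.isOpen hℋ) hk'
  rwa [eq_of_mem hq' hq]

end Edge

/-! ### Critical values, gaps between them, and finiteness of the set of edges. -/

/-- The critical values of `ℋ`. -/
def criticalValues (ℋ : Plane → ℝ) : Set ℝ := ℋ '' {x | gradient ℋ x = 0}

lemma finite_criticalValues (hℋ : HamiltonianHyp ℋ) : (criticalValues ℋ).Finite :=
  hℋ.finite_critical.image _

lemma notMem_vertices {p : LevelGraph ℋ} (hp : height ℋ p ∉ criticalValues ℋ) :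
    p ∉ vertices ℋ := by
  rintro ⟨x, hx, rfl⟩
  exact hp (mem_image_of_mem _ hx)

/-- The end points of the interval of an edge are critical values. -/
lemma Edge.mem_interval_of_gap (hℋ : HamiltonianHyp ℋ) {k : Edge ℋ} {z z' : ℝ}
    (hz : z ∈ k.interval) (hgap : Disjoint (uIcc z z') (criticalValues ℋ)) :
    z' ∈ k.interval := by
  -- No vertex has a height in `uIcc z z'`, so the closure adds nothing to the edge there. By
  -- compactness the heights of `k` are closed as well as open in this segment.
  set S : Set Plane := {x | ℋ x ∈ uIcc z z'} ∩ proj ℋ ⁻¹' closure k.1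
  have hSc : IsCompact S := by
    refine (hℋ.isCompact_sublevel (max z z')).of_isClosed_subset ?_ fun x hx => hx.1.2
    exact (isClosed_Icc.preimage hℋ.continuous).inter (isClosed_closure.preimage continuous_proj)
  have hSk : ∀ x ∈ S, proj ℋ x ∈ k.1 := fun x hx =>
    mem_of_mem_closure hℋ hx.2 (notMem_vertices fun h => Set.disjoint_left.1 hgap hx.1 h)
  have hclosed : IsClosed (ℋ '' S) := (hSc.image hℋ.continuous).isClosed
  have hmem : ∀ w ∈ uIcc z z', w ∈ k.interval → w ∈ ℋ '' S := by
    rintro w hw ⟨p, hp, rfl⟩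
    obtain ⟨x, rfl⟩ := surjective_proj p
    exact ⟨x, ⟨hw, subset_closure hp⟩, rfl⟩
  by_contra hz'
  obtain ⟨w, hw, hw1, hw2⟩ := isPreconnected_uIcc k.interval (ℋ '' S)ᶜ
    (k.isOpen_interval hℋ) hclosed.isOpen_compl
    (fun w hw => by
      by_cases h : w ∈ ℋ '' S
      · obtain ⟨x, hx, rfl⟩ := h
        exact Or.inl (mem_image_of_mem _ (hSk x hx))
      · exact Or.inr h)
    ⟨z, left_mem_uIcc, hz⟩ ⟨z', right_mem_uIcc, fun ⟨x, hx, hxz⟩ =>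
      hz' (hxz ▸ mem_image_of_mem _ (hSk x hx))⟩
  exact hw2 (hmem w hw hw1)

/-- A level that is not critical has finitely many components. -/
lemma finite_level (hℋ : HamiltonianHyp ℋ) {z : ℝ} (hz : z ∉ criticalValues ℋ) :
    {p : LevelGraph ℋ | height ℋ p = z}.Finite := by
  have hV : ∀ p : LevelGraph ℋ, height ℋ p = z → p ∉ vertices ℋ := fun p hp =>
    notMem_vertices (hp ▸ hz)
  have himg : {p : LevelGraph ℋ | height ℋ p = z} = proj ℋ '' {x | ℋ x = z} := by
    ext p
    obtain ⟨x, rfl⟩ := surjective_proj p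
    exact ⟨fun h => ⟨x, h, rfl⟩, fun ⟨y, hy, hyx⟩ => by
      rw [mem_ofPred_eq, ← hyx]; exact hy⟩
  have hcomp : IsCompact {p : LevelGraph ℋ | height ℋ p = z} := by
    rw [himg]
    exact (hℋ.isCompact_level z).image continuous_proj
  -- The level is compact in the graph, and each sheet contains at most one of its points.
  choose! A hA hpA using fun (p : LevelGraph ℋ) (hp : height ℋ p = z) =>
    exists_isSheet hℋ (hV p hp)
  obtain ⟨t, ht, htc⟩ := hcomp.elim_nhds_subcover A
    fun p hp => (hA p hp).isOpen.mem_nhds (hpA p hp)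
  refine t.finite_toSet.subset fun q hq => ?_
  obtain ⟨p, hp, hqp⟩ := mem_iUnion₂.1 (htc hq)
  rw [(hA p (ht p hp)).injOn hqp (hpA p (ht p hp)) (Eq.trans hq (ht p hp).symm)]
  exact hp

/-- A positive lower bound for the gaps between critical values. -/
lemma exists_gap (hℋ : HamiltonianHyp ℋ) :
    ∃ δ : ℝ, 0 < δ ∧ ∀ c ∈ criticalValues ℋ, ∀ c' ∈ criticalValues ℋ, c < c' → c + δ < c' := by
  have hfin := (finite_criticalValues hℋ)
  have h : ∀ p ∈ {p : ℝ × ℝ | p.1 ∈ criticalValues ℋ ∧ p.2 ∈ criticalValues ℋ ∧ p.1 < p.2},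
      ∀ᶠ δ : ℝ in 𝓝[>] 0, p.1 + δ < p.2 := by
    rintro p ⟨-, -, hp⟩
    filter_upwards [mem_nhdsWithin_of_mem_nhds (Iio_mem_nhds (sub_pos.2 hp))] with δ hδ
    linarith [show δ < p.2 - p.1 from hδ]
  have hfin2 : {p : ℝ × ℝ | p.1 ∈ criticalValues ℋ ∧ p.2 ∈ criticalValues ℋ ∧
      p.1 < p.2}.Finite := (hfin.prod hfin).subset fun p hp => ⟨hp.1, hp.2.1⟩
  obtain ⟨δ, hδ, hδ0⟩ := ((hfin2.eventually_all.2 h).and self_mem_nhdsWithin).exists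
  exact ⟨δ, hδ0, fun c hc c' hc' hcc' => hδ (c, c') ⟨hc, hc', hcc'⟩⟩

lemma zero_mem_criticalValues (hℋ : HamiltonianHyp ℋ) : (0 : ℝ) ∈ criticalValues ℋ := by
  obtain ⟨x₀, hx₀⟩ := hℋ.min_eq_zero.1
  refine ⟨x₀, ?_, hx₀⟩
  have hmin : IsLocalMin ℋ x₀ := Eventually.of_forall fun y => hx₀.trans_le (hℋ.nonneg y)
  rw [mem_ofPred_eq, gradient, hmin.fderiv_eq_zero, map_zero]

/-- Below every height there is a last critical value. -/
lemma exists_critical_below (hℋ : HamiltonianHyp ℋ) {z : ℝ} (hz : 0 ≤ z)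
    (hzc : z ∉ criticalValues ℋ) :
    ∃ c ∈ criticalValues ℋ, c < z ∧ ∀ c' ∈ criticalValues ℋ, c < c' → z < c' := by
  obtain ⟨c, ⟨hc, hcz⟩, hmax⟩ := Set.exists_max_image (criticalValues ℋ ∩ Iic z) id
    ((finite_criticalValues hℋ).inter_of_left _) ⟨0, zero_mem_criticalValues hℋ, hz⟩
  refine ⟨c, hc, lt_of_le_of_ne hcz fun h => hzc (h ▸ hc), fun c' hc' hlt => ?_⟩
  by_contra! hle
  exact absurd (hmax c' ⟨hc', hle⟩) (not_le.2 hlt)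

/-- The part of a gap just above its lower end lies on the same edge. -/
lemma Edge.exists_gap_subset (hℋ : HamiltonianHyp ℋ) {δ : ℝ} 
    (hδ : ∀ c ∈ criticalValues ℋ, ∀ c' ∈ criticalValues ℋ, c < c' → c + δ < c')
    {k : Edge ℋ} {z : ℝ} (hz : z ∈ k.interval) (hzc : z ∉ criticalValues ℋ) :
    ∃ c ∈ criticalValues ℋ, c < z ∧ (∀ c' ∈ criticalValues ℋ, c < c' → z < c') ∧
      ∀ z' ∈ Ioc c (c + δ), Disjoint (uIcc z z') (criticalValues ℋ) ∧ z' ∈ k.interval := by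
  obtain ⟨p, hp, rfl⟩ := hz
  obtain ⟨x, rfl⟩ := surjective_proj p
  obtain ⟨c, hc, hcz, hgap⟩ := exists_critical_below hℋ (hℋ.nonneg x) hzc
  refine ⟨c, hc, hcz, hgap, fun z' hz' => ?_⟩
  have hd : Disjoint (uIcc (height ℋ (proj ℋ x)) z') (criticalValues ℋ) := by
    rw [Set.disjoint_left]
    intro w hw hwc
    have h1 : c < w := (lt_min hcz hz'.1).trans_le hw.1
    rcases le_max_iff.1 hw.2 with h | h
    · exact absurd (hgap w hwc h1) (not_lt.2 h)
    · exact absurd (hδ c hc w hwc h1) (not_lt.2 (h.trans hz'.2))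
  exact ⟨hd, mem_interval_of_gap hℋ (mem_image_of_mem _ hp) hd⟩

/-- Every edge passes the height `c + δ` for some critical value `c`. These heights are not
critical, so only finitely many points of the graph lie over them, and each belongs to a single
edge. -/
lemma finite_edge (hℋ : HamiltonianHyp ℋ) : Finite (Edge ℋ) := by
  obtain ⟨δ, hδ0, hδ⟩ := exists_gap hℋ
  set P : Set (LevelGraph ℋ) := ⋃ c ∈ criticalValues ℋ, {p | height ℋ p = c + δ}
  have hP : P.Finite := by
    refine (finite_criticalValues hℋ).biUnion fun c hc => finite_level hℋ fun h => ?_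
    exact lt_irrefl _ (hδ c hc _ h (by linarith))
  have hex : ∀ k : Edge ℋ, ∃ p ∈ P, p ∈ k.1 := by
    intro k
    have hne : (k.interval \ criticalValues ℋ).Nonempty := by
      refine nonempty_of_measure_ne_zero (μ := volume) ?_
      rw [measure_sdiff_null ((finite_criticalValues hℋ).measure_zero _)]
      exact ((k.isOpen_interval hℋ).measure_pos _ (k.nonempty.image _)).ne'
    obtain ⟨z, hz, hzc⟩ := hne
    obtain ⟨c, hc, -, -, h⟩ := k.exists_gap_subset hℋ hδ hz hzc
    have hm := (h (c + δ) ⟨by linarith, le_rfl⟩).2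
    exact ⟨k.point (c + δ), mem_biUnion hc (Edge.height_point hm), Edge.point_mem hm⟩
  choose f hfP hfk using hex
  have : Finite P := hP
  exact Finite.of_injective (fun k => (⟨f k, hfP k⟩ : P)) fun k k' h => by
    have h' : f k = f k' := congrArg Subtype.val h
    exact Edge.eq_of_mem (hfk k) (h' ▸ hfk k')

end LevelGraph

end

noncomputable section

open LevelGraph

/-! ### Orthonormal frames of the plane -/

/-- The vector `ν^⊥`. -/
def rot (ν : Plane) : Plane := !₂[-ν 1, ν 0]

/-- The coordinates `(a, t) ↦ a ν^⊥ + t ν` of the plane attached to a vector `ν`. -/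
def frame (ν : Plane) (p : ℝ × ℝ) : Plane := p.1 • rot ν + p.2 • ν

lemma frame_eq (ν : Plane) (a t : ℝ) : frame ν (a, t) = a • rot ν + t • ν := rfl

lemma norm_rot (ν : Plane) : ‖rot ν‖ = ‖ν‖ := by
  simp [rot, EuclideanSpace.norm_eq, Fin.sum_univ_two, add_comm]

lemma inner_rot_self (ν : Plane) : inner ℝ (rot ν) ν = 0 := by
  simp [rot, PiLp.inner_apply, Fin.sum_univ_two]; ring

lemma continuous_frame (ν : Plane) : Continuous (frame ν) :=
  (continuous_fst.smul continuous_const).add (continuous_snd.smul continuous_const)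

lemma measurePreserving_frame {ν : Plane} (hν : ‖ν‖ = 1) : MeasurePreserving (frame ν) := by
  have hon : Orthonormal ℝ ![rot ν, ν] := by
    rw [orthonormal_iff_ite]
    have h3 := inner_rot_self ν
    have h4 : inner ℝ ν (rot ν) = (0 : ℝ) := by rw [real_inner_comm, h3]
    intro i j
    fin_cases i <;> fin_cases j <;> simp [norm_rot, hν, h3, h4]
  have hspan : ⊤ ≤ Submodule.span ℝ (Set.range ![rot ν, ν]) := by
    rw [hon.linearIndependent.span_eq_top_of_card_eq_finrank (by simp)]
  let b := OrthonormalBasis.mk hon hspan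
  have h := (b.measurePreserving_repr_symm.comp (PiLp.volume_preserving_toLp (Fin 2))).comp
    (volume_preserving_finTwoArrow ℝ).symm
  have heq : frame ν = (b.repr.symm ∘ WithLp.toLp 2) ∘ MeasurableEquiv.finTwoArrow.symm := by
    ext1 p
    rw [Function.comp_apply, Function.comp_apply, ← b.sum_repr_symm]
    simp [b, Fin.sum_univ_two, frame, rot]
  rw [heq]
  exact h

lemma inner_rot_frame {ν : Plane} (hν : ‖ν‖ = 1) (a t : ℝ) :
    inner ℝ (rot ν) (frame ν (a, t)) = a := by
  rw [frame_eq, inner_add_right, real_inner_smul_right, real_inner_smul_right, inner_rot_self,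
    real_inner_self_eq_norm_sq, norm_rot, hν]
  ring

lemma norm_frame_le {ν : Plane} (hν : ‖ν‖ = 1) (a t : ℝ) : ‖frame ν (a, t)‖ ≤ |a| + |t| := by
  rw [frame_eq]
  refine (norm_add_le _ _).trans_eq ?_
  rw [norm_smul, norm_smul, norm_rot, hν, mul_one, mul_one, Real.norm_eq_abs, Real.norm_eq_abs]

/-- Along a line in a unit direction, sets project without increasing their length. -/
lemma volume_image_inner_le {e : Plane} (he : ‖e‖ = 1) (S : Set Plane) :
    volume ((fun y => inner ℝ e y) '' S) ≤ Measure.hausdorffMeasure 1 S := by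
  have hL : LipschitzWith 1 (fun y : Plane => (inner ℝ e y : ℝ)) :=
    LipschitzWith.of_dist_le_mul fun x y => by
      rw [Real.dist_eq, ← inner_sub_right, NNReal.coe_one, one_mul, dist_eq_norm]
      simpa [he] using abs_real_inner_le_norm e (x - y)
  have := hL.hausdorffMeasure_image_le zero_le_one S
  rw [hausdorffMeasure_real] at this
  simpa using this

/-! ### The coarea inequality -/

namespace HamiltonianHyp

variable {ℋ : Plane → ℝ} (hℋ : HamiltonianHyp ℋ)
include hℋ

lemma hasDerivAt_line (x e : Plane) (t : ℝ) :
    HasDerivAt (fun s : ℝ => ℋ (x + s • e)) (inner ℝ (gradient ℋ (x + t • e)) e) t := by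
  have h1 : HasDerivAt (fun s : ℝ => x + s • e) e t := by
    simpa using ((hasDerivAt_id t).smul_const e).const_add x
  have h2 := (hℋ.hasGradientAt (x + t • e)).hasFDerivAt.comp_hasDerivAt t h1
  simpa [Function.comp_def] using h2

lemma hasDerivAt_frame_snd (x ν : Plane) (a t : ℝ) :
    HasDerivAt (fun s : ℝ => ℋ (x + frame ν (a, s)))
      (inner ℝ (gradient ℋ (x + frame ν (a, t))) ν) t := by
  simpa only [frame_eq, add_assoc] using hℋ.hasDerivAt_line (x + a • rot ν) ν t

lemma hasDerivAt_frame_fst (x ν : Plane) (a t : ℝ) :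
    HasDerivAt (fun s : ℝ => ℋ (x + frame ν (s, t)))
      (inner ℝ (gradient ℋ (x + frame ν (a, t))) (rot ν)) a := by
  have := hℋ.hasDerivAt_line (x + t • ν) (rot ν) a
  simpa only [frame_eq, add_assoc, add_comm (t • ν)] using this

end HamiltonianHyp

/-- Near a point, at distances small compared with the gradient, the gradient varies little. -/
lemma gradient_near {ℋ : Plane → ℝ} {K : ℝ} (hK0 : 0 < K)
    (hK : ∀ x y, ‖gradient ℋ y - gradient ℋ x‖ ≤ K * ‖y - x‖) {x y : Plane}
    (hx : gradient ℋ x ≠ 0) (hy : ‖y - x‖ ≤ ‖gradient ℋ x‖ / (2 * K)) :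
    ‖gradient ℋ x‖ / 2 ≤ inner ℝ (gradient ℋ y) (‖gradient ℋ x‖⁻¹ • gradient ℋ x) ∧
      ‖gradient ℋ x‖ / 2 ≤ ‖gradient ℋ y‖ ∧ ‖gradient ℋ y‖ ≤ 3 / 2 * ‖gradient ℋ x‖ := by
  set g := ‖gradient ℋ x‖ with hg
  have hg0 : 0 < g := norm_pos_iff.2 hx
  have h1 : ‖gradient ℋ y - gradient ℋ x‖ ≤ g / 2 := by
    refine (hK x y).trans ((mul_le_mul_of_nonneg_left hy hK0.le).trans_eq ?_)
    field_simp
  have hν : ‖g⁻¹ • gradient ℋ x‖ = 1 := by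
    rw [norm_smul, norm_inv, Real.norm_of_nonneg hg0.le, ← hg, inv_mul_cancel₀ hg0.ne']
  have h2 : inner ℝ (gradient ℋ x) (g⁻¹ • gradient ℋ x) = g := by
    rw [real_inner_smul_right, real_inner_self_eq_norm_sq, ← hg]
    field_simp
  have h3 : |inner ℝ (gradient ℋ y - gradient ℋ x) (g⁻¹ • gradient ℋ x)| ≤ g / 2 := by
    refine (abs_real_inner_le_norm _ _).trans ?_
    rwa [hν, mul_one]
  have h4 : g / 2 ≤ inner ℝ (gradient ℋ y) (g⁻¹ • gradient ℋ x) := by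
    rw [inner_sub_left, h2] at h3
    linarith [(abs_le.1 h3).1]
  refine ⟨h4, ?_, ?_⟩
  · have := real_inner_le_norm (gradient ℋ y) (g⁻¹ • gradient ℋ x)
    rw [hν, mul_one] at this
    exact h4.trans this
  · have := norm_le_norm_add_norm_sub' (gradient ℋ y) (gradient ℋ x)
    rw [← hg] at this
    linarith

/-- The integral of `1 / |∇ℋ|` over the part of a level set in `E`. -/
def levelDensity (ℋ : Plane → ℝ) (E : Set Plane) (z : ℝ) : ℝ≥0∞ :=
  ∫⁻ x in E ∩ {y | ℋ y = z}, ‖gradient ℋ x‖ₑ⁻¹ ∂(Measure.hausdorffMeasure 1)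

/-- With the second axis along the gradient at `x`, `ℋ` replaces `t` as a coordinate at a cost of at
least `g / 2`. At fixed height the projection to the `a`-axis is no longer than the level set, whose
length is at most `3 g / 2` times the integral of `1 / |∇ℋ|`. The quotient of the two factors is 3.
-/
lemma volume_le_of_subset_ball {ℋ : Plane → ℝ} (hℋ : HamiltonianHyp ℋ) {K : ℝ} (hK0 : 0 < K)
    (hK : ∀ x y, ‖gradient ℋ y - gradient ℋ x‖ ≤ K * ‖y - x‖) {x : Plane}
    (hx : gradient ℋ x ≠ 0) {s : Set Plane} (hs : MeasurableSet s)
    (hsx : s ⊆ Metric.ball x (‖gradient ℋ x‖ / (2 * K))) :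
    volume s ≤ 3 * ∫⁻ z, levelDensity ℋ s z := by
  have hnear := fun y (hy : y ∈ Metric.ball x (‖gradient ℋ x‖ / (2 * K))) =>
    gradient_near hK0 hK hx (mem_ball_iff_norm.1 hy).le
  set g := ‖gradient ℋ x‖ with hg
  have hg0 : 0 < g := norm_pos_iff.2 hx
  set ν := g⁻¹ • gradient ℋ x with hνdef
  have hν : ‖ν‖ = 1 := by
    rw [norm_smul, norm_inv, Real.norm_of_nonneg hg0.le, ← hg, inv_mul_cancel₀ hg0.ne']
  have hmp := measurePreserving_frame hν
  set s' := frame ν ⁻¹' s with hs'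
  have hs'm : MeasurableSet s' := hmp.measurable hs
  have hd : ∀ a t, HasDerivAt (fun s : ℝ => ℋ (frame ν (a, s)))
      (inner ℝ (gradient ℋ (frame ν (a, t))) ν) t := fun a t => by
    simpa using hℋ.hasDerivAt_frame_snd 0 ν a t
  have hinj : ∀ a, InjOn (fun t => ℋ (frame ν (a, t)))
      {t | frame ν (a, t) ∈ Metric.ball x (g / (2 * K))} := fun a => by
    have hconv : Convex ℝ {t | frame ν (a, t) ∈ Metric.ball x (g / (2 * K))} := by
      have h1 : {t : ℝ | frame ν (a, t) ∈ Metric.ball x (g / (2 * K))}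
          = AffineMap.lineMap (a • rot ν) (a • rot ν + ν) ⁻¹' Metric.ball x (g / (2 * K)) := by
        ext t
        simp [frame_eq, AffineMap.lineMap_apply, add_comm]
      rw [h1]
      exact (convex_ball _ _).affine_preimage _
    refine (strictMonoOn_of_deriv_pos hconv
      (fun t _ => (hd a t).continuousAt.continuousWithinAt) fun t ht => ?_).injOn
    rw [(hd a t).deriv]
    exact (half_pos hg0).trans_le (hnear _ (interior_subset (s := {t | frame ν (a, t) ∈ _}) ht)).1
  set Fm : ℝ × ℝ → ℝ × ℝ := fun p => (p.1, ℋ (frame ν p)) with hF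
  -- An injective continuous image of a Borel set is Borel; this allows slicing the image in both
  -- directions.
  have hFm : MeasurableSet (Fm '' s') := by
    refine hs'm.image_of_continuousOn_injOn
      (continuous_fst.prodMk (hℋ.continuous.comp (continuous_frame ν))).continuousOn ?_
    rintro ⟨a, t⟩ hp ⟨a', t'⟩ hp' h
    obtain ⟨rfl, h2⟩ := Prod.mk.inj h
    rw [hinj a (hsx hp) (hsx hp') h2]
  have hslice : ∀ a, ENNReal.ofReal (g / 2) * volume (Prod.mk a ⁻¹' s')
      ≤ volume (Prod.mk a ⁻¹' (Fm '' s')) := by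
    intro a
    have hm : MeasurableSet (Prod.mk a ⁻¹' s') := measurable_prodMk_left hs'm
    have himg : Prod.mk a ⁻¹' (Fm '' s') = (fun t => ℋ (frame ν (a, t))) '' (Prod.mk a ⁻¹' s') := by
      ext z
      constructor
      · rintro ⟨⟨a', t⟩, hp, h⟩
        obtain ⟨rfl, rfl⟩ := Prod.mk.inj h
        exact ⟨t, hp, rfl⟩
      · rintro ⟨t, ht, rfl⟩
        exact ⟨(a, t), ht, rfl⟩
    have h1 := lintegral_image_eq_lintegral_abs_deriv_mul hm
      (fun t _ => (hd a t).hasDerivWithinAt) ((hinj a).mono fun t ht => hsx ht) (fun _ => 1)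
    simp only [setLIntegral_one, mul_one] at h1
    rw [himg, h1, ← setLIntegral_const]
    refine setLIntegral_mono' hm fun t ht => ENNReal.ofReal_le_ofReal ?_
    exact (hnear _ (hsx ht)).1.trans (le_abs_self _)
  have hline : ∀ z, volume ((fun a => (a, z)) ⁻¹' (Fm '' s'))
      ≤ ENNReal.ofReal (3 / 2 * g) * levelDensity ℋ s z := by
    intro z
    have hm : MeasurableSet (s ∩ {y | ℋ y = z}) :=
      hs.inter (hℋ.continuous.measurable (measurableSet_singleton z))
    calc volume ((fun a => (a, z)) ⁻¹' (Fm '' s'))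
        ≤ volume ((fun y => inner ℝ (rot ν) y) '' (s ∩ {y | ℋ y = z})) := by
          refine measure_mono ?_
          rintro a ⟨⟨a', t⟩, hp, h⟩
          obtain ⟨rfl, h2⟩ := Prod.mk.inj h
          exact ⟨frame ν (a', t), ⟨hp, h2⟩, inner_rot_frame hν _ _⟩
      _ ≤ Measure.hausdorffMeasure 1 (s ∩ {y | ℋ y = z}) :=
          volume_image_inner_le (by rw [norm_rot, hν]) _
      _ = ∫⁻ _ in s ∩ {y | ℋ y = z}, 1 ∂(Measure.hausdorffMeasure 1) := by
          rw [setLIntegral_one]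
      _ ≤ ∫⁻ y in s ∩ {y | ℋ y = z}, ENNReal.ofReal (3 / 2 * g) * ‖gradient ℋ y‖ₑ⁻¹
            ∂(Measure.hausdorffMeasure 1) := by
          refine setLIntegral_mono' hm fun y hy => ?_
          have h1 := hnear y (hsx hy.1)
          have h2 : ‖gradient ℋ y‖ₑ ≠ 0 := by
            rw [enorm_ne_zero, ← norm_pos_iff]
            linarith [h1.2.1]
          rw [← div_eq_mul_inv, ENNReal.le_div_iff_mul_le (Or.inl h2) (Or.inl enorm_ne_top),
            one_mul, ← ofReal_norm]
          exact ENNReal.ofReal_le_ofReal h1.2.2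
      _ = ENNReal.ofReal (3 / 2 * g) * levelDensity ℋ s z :=
          lintegral_const_mul' _ _ ENNReal.ofReal_ne_top
  have hvol : volume s = ∫⁻ a, volume (Prod.mk a ⁻¹' s') := by
    rw [← hmp.measure_preimage hs.nullMeasurableSet, Measure.volume_eq_prod,
      Measure.prod_apply hs'm]
  have h1 : ENNReal.ofReal (g / 2) * volume s
      ≤ ENNReal.ofReal (3 / 2 * g) * ∫⁻ z, levelDensity ℋ s z := by
    calc ENNReal.ofReal (g / 2) * volume s
        = ∫⁻ a, ENNReal.ofReal (g / 2) * volume (Prod.mk a ⁻¹' s') := by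
          rw [hvol, lintegral_const_mul' _ _ ENNReal.ofReal_ne_top]
      _ ≤ ∫⁻ a, volume (Prod.mk a ⁻¹' (Fm '' s')) := lintegral_mono hslice
      _ = ∫⁻ z, volume ((fun a => (a, z)) ⁻¹' (Fm '' s')) := by
          rw [← Measure.prod_apply hFm, Measure.prod_apply_symm hFm]
      _ ≤ ∫⁻ z, ENNReal.ofReal (3 / 2 * g) * levelDensity ℋ s z := lintegral_mono hline
      _ = _ := lintegral_const_mul' _ _ ENNReal.ofReal_ne_top
  have h2 : ENNReal.ofReal (3 / 2 * g) = ENNReal.ofReal (g / 2) * 3 := by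
    rw [← ENNReal.ofReal_ofNat 3, ← ENNReal.ofReal_mul (by positivity)]
    congr 1; ring
  rw [h2, mul_assoc] at h1
  exact (ENNReal.mul_le_mul_iff_right (by simpa using hg0) ENNReal.ofReal_ne_top).1 h1

/-- The lower integral is superadditive, also for functions that are not measurable. -/
lemma finset_sum_lintegral_le {α ι : Type*} [MeasurableSpace α] (μ : Measure α) (t : Finset ι)
    (f : ι → α → ℝ≥0∞) : ∑ i ∈ t, ∫⁻ a, f i a ∂μ ≤ ∫⁻ a, ∑ i ∈ t, f i a ∂μ := by
  classical
  induction t using Finset.induction_on with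
  | empty => simp
  | insert i t hi ih =>
    simp only [Finset.sum_insert hi]
    exact (add_le_add_right ih _).trans (le_lintegral_add _ _)

lemma tsum_lintegral_le {α ι : Type*} [MeasurableSpace α] (μ : Measure α)
    (f : ι → α → ℝ≥0∞) : ∑' i, ∫⁻ a, f i a ∂μ ≤ ∫⁻ a, ∑' i, f i a ∂μ := by
  rw [ENNReal.tsum_eq_iSup_sum]
  exact iSup_le fun t => (finset_sum_lintegral_le μ t f).trans
    (lintegral_mono fun a => ENNReal.sum_le_tsum t)

/-- One half of the coarea formula, up to a constant factor. -/
theorem volume_le_lintegral_levelDensity {ℋ : Plane → ℝ} (hℋ : HamiltonianHyp ℋ) {E : Set Plane}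
    (hE : MeasurableSet E) (hgrad : ∀ x ∈ E, gradient ℋ x ≠ 0) :
    volume E ≤ 3 * ∫⁻ z, levelDensity ℋ E z := by
  rcases E.eq_empty_or_nonempty with rfl | hne
  · simp
  obtain ⟨K, hK0, hK⟩ := hℋ.exists_gradient_lipschitz
  -- Countably many balls of the admissible size cover `E`; they are then made disjoint.
  obtain ⟨t, htE, htc, hcov⟩ := TopologicalSpace.countable_cover_nhdsWithin (s := E)
    (f := fun x => Metric.ball x (‖gradient ℋ x‖ / (2 * K))) fun x hx =>
      mem_nhdsWithin_of_mem_nhds (Metric.ball_mem_nhds _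
        (div_pos (norm_pos_iff.2 (hgrad x hx)) (by positivity)))
  have htne : t.Nonempty := by
    by_contra h
    rw [not_nonempty_iff_eq_empty.1 h] at hcov
    obtain ⟨x, hx⟩ := hne
    simpa using hcov hx
  obtain ⟨c, rfl⟩ := htc.exists_eq_range htne
  set B : ℕ → Set Plane := fun n => Metric.ball (c n) (‖gradient ℋ (c n)‖ / (2 * K))
  set s : ℕ → Set Plane := fun n => E ∩ disjointed B n
  have hsm : ∀ n, MeasurableSet (s n) := fun n =>
    hE.inter (.disjointed (fun _ => Metric.isOpen_ball.measurableSet) n)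
  have hsd : Pairwise (Function.onFun Disjoint s) := fun m n hmn =>
    ((disjoint_disjointed B) hmn).mono inter_subset_right inter_subset_right
  have hsE : E = ⋃ n, s n := by
    rw [← inter_iUnion, iUnion_disjointed, inter_eq_self_of_subset_left]
    simpa only [biUnion_range] using hcov
  have hdens : ∀ z, ∑' n, levelDensity ℋ (s n) z = levelDensity ℋ E z := by
    intro z
    rw [levelDensity, hsE, iUnion_inter, lintegral_iUnion]
    · rfl
    · exact fun n => (hsm n).inter (hℋ.continuous.measurable (measurableSet_singleton z))
    · exact fun m n hmn => (hsd hmn).mono inter_subset_left inter_subset_left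
  calc volume E = ∑' n, volume (s n) := by
        conv_lhs => rw [hsE]
        exact measure_iUnion hsd hsm
    _ ≤ ∑' n, 3 * ∫⁻ z, levelDensity ℋ (s n) z := ENNReal.tsum_le_tsum fun n =>
        volume_le_of_subset_ball hℋ hK0 hK (hgrad _ (htE (mem_range_self n))) (hsm n)
          (inter_subset_right.trans (disjointed_subset B n))
    _ = 3 * ∑' n, ∫⁻ z, levelDensity ℋ (s n) z := ENNReal.tsum_mul_left
    -- Superadditivity of the lower integral has the right direction here, so measurability of
    -- `levelDensity` in `z` is not needed.
    _ ≤ 3 * ∫⁻ z, ∑' n, levelDensity ℋ (s n) z := by gcongr; exact tsum_lintegral_le _ _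
    _ = 3 * ∫⁻ z, levelDensity ℋ E z := by simp only [hdens]

lemma volume_inter_preimage_le {ℋ : Plane → ℝ} (hℋ : HamiltonianHyp ℋ) {E : Set Plane}
    (hE : MeasurableSet E) (hgrad : ∀ x ∈ E, gradient ℋ x ≠ 0) {A : Set ℝ}
    (hA : MeasurableSet A) :
    volume (E ∩ ℋ ⁻¹' A) ≤ 3 * ∫⁻ z, A.indicator (levelDensity ℋ E) z := by
  refine (volume_le_lintegral_levelDensity hℋ (hE.inter (hℋ.continuous.measurable hA))
    fun x hx => hgrad x hx.1).trans ?_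
  gcongr with z
  by_cases hz : z ∈ A
  · rw [indicator_of_mem hz]
    exact lintegral_mono_set (inter_subset_inter_left _ inter_subset_left)
  · rw [indicator_of_notMem hz, levelDensity]
    have : E ∩ ℋ ⁻¹' A ∩ {y | ℋ y = z} = ∅ := by
      ext y
      simp only [mem_inter_iff, mem_preimage, mem_empty_iff_false, iff_false]
      rintro ⟨⟨-, h⟩, rfl⟩
      exact hz h
    rw [this]; simp

/-- Null sets of values have null preimages off the critical points. -/
lemma volume_inter_preimage_eq_zero {ℋ : Plane → ℝ} (hℋ : HamiltonianHyp ℋ) {E : Set Plane}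
    (hE : MeasurableSet E) (hgrad : ∀ x ∈ E, gradient ℋ x ≠ 0) {A : Set ℝ}
    (hA : volume A = 0) : volume (E ∩ ℋ ⁻¹' A) = 0 := by
  obtain ⟨A', hAA', hA', hA0⟩ := exists_measurable_superset_of_null hA
  have h := volume_inter_preimage_le hℋ hE hgrad hA'
  rw [lintegral_indicator hA', setLIntegral_measure_zero _ _ hA0, mul_zero] at h
  exact measure_mono_null (inter_subset_inter_right _ (preimage_mono hAA')) (le_zero_iff.1 h)

/-- The coarea inequality for functions of the height. -/
theorem lintegral_comp_height_le {ℋ : Plane → ℝ} (hℋ : HamiltonianHyp ℋ) {E : Set Plane}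
    (hE : MeasurableSet E) (hgrad : ∀ x ∈ E, gradient ℋ x ≠ 0) {φ : ℝ → ℝ≥0∞}
    (hφ : Measurable φ) :
    ∫⁻ x in E, φ (ℋ x) ≤ 3 * ∫⁻ z, φ z * levelDensity ℋ E z := by
  rw [← lintegral_map hφ hℋ.continuous.measurable, lintegral]
  refine iSup₂_le fun s hs => ?_
  calc s.lintegral (Measure.map ℋ (volume.restrict E))
      = ∑ c ∈ s.range, c * volume (E ∩ ℋ ⁻¹' (s ⁻¹' {c})) := by
        refine Finset.sum_congr rfl fun c _ => ?_
        rw [Measure.map_apply hℋ.continuous.measurable (s.measurableSet_fiber c),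
          Measure.restrict_apply (hℋ.continuous.measurable (s.measurableSet_fiber c)), inter_comm]
    _ ≤ ∑ c ∈ s.range, 3 * ∫⁻ z, c * (s ⁻¹' {c}).indicator (levelDensity ℋ E) z := by
        refine Finset.sum_le_sum fun c _ => ?_
        refine (mul_le_mul_right (volume_inter_preimage_le hℋ hE hgrad
          (s.measurableSet_fiber c)) c).trans ?_
        rw [mul_left_comm]
        gcongr
        exact lintegral_const_mul_le _ _
    _ ≤ 3 * ∫⁻ z, ∑ c ∈ s.range, c * (s ⁻¹' {c}).indicator (levelDensity ℋ E) z := by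
        rw [← Finset.mul_sum]
        gcongr
        exact finset_sum_lintegral_le _ _ _
    _ ≤ 3 * ∫⁻ z, φ z * levelDensity ℋ E z := by
        gcongr with z
        rw [Finset.sum_eq_single_of_mem (s z) (s.mem_range_self z)]
        · rw [indicator_of_mem (by simp)]
          gcongr
          exact hs z
        · intro c _ hc
          rw [indicator_of_notMem (by simpa using hc.symm), mul_zero]

end

noncomputable section

open LevelGraph

/-! ### Lower bounds for the line integrals over level curves -/

section Arc

variable {ℋ : Plane → ℝ} {K : ℝ}

/-- Through every non-critical point runs an arc of the level set whose length and whose gradients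
are comparable with the gradient at the point. -/
lemma exists_level_arc (hℋ : HamiltonianHyp ℋ) (hK0 : 0 < K)
    (hK : ∀ x y, ‖gradient ℋ y - gradient ℋ x‖ ≤ K * ‖y - x‖) {x : Plane}
    (hx : gradient ℋ x ≠ 0) :
    ∃ S : Set Plane, IsCompact S ∧ IsPreconnected S ∧ x ∈ S ∧ (∀ y ∈ S, ℋ y = ℋ x) ∧
      (∀ y ∈ S, ‖gradient ℋ x‖ / 2 ≤ ‖gradient ℋ y‖ ∧
        ‖gradient ℋ y‖ ≤ 3 / 2 * ‖gradient ℋ x‖) ∧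
      ENNReal.ofReal (‖gradient ℋ x‖ / (2 * K)) ≤ Measure.hausdorffMeasure 1 S := by
  have hnear := fun y => gradient_near (y := y) hK0 hK hx
  set g := ‖gradient ℋ x‖ with hg
  have hg0 : 0 < g := norm_pos_iff.2 hx
  set ν := g⁻¹ • gradient ℋ x with hνdef
  have hν : ‖ν‖ = 1 := by
    rw [norm_smul, norm_inv, Real.norm_of_nonneg hg0.le, ← hg, inv_mul_cancel₀ hg0.ne']
  set r := g / (4 * K) with hr
  have hr0 : 0 < r := by positivity
  have hKr : K * r = g / 4 := by rw [hr]; field_simp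
  have hin : ∀ a ∈ Icc (-r) r, ∀ t ∈ Icc (-r) r, ‖x + frame ν (a, t) - x‖ ≤ g / (2 * K) := by
    intro a ha t ht
    rw [add_sub_cancel_left]
    refine (norm_frame_le hν a t).trans ?_
    have h1 := abs_le.2 ha
    have h2 := abs_le.2 ht
    calc |a| + |t| ≤ r + r := add_le_add h1 h2
      _ = g / (2 * K) := by rw [hr]; field_simp; ring
  have h00 : (0 : ℝ) ∈ Icc (-r) r := ⟨by linarith, hr0.le⟩
  set ψ : ℝ → ℝ → ℝ := fun a t => ℋ (x + frame ν (a, t)) with hψ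
  have hψ0 : ψ 0 0 = ℋ x := by simp [hψ, frame_eq]
  have hmono : ∀ a ∈ Icc (-r) r, ∀ t ∈ Icc (-r) r, ∀ t' ∈ Icc (-r) r, t ≤ t' →
      g / 2 * (t' - t) ≤ ψ a t' - ψ a t := by
    intro a ha
    refine (convex_Icc (-r) r).mul_sub_le_image_sub_of_le_deriv
      (fun t _ => (hℋ.hasDerivAt_frame_snd x ν a t).continuousAt.continuousWithinAt)
      (fun t _ => (hℋ.hasDerivAt_frame_snd x ν a t).differentiableAt.differentiableWithinAt)
      fun t ht => ?_
    rw [(hℋ.hasDerivAt_frame_snd x ν a t).deriv]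
    exact (hnear _ (hin a ha t (interior_subset ht))).1
  have hlip : ∀ t ∈ Icc (-r) r, ∀ a ∈ Icc (-r) r, ∀ a' ∈ Icc (-r) r,
      |ψ a' t - ψ a t| ≤ 3 / 2 * g * |a' - a| := by
    intro t ht a ha a' ha'
    refine (convex_Icc (-r) r).norm_image_sub_le_of_norm_hasDerivWithin_le
      (fun b _ => (hℋ.hasDerivAt_frame_fst x ν b t).hasDerivWithinAt) (fun b hb => ?_) ha ha'
    refine (norm_inner_le_norm _ _).trans ?_
    rw [norm_rot, hν, mul_one]
    exact (hnear _ (hin b hb t ht)).2.2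
  -- The axis `t = 0` is orthogonal to the gradient at `x`, so the slope along it is at most `K r =
  -- g / 4`. This is less than the change of at least `g r / 2` from `t = 0` to `t = ± r`, and the
  -- level is met on every vertical segment.
  have hzero : ∀ a ∈ Icc (-r) r, |ψ a 0 - ℋ x| ≤ g / 4 * r := by
    intro a ha
    have h1 : |ψ a 0 - ψ 0 0| ≤ g / 4 * |a - 0| := by
      refine (convex_Icc (-r) r).norm_image_sub_le_of_norm_hasDerivWithin_le
        (fun b _ => (hℋ.hasDerivAt_frame_fst x ν b 0).hasDerivWithinAt) (fun b hb => ?_) h00 ha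
      have h2 : inner ℝ (gradient ℋ x) (rot ν) = 0 := by
        have h3 : gradient ℋ x = g • ν := by
          rw [hνdef, smul_smul, mul_inv_cancel₀ hg0.ne', one_smul]
        rw [h3, real_inner_smul_left, real_inner_comm, inner_rot_self, mul_zero]
      have h4 : inner ℝ (gradient ℋ (x + frame ν (b, 0))) (rot ν)
          = inner ℝ (gradient ℋ (x + frame ν (b, 0)) - gradient ℋ x) (rot ν) := by
        rw [inner_sub_left, h2, sub_zero]
      rw [h4]
      refine (norm_inner_le_norm _ _).trans ?_
      rw [norm_rot, hν, mul_one, ← hKr]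
      refine (hK _ _).trans ?_
      gcongr
      rw [add_sub_cancel_left]
      refine (norm_frame_le hν b 0).trans ?_
      rw [abs_zero, add_zero]
      exact abs_le.2 hb
    rw [hψ0, sub_zero] at h1
    exact h1.trans (by gcongr; exact abs_le.2 ha)
  have hex : ∀ a ∈ Icc (-r) r, ∃ t ∈ Icc (-r) r, ψ a t = ℋ x := by
    intro a ha
    have h1 := abs_le.1 (hzero a ha)
    have h2 := hmono a ha (-r) ⟨le_rfl, by linarith⟩ 0 h00 (by linarith)
    have h3 := hmono a ha 0 h00 r ⟨by linarith, le_rfl⟩ hr0.le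
    have h4 : 0 < g * r := by positivity
    have hc : ContinuousOn (ψ a) (Icc (-r) r) := fun t _ =>
      (hℋ.hasDerivAt_frame_snd x ν a t).continuousAt.continuousWithinAt
    exact intermediate_value_Icc (by linarith) hc ⟨by linarith, by linarith⟩
  choose! τ hτ hτz using hex
  -- The constant is the horizontal slope bound `3 g / 2` divided by the vertical lower bound `g /
  -- 2`.
  have hτlip : LipschitzOnWith 3 τ (Icc (-r) r) := by
    refine LipschitzOnWith.of_dist_le_mul fun a ha a' ha' => ?_
    rw [Real.dist_eq, Real.dist_eq, NNReal.coe_ofNat]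
    have h1 := hlip (τ a') (hτ a' ha') a ha a' ha'
    rw [hτz a' ha', ← hτz a ha] at h1
    rw [abs_sub_comm a a']
    rcases le_total (τ a) (τ a') with h | h
    · have h2 := hmono a ha _ (hτ a ha) _ (hτ a' ha') h
      rw [abs_of_nonpos (by linarith)]
      have h3 := abs_le.1 h1
      by_contra! h5
      nlinarith
    · have h2 := hmono a ha _ (hτ a' ha') _ (hτ a ha) h
      rw [abs_of_nonneg (by linarith)]
      have h3 := abs_le.1 h1
      by_contra! h5
      nlinarith
  have hcurve : ContinuousOn (fun a => x + frame ν (a, τ a)) (Icc (-r) r) :=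
    continuousOn_const.add
      ((continuous_frame ν).comp_continuousOn (continuousOn_id.prodMk hτlip.continuousOn))
  refine ⟨(fun a => x + frame ν (a, τ a)) '' Icc (-r) r, isCompact_Icc.image_of_continuousOn hcurve,
    isPreconnected_Icc.image _ hcurve, ⟨0, h00, ?_⟩, ?_, ?_, ?_⟩
  · have h1 : τ 0 = 0 := by
      have h2 : ψ 0 (τ 0) = ψ 0 0 := by rw [hτz 0 h00, hψ0]
      rcases le_total (τ 0) 0 with h | h
      · have := hmono 0 h00 _ (hτ 0 h00) 0 h00 h
        nlinarith
      · have := hmono 0 h00 0 h00 _ (hτ 0 h00) h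
        nlinarith
    simp [h1, frame_eq]
  · rintro _ ⟨a, ha, rfl⟩
    exact hτz a ha
  · rintro _ ⟨a, ha, rfl⟩
    exact (hnear _ (hin a ha _ (hτ a ha))).2
  -- The arc is a graph over `[-r, r]`, so its projection has length `2 r = g / (2 K)`.
  · refine le_trans ?_ (volume_image_inner_le (e := rot ν) (by rw [norm_rot, hν]) _)
    have : (fun y => inner ℝ (rot ν) y) '' ((fun a => x + frame ν (a, τ a)) '' Icc (-r) r)
        = (fun a => inner ℝ (rot ν) x + a) '' Icc (-r) r := by
      rw [image_image]
      refine image_congr fun a _ => ?_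
      rw [inner_add_right, inner_rot_frame hν]
    rw [this, image_const_add_Icc, Real.volume_Icc]
    refine ENNReal.ofReal_le_ofReal (le_of_eq ?_)
    rw [hr]; field_simp; ring

lemma arc_subset_levelCurve {k : Edge ℋ} {x : Plane} (hxk : proj ℋ x ∈ k.1) {S : Set Plane}
    (hS : IsPreconnected S) (hxS : x ∈ S) (hz : ∀ y ∈ S, ℋ y = ℋ x) :
    S ⊆ k.levelCurve (ℋ x) := fun y hy =>
  ⟨hz y hy, by rw [← proj_eq_of_isPreconnected hS hz hxS hy]; exact hxk⟩

/-- The bound is the length `g / (2 K)` of the arc through `x` times the lower bound `g / 2` for the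
gradient on it. -/
lemma ofReal_sq_le_alpha (hℋ : HamiltonianHyp ℋ) (hK0 : 0 < K)
    (hK : ∀ x y, ‖gradient ℋ y - gradient ℋ x‖ ≤ K * ‖y - x‖) {k : Edge ℋ} {x : Plane}
    (hxk : proj ℋ x ∈ k.1) :
    ENNReal.ofReal (‖gradient ℋ x‖ ^ 2 / (4 * K)) ≤ k.alpha (ℋ x) := by
  obtain ⟨S, hSc, hS, hxS, hz, hgr, hlen⟩ :=
    exists_level_arc hℋ hK0 hK (gradient_ne_zero_of_proj (k.subset hxk))
  calc ENNReal.ofReal (‖gradient ℋ x‖ ^ 2 / (4 * K))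
      = ENNReal.ofReal (‖gradient ℋ x‖ / 2) * ENNReal.ofReal (‖gradient ℋ x‖ / (2 * K)) := by
        rw [← ENNReal.ofReal_mul (by positivity)]
        congr 1; field_simp; ring
    _ ≤ ENNReal.ofReal (‖gradient ℋ x‖ / 2) * Measure.hausdorffMeasure 1 S := by gcongr
    _ = ∫⁻ _ in S, ENNReal.ofReal (‖gradient ℋ x‖ / 2) ∂(Measure.hausdorffMeasure 1) := by
        rw [setLIntegral_const]
    _ ≤ ∫⁻ y in S, ‖gradient ℋ y‖ₑ ∂(Measure.hausdorffMeasure 1) :=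
        setLIntegral_mono' hSc.measurableSet fun y hy => by
          rw [← ofReal_norm]
          exact ENNReal.ofReal_le_ofReal (hgr y hy).1
    _ ≤ k.alpha (ℋ x) := lintegral_mono_set (arc_subset_levelCurve hxk hS hxS hz)

/-- Length `g / (2 K)` over gradient `3 g / 2`: the size `g` cancels, so the bound is uniform over
all edges and heights. -/
lemma ofReal_le_period (hℋ : HamiltonianHyp ℋ) (hK0 : 0 < K)
    (hK : ∀ x y, ‖gradient ℋ y - gradient ℋ x‖ ≤ K * ‖y - x‖) {k : Edge ℋ} {z : ℝ}
    (hz : z ∈ k.interval) : ENNReal.ofReal (1 / (3 * K)) ≤ k.period z := by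
  obtain ⟨p, hp, rfl⟩ := hz
  obtain ⟨x, rfl⟩ := surjective_proj p
  have hx0 := gradient_ne_zero_of_proj (k.subset hp)
  obtain ⟨S, hSc, hS, hxS, hz, hgr, hlen⟩ := exists_level_arc hℋ hK0 hK hx0
  have hg0 : 0 < ‖gradient ℋ x‖ := norm_pos_iff.2 hx0
  calc ENNReal.ofReal (1 / (3 * K))
      = ENNReal.ofReal (3 / 2 * ‖gradient ℋ x‖)⁻¹ * ENNReal.ofReal (‖gradient ℋ x‖ / (2 * K)) := by
        rw [← ENNReal.ofReal_mul (by positivity)]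
        congr 1; field_simp
    _ ≤ ENNReal.ofReal (3 / 2 * ‖gradient ℋ x‖)⁻¹ * Measure.hausdorffMeasure 1 S := by gcongr
    _ = ∫⁻ _ in S, ENNReal.ofReal (3 / 2 * ‖gradient ℋ x‖)⁻¹ ∂(Measure.hausdorffMeasure 1) := by
        rw [setLIntegral_const]
    _ ≤ ∫⁻ y in S, ‖gradient ℋ y‖ₑ⁻¹ ∂(Measure.hausdorffMeasure 1) :=
        setLIntegral_mono' hSc.measurableSet fun y hy => by
          rw [ENNReal.ofReal_inv_of_pos (by positivity), ENNReal.inv_le_inv, ← ofReal_norm]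
          exact ENNReal.ofReal_le_ofReal (hgr y hy).2
    _ ≤ k.period (ℋ x) := lintegral_mono_set (arc_subset_levelCurve hp hS hxS hz)

end Arc

/-! ### Behaviour of the gradient near the critical points -/

section Critical

variable {ℋ : Plane → ℝ}

lemma exists_critical_point (hℋ : HamiltonianHyp ℋ) : ∃ x, gradient ℋ x = 0 := by
  obtain ⟨x, hx, -⟩ := zero_mem_criticalValues hℋ
  exact ⟨x, hx⟩

/-- On sublevel sets the gradient grows at least linearly in the distance to the critical
points. -/
lemma exists_mul_dist_le_norm_gradient (hℋ : HamiltonianHyp ℋ) (R : ℝ) :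
    ∃ c : ℝ, 0 < c ∧ ∀ x, ℋ x ≤ R → ∃ y, gradient ℋ y = 0 ∧ c * ‖x - y‖ ≤ ‖gradient ℋ x‖ := by
  refine (hℋ.isCompact_sublevel R).induction_on
    (p := fun s => ∃ c : ℝ, 0 < c ∧ ∀ x ∈ s, ∃ y, gradient ℋ y = 0 ∧
      c * ‖x - y‖ ≤ ‖gradient ℋ x‖) ⟨1, one_pos, by simp⟩ ?_ ?_ ?_
  · rintro s t hst ⟨c, hc, h⟩
    exact ⟨c, hc, fun x hx => h x (hst hx)⟩
  · rintro s t ⟨c, hc, h⟩ ⟨c', hc', h'⟩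
    refine ⟨min c c', lt_min hc hc', ?_⟩
    rintro x (hx | hx)
    · obtain ⟨y, hy, hxy⟩ := h x hx
      exact ⟨y, hy, (mul_le_mul_of_nonneg_right (min_le_left _ _) (norm_nonneg _)).trans hxy⟩
    · obtain ⟨y, hy, hxy⟩ := h' x hx
      exact ⟨y, hy, (mul_le_mul_of_nonneg_right (min_le_right _ _) (norm_nonneg _)).trans hxy⟩
  · intro x _
    by_cases hx : gradient ℋ x = 0
    -- The invertible Hessian gives `|A v| ≥ |v| / N`; a linearization error of half that size still
    -- leaves `1 / (2 N)`.
    · let A := ContinuousLinearMap.toContinuousLinearEquivOfDetNeZero _ (hℋ.nondegenerate x hx)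
      have hA : HasFDerivAt (gradient ℋ) (A : Plane →L[ℝ] Plane) x :=
        (hℋ.differentiable_gradient x).hasFDerivAt
      set N := ‖(A.symm : Plane →L[ℝ] Plane)‖ with hN
      have hN0 : 0 < N := A.norm_symm_pos
      have hAN : ∀ v, ‖v‖ ≤ N * ‖A v‖ := fun v => by
        simpa using (A.symm : Plane →L[ℝ] Plane).le_opNorm (A v)
      refine ⟨_, mem_nhdsWithin_of_mem_nhds
        (hA.isLittleO.def (c := 1 / (2 * N)) (by positivity)), 1 / (2 * N), by positivity,
        fun y hy => ⟨x, hx, ?_⟩⟩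
      have hy' : ‖gradient ℋ y - gradient ℋ x - A (y - x)‖ ≤ 1 / (2 * N) * ‖y - x‖ := hy
      rw [hx, sub_zero] at hy'
      have h1 := norm_sub_norm_le (A (y - x)) (gradient ℋ y)
      rw [norm_sub_rev] at h1
      have h2 := hAN (y - x)
      have h3 : ‖y - x‖ / N ≤ ‖A (y - x)‖ := by rwa [div_le_iff₀' hN0]
      have h4 : ‖y - x‖ / N = 1 / (2 * N) * ‖y - x‖ + 1 / (2 * N) * ‖y - x‖ := by
        field_simp; ring
      linarith
    -- Here the gradient is bounded below nearby, so any critical point serves as `y`.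
    · obtain ⟨y, hy⟩ := exists_critical_point hℋ
      have hg0 : 0 < ‖gradient ℋ x‖ := norm_pos_iff.2 hx
      have h1 : ∀ᶠ w in 𝓝 x, ‖gradient ℋ x‖ / 2 < ‖gradient ℋ w‖ :=
        hℋ.continuous_gradient.norm.continuousAt.eventually_const_lt (half_lt_self hg0)
      have h2 : ∀ᶠ w in 𝓝 x, ‖w - y‖ < ‖x - y‖ + 1 :=
        ((continuous_id.sub continuous_const).norm.continuousAt).eventually_lt_const
          (lt_add_one _)
      have h3 : 0 < ‖x - y‖ + 1 := by positivity
      refine ⟨_, mem_nhdsWithin_of_mem_nhds (h1.and h2),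
        ‖gradient ℋ x‖ / 2 / (‖x - y‖ + 1), by positivity, fun w hw => ⟨y, hy, ?_⟩⟩
      have hw' : ‖gradient ℋ x‖ / 2 < ‖gradient ℋ w‖ ∧ ‖w - y‖ < ‖x - y‖ + 1 := hw
      calc ‖gradient ℋ x‖ / 2 / (‖x - y‖ + 1) * ‖w - y‖
          ≤ ‖gradient ℋ x‖ / 2 / (‖x - y‖ + 1) * (‖x - y‖ + 1) := by gcongr; exact hw'.2.le
        _ = ‖gradient ℋ x‖ / 2 := by field_simp
        _ ≤ _ := hw'.1.le

lemma norm_fderiv_eq_norm_gradient (x : Plane) : ‖fderiv ℝ ℋ x‖ = ‖gradient ℋ x‖ := by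
  rw [gradient, LinearIsometryEquiv.norm_map]

/-- The gradient is at most `K |x - y|` on the ball around `y` through `x`; the mean value
inequality supplies the second factor. -/
lemma abs_sub_le_of_gradient_eq_zero (hℋ : HamiltonianHyp ℋ) {K : ℝ} (hK0 : 0 < K)
    (hK : ∀ x y, ‖gradient ℋ y - gradient ℋ x‖ ≤ K * ‖y - x‖) {y : Plane}
    (hy : gradient ℋ y = 0) (x : Plane) : |ℋ x - ℋ y| ≤ K * ‖x - y‖ ^ 2 := by
  have h := (convex_closedBall y ‖x - y‖).norm_image_sub_le_of_norm_fderiv_le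
    (f := ℋ) (𝕜 := ℝ) (C := K * ‖x - y‖) (fun w _ => hℋ.differentiable w) (fun w hw => ?_)
    (Metric.mem_closedBall_self (norm_nonneg _)) (mem_closedBall_iff_norm.2 le_rfl)
  · rw [Real.norm_eq_abs] at h
    linarith
  · rw [norm_fderiv_eq_norm_gradient]
    have := hK y w
    rw [hy, sub_zero] at this
    exact this.trans (by gcongr; exact mem_closedBall_iff_norm.1 hw)

/-- The distance of a height to the critical values. -/
def critDist (ℋ : Plane → ℝ) (z : ℝ) : ℝ := Metric.infDist z (criticalValues ℋ)

lemma critDist_nonneg (z : ℝ) : 0 ≤ critDist ℋ z := Metric.infDist_nonneg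

lemma continuous_critDist : Continuous (critDist ℋ) := Metric.continuous_infDist_pt _

lemma critDist_le {z c : ℝ} (hc : c ∈ criticalValues ℋ) : critDist ℋ z ≤ |z - c| :=
  (Metric.infDist_le_dist_of_mem hc).trans_eq (Real.dist_eq z c)

lemma exists_critDist_eq (hℋ : HamiltonianHyp ℋ) (z : ℝ) :
    ∃ c ∈ criticalValues ℋ, critDist ℋ z = |z - c| := by
  obtain ⟨x, hx⟩ := exists_critical_point hℋ
  obtain ⟨c, hc, h⟩ := (finite_criticalValues hℋ).isCompact.exists_infDist_eq_dist
    ⟨_, mem_image_of_mem ℋ hx⟩ z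
  exact ⟨c, hc, h.trans (Real.dist_eq z c)⟩

lemma critDist_pos (hℋ : HamiltonianHyp ℋ) {z : ℝ} (hz : z ∉ criticalValues ℋ) :
    0 < critDist ℋ z := by
  obtain ⟨c, hc, h⟩ := exists_critDist_eq hℋ z
  rw [h, abs_pos, sub_ne_zero]
  rintro rfl
  exact hz hc

/-- `α_k(z)` is at least of the order of the distance of `z` to the critical values. -/
theorem exists_mul_critDist_le_alpha (hℋ : HamiltonianHyp ℋ) (R : ℝ) :
    ∃ c : ℝ, 0 < c ∧ ∀ (k : Edge ℋ), ∀ z ∈ k.interval, z ≤ R →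
      ENNReal.ofReal (c * critDist ℋ z) ≤ k.alpha z := by
  obtain ⟨K, hK0, hK⟩ := hℋ.exists_gradient_lipschitz
  obtain ⟨c, hc0, hc⟩ := exists_mul_dist_le_norm_gradient hℋ R
  refine ⟨c ^ 2 / (4 * K ^ 2), by positivity, ?_⟩
  rintro k _ ⟨p, hp, rfl⟩ hR
  obtain ⟨x, rfl⟩ := surjective_proj p
  obtain ⟨y, hy, hxy⟩ := hc x hR
  refine le_trans (ENNReal.ofReal_le_ofReal ?_) (ofReal_sq_le_alpha hℋ hK0 hK hp)
  -- Both quantities compare with `|x - y|²`: the distance of heights from above, the squared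
  -- gradient from below.
  have h1 : critDist ℋ (ℋ x) ≤ K * ‖x - y‖ ^ 2 :=
    (critDist_le (mem_image_of_mem ℋ hy)).trans (abs_sub_le_of_gradient_eq_zero hℋ hK0 hK hy x)
  have h2 : (c * ‖x - y‖) ^ 2 ≤ ‖gradient ℋ x‖ ^ 2 := by gcongr
  calc c ^ 2 / (4 * K ^ 2) * critDist ℋ (ℋ x)
      ≤ c ^ 2 / (4 * K ^ 2) * (K * ‖x - y‖ ^ 2) := by gcongr
    _ = (c * ‖x - y‖) ^ 2 / (4 * K) := by field_simp
    _ ≤ ‖gradient ℋ x‖ ^ 2 / (4 * K) := by gcongr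

end Critical

end

noncomputable section

open LevelGraph

/-! ### The volume of thin layers around critical levels -/

/-- The part of an interval on which a function with bounded second derivative is within `δ` of a
given value carries little of the square of the derivative. -/
lemma lintegral_deriv_sq_le {φ φ' φ'' : ℝ → ℝ} (hφ : ∀ t, HasDerivAt φ (φ' t) t)
    (hφ' : ∀ t, HasDerivAt φ' (φ'' t) t) (hφ'' : Continuous φ'') {r B C : ℝ} (hr : 0 ≤ r)
    (hB : ∀ t ∈ Icc (-r) r, |φ' t| ≤ B) (hC : ∀ t ∈ Icc (-r) r, |φ'' t| ≤ C) (c : ℝ) {δ : ℝ}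
    (hδ : 0 < δ) :
    ∫⁻ t in Icc (-r) r ∩ {t | |φ t - c| < δ}, ENNReal.ofReal (φ' t ^ 2)
      ≤ ENNReal.ofReal (8 * δ * (B + r * C)) := by
  have hc : Continuous φ := continuous_iff_continuousAt.2 fun t => (hφ t).continuousAt
  have hc' : Continuous φ' := continuous_iff_continuousAt.2 fun t => (hφ' t).continuousAt
  -- `A` is a bounded primitive-type weight: the derivative of `φ' A` is `φ'' A + G / δ`, and `G` is
  -- at least half of `φ'²` where `|φ - c| < δ`.
  set A : ℝ → ℝ := fun t => Real.arctan ((φ t - c) / δ) with hA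
  have hAc : Continuous A := Real.continuous_arctan.comp ((hc.sub continuous_const).div_const _)
  have hAb : ∀ t, |A t| ≤ 2 := fun t => by
    rw [abs_le]
    constructor <;> linarith [Real.neg_pi_div_two_lt_arctan ((φ t - c) / δ),
      Real.arctan_lt_pi_div_two ((φ t - c) / δ), Real.pi_le_four]
  set G : ℝ → ℝ := fun t => φ' t ^ 2 / (1 + ((φ t - c) / δ) ^ 2) with hG
  have hden : ∀ t, 0 < 1 + ((φ t - c) / δ) ^ 2 := fun t => by positivity
  have hGc : Continuous G :=
    (hc'.pow 2).div₀ (continuous_const.add (((hc.sub continuous_const).div_const _).pow 2))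
      fun t => (hden t).ne'
  have hG0 : ∀ t, 0 ≤ G t := fun t => div_nonneg (sq_nonneg _) (hden t).le
  have hderiv : ∀ t, HasDerivAt (fun t => φ' t * A t) (φ'' t * A t + G t / δ) t := by
    intro t
    have h1 := ((hφ t).sub_const c).div_const δ |>.arctan
    refine ((hφ' t).mul h1).congr_deriv ?_
    have := hden t
    simp only [hG, hA]
    field_simp
  have hint : ∫ t in (-r)..r, (φ'' t * A t + G t / δ) = φ' r * A r - φ' (-r) * A (-r) :=
    intervalIntegral.integral_eq_sub_of_hasDerivAt (fun t _ => hderiv t)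
      (((hφ''.mul hAc).add (hGc.div_const _)).intervalIntegrable _ _)
  have hsplit : ∫ t in (-r)..r, (φ'' t * A t + G t / δ)
      = (∫ t in (-r)..r, φ'' t * A t) + ∫ t in (-r)..r, G t / δ :=
    intervalIntegral.integral_add ((hφ''.mul hAc).intervalIntegrable _ _)
      ((hGc.div_const _).intervalIntegrable _ _)
  rw [hsplit, intervalIntegral.integral_div] at hint
  have hmem1 : r ∈ Icc (-r) r := ⟨by linarith, le_rfl⟩
  have hmem2 : -r ∈ Icc (-r) r := ⟨le_rfl, by linarith⟩
  have hb1 : |φ' r * A r| ≤ B * 2 := by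
    rw [abs_mul]
    exact mul_le_mul (hB r hmem1) (hAb r) (abs_nonneg _) ((abs_nonneg _).trans (hB r hmem1))
  have hb2 : |φ' (-r) * A (-r)| ≤ B * 2 := by
    rw [abs_mul]
    exact mul_le_mul (hB _ hmem2) (hAb _) (abs_nonneg _) ((abs_nonneg _).trans (hB _ hmem2))
  have hb3 : |∫ t in (-r)..r, φ'' t * A t| ≤ C * 2 * |r - -r| := by
    rw [← Real.norm_eq_abs (∫ t in (-r)..r, φ'' t * A t)]
    refine intervalIntegral.norm_integral_le_of_norm_le_const fun t ht => ?_
    rw [uIoc_of_le (by linarith)] at ht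
    rw [norm_mul]
    exact mul_le_mul (hC t (Ioc_subset_Icc_self ht)) (hAb t) (abs_nonneg _)
      ((abs_nonneg _).trans (hC r hmem1))
  -- With `|A| ≤ 2`, the two boundary terms cost `4 B` and the term `φ'' A` over length `2 r` costs
  -- `4 r C`.
  have hGint : (∫ t in (-r)..r, G t) ≤ 4 * δ * (B + r * C) := by
    have h1 : (∫ t in (-r)..r, G t) / δ ≤ 4 * (B + r * C) := by
      have h2 : |r - -r| = 2 * r := by rw [sub_neg_eq_add, ← two_mul, abs_of_nonneg (by linarith)]
      rw [h2] at hb3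
      linarith [abs_le.1 hb1, abs_le.1 hb2, abs_le.1 hb3]
    rw [div_le_iff₀ hδ] at h1
    linarith
  calc ∫⁻ t in Icc (-r) r ∩ {t | |φ t - c| < δ}, ENNReal.ofReal (φ' t ^ 2)
      ≤ ∫⁻ t in Icc (-r) r ∩ {t | |φ t - c| < δ}, ENNReal.ofReal (2 * G t) := by
        refine setLIntegral_mono' (measurableSet_Icc.inter
          (isOpen_lt (hc.sub continuous_const).abs continuous_const).measurableSet)
          fun t ht => ENNReal.ofReal_le_ofReal ?_
        have h1 : |φ t - c| < δ := ht.2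
        have h2 : ((φ t - c) / δ) ^ 2 ≤ 1 := by
          rw [sq_le_one_iff_abs_le_one, abs_div, abs_of_pos hδ]
          exact (div_le_one hδ).2 h1.le
        simp only [hG]
        rw [← mul_div_assoc, le_div_iff₀ (hden t)]
        nlinarith [sq_nonneg (φ' t)]
    _ ≤ ∫⁻ t in Icc (-r) r, ENNReal.ofReal (2 * G t) := lintegral_mono_set inter_subset_left
    _ = ENNReal.ofReal (∫ t in Icc (-r) r, 2 * G t) := by
        rw [ofReal_integral_eq_lintegral_ofReal]
        · exact (continuous_const.mul hGc).continuousOn.integrableOn_Icc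
        · exact Eventually.of_forall fun t => mul_nonneg zero_le_two (hG0 t)
    _ ≤ ENNReal.ofReal (8 * δ * (B + r * C)) := by
        refine ENNReal.ofReal_le_ofReal ?_
        rw [integral_Icc_eq_integral_Ioc, ← intervalIntegral.integral_of_le (by linarith),
          intervalIntegral.integral_const_mul]
        linarith

variable {ℋ : Plane → ℝ}

/-- Fubini along lines parallel to `ν` reduces to the one-dimensional estimate, whose constants are
uniform over lines. -/
lemma lintegral_inner_gradient_sq_le (hℋ : HamiltonianHyp ℋ) {r : ℝ} (hr : 0 ≤ r) {ν : Plane}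
    (hν : ‖ν‖ = 1) (c : ℝ) :
    ∃ C : ℝ, 0 ≤ C ∧ ∀ δ : ℝ, 0 < δ →
      ∫⁻ x in Metric.closedBall 0 r ∩ {x | |ℋ x - c| < δ},
        ENNReal.ofReal (inner ℝ (gradient ℋ x) ν ^ 2) ≤ ENNReal.ofReal (C * δ) := by
  obtain ⟨D, hD⟩ := hℋ.bounded_hessian
  -- The ball of radius `2 r` contains the whole square `|a|, |t| ≤ r` on which the line estimate is
  -- applied.
  obtain ⟨B, hB⟩ := (isCompact_closedBall (0 : Plane) (2 * r)).exists_bound_of_continuousOn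
    hℋ.continuous_gradient.continuousOn
  have hB0 : 0 ≤ B := (norm_nonneg _).trans (hB 0 (Metric.mem_closedBall_self (by linarith)))
  have hD0 : 0 ≤ D := (norm_nonneg _).trans (hD 0)
  refine ⟨8 * (B + r * D) * (2 * r), by positivity, fun δ hδ => ?_⟩
  have hmp := measurePreserving_frame hν
  set E := Metric.closedBall (0 : Plane) r ∩ {x | |ℋ x - c| < δ} with hE
  have hEm : MeasurableSet E := Metric.isClosed_closedBall.measurableSet.inter
    (isOpen_lt (hℋ.continuous.sub continuous_const).abs continuous_const).measurableSet
  have hfm : Measurable fun x => ENNReal.ofReal (inner ℝ (gradient ℋ x) ν ^ 2) :=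
    ((hℋ.continuous_gradient.inner continuous_const).pow 2).measurable.ennreal_ofReal
  have hline : ∀ a, ∫⁻ t, E.indicator (fun x => ENNReal.ofReal (inner ℝ (gradient ℋ x) ν ^ 2))
      (frame ν (a, t)) ≤ (Icc (-r) r).indicator
        (fun _ => ENNReal.ofReal (8 * δ * (B + r * D))) a := by
    intro a
    have hcoord : ∀ t, frame ν (a, t) ∈ E → a ∈ Icc (-r) r ∧ t ∈ Icc (-r) r := by
      intro t ht
      have h1 := mem_closedBall_zero_iff.1 ht.1
      have h2 : |a| ≤ r := by
        rw [← inner_rot_frame hν a t]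
        refine (abs_real_inner_le_norm _ _).trans ?_
        rwa [norm_rot, hν, one_mul]
      have h3 : inner ℝ ν (frame ν (a, t)) = t := by
        rw [frame_eq, inner_add_right, real_inner_smul_right, real_inner_smul_right,
          real_inner_comm, inner_rot_self, real_inner_self_eq_norm_sq, hν]
        ring
      have h4 : |t| ≤ r := by
        rw [← h3]
        refine (abs_real_inner_le_norm _ _).trans ?_
        rwa [hν, one_mul]
      exact ⟨abs_le.1 h2, abs_le.1 h4⟩
    by_cases ha : a ∈ Icc (-r) r
    · rw [indicator_of_mem ha]
      have hd1 : ∀ t, HasDerivAt (fun t => ℋ (frame ν (a, t)))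
          (inner ℝ (gradient ℋ (frame ν (a, t))) ν) t := fun t => by
        simpa using hℋ.hasDerivAt_frame_snd 0 ν a t
      have hfr : ∀ t, HasDerivAt (fun t => frame ν (a, t)) ν t := fun t => by
        simp only [frame_eq]
        simpa using ((hasDerivAt_id t).smul_const ν).const_add (a • rot ν)
      have hd2 : ∀ t, HasDerivAt (fun t => (inner ℝ (gradient ℋ (frame ν (a, t))) ν : ℝ))
          (inner ℝ (fderiv ℝ (gradient ℋ) (frame ν (a, t)) ν) ν) t := fun t => by
        have h1 := (hℋ.differentiable_gradient (frame ν (a, t))).hasFDerivAt.comp_hasDerivAt t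
          (hfr t)
        simpa using h1.inner ℝ (hasDerivAt_const t ν)
      have hcf : Continuous fun t : ℝ => frame ν (a, t) :=
        (continuous_frame ν).comp (continuous_const.prodMk continuous_id)
      have hc2 : Continuous fun t => (inner ℝ (fderiv ℝ (gradient ℋ) (frame ν (a, t)) ν) ν : ℝ) :=
        ((((hℋ.contDiff_gradient.continuous_fderiv (by norm_num)).comp hcf).clm_apply
          continuous_const).inner continuous_const)
      refine le_trans ?_ (lintegral_deriv_sq_le hd1 hd2 hc2 hr (B := B) (C := D) ?_ ?_ c hδ)
      · have hm : MeasurableSet (Icc (-r) r ∩ {t | |ℋ (frame ν (a, t)) - c| < δ}) :=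
          measurableSet_Icc.inter (isOpen_lt (((hℋ.continuous.comp hcf).sub
            continuous_const).abs) continuous_const).measurableSet
        rw [← lintegral_indicator hm]
        refine lintegral_mono fun t => ?_
        by_cases ht : frame ν (a, t) ∈ E
        · rw [indicator_of_mem ht, indicator_of_mem
            (show t ∈ Icc (-r) r ∩ {t | |ℋ (frame ν (a, t)) - c| < δ} from ⟨(hcoord t ht).2, ht.2⟩)]
        · rw [indicator_of_notMem ht]
          exact zero_le
      · intro t ht
        refine (abs_real_inner_le_norm _ _).trans ?_
        rw [hν, mul_one]
        refine hB _ (mem_closedBall_zero_iff.2 ((norm_frame_le hν a t).trans ?_))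
        linarith [abs_le.2 ha, abs_le.2 ht]
      · intro t _
        refine (abs_real_inner_le_norm _ _).trans ?_
        rw [hν, mul_one]
        refine ((fderiv ℝ (gradient ℋ) (frame ν (a, t))).le_opNorm ν).trans ?_
        rw [hν, mul_one]
        exact hD _
    · rw [indicator_of_notMem ha]
      refine le_of_eq ?_
      rw [lintegral_eq_zero_of_ae_eq_zero]
      refine Eventually.of_forall fun t => indicator_of_notMem (fun ht => ha (hcoord t ht).1) _
  calc ∫⁻ x in E, ENNReal.ofReal (inner ℝ (gradient ℋ x) ν ^ 2)
      = ∫⁻ p, E.indicator (fun x => ENNReal.ofReal (inner ℝ (gradient ℋ x) ν ^ 2))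
          (frame ν p) := by
        rw [← lintegral_indicator hEm, hmp.lintegral_comp (hfm.indicator hEm)]
    _ = ∫⁻ a, ∫⁻ t, E.indicator (fun x => ENNReal.ofReal (inner ℝ (gradient ℋ x) ν ^ 2))
          (frame ν (a, t)) := by
        rw [Measure.volume_eq_prod, lintegral_prod]
        exact ((hfm.indicator hEm).comp hmp.measurable).aemeasurable
    _ ≤ ∫⁻ a, (Icc (-r) r).indicator (fun _ => ENNReal.ofReal (8 * δ * (B + r * D))) a :=
        lintegral_mono hline
    _ = ENNReal.ofReal (8 * (B + r * D) * (2 * r) * δ) := by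
        rw [lintegral_indicator measurableSet_Icc, setLIntegral_const, Real.volume_Icc,
          ← ENNReal.ofReal_mul (by positivity)]
        congr 1; ring

lemma lintegral_gradient_sq_le (hℋ : HamiltonianHyp ℋ) {r : ℝ} (hr : 0 ≤ r) (c : ℝ) :
    ∃ C : ℝ, 0 ≤ C ∧ ∀ δ : ℝ, 0 < δ →
      ∫⁻ x in Metric.closedBall 0 r ∩ {x | |ℋ x - c| < δ},
        ENNReal.ofReal (‖gradient ℋ x‖ ^ 2) ≤ ENNReal.ofReal (C * δ) := by
  have hn : ∀ i : Fin 2, ‖(EuclideanSpace.single i 1 : Plane)‖ = 1 := fun i => by simp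
  obtain ⟨C₀, h0, hC₀⟩ := lintegral_inner_gradient_sq_le hℋ hr (hn 0) c
  obtain ⟨C₁, h1, hC₁⟩ := lintegral_inner_gradient_sq_le hℋ hr (hn 1) c
  refine ⟨C₀ + C₁, by positivity, fun δ hδ => ?_⟩
  rw [add_mul, ENNReal.ofReal_add (by positivity) (by positivity)]
  refine le_trans (le_of_eq ?_) (add_le_add (hC₀ δ hδ) (hC₁ δ hδ))
  rw [← lintegral_add_left]
  · refine lintegral_congr fun x => ?_
    rw [← ENNReal.ofReal_add (sq_nonneg _) (sq_nonneg _), EuclideanSpace.real_norm_sq_eq,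
      Fin.sum_univ_two, EuclideanSpace.inner_single_right, EuclideanSpace.inner_single_right]
    simp
  · exact ((hℋ.continuous_gradient.inner continuous_const).pow 2).measurable.ennreal_ofReal

/-- The region in a sublevel set where the gradient is small has small area. -/
lemma volume_gradient_lt_le (hℋ : HamiltonianHyp ℋ) (R : ℝ) :
    ∃ C : ℝ, 0 ≤ C ∧ ∀ s : ℝ, 0 < s →
      volume {x | ℋ x ≤ R ∧ ‖gradient ℋ x‖ < s} ≤ ENNReal.ofReal (C * s ^ 2) := by
  obtain ⟨c, hc0, hc⟩ := exists_mul_dist_le_norm_gradient hℋ R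
  set V := (volume (Metric.ball (0 : Plane) 1)).toReal with hV
  have hVtop : volume (Metric.ball (0 : Plane) 1) ≠ ∞ := measure_ball_lt_top.ne
  set Z := hℋ.finite_critical.toFinset with hZ
  refine ⟨Z.card * ((1 / c) ^ 2 * V), by positivity, fun s hs => ?_⟩
  calc volume {x | ℋ x ≤ R ∧ ‖gradient ℋ x‖ < s}
      ≤ volume (⋃ y ∈ Z, Metric.ball y (s / c)) := by
        refine measure_mono fun x hx => ?_
        obtain ⟨y, hy, hxy⟩ := hc x hx.1
        refine mem_biUnion (hℋ.finite_critical.mem_toFinset.2 hy) ?_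
        rw [mem_ball_iff_norm, lt_div_iff₀' hc0]
        exact hxy.trans_lt hx.2
    _ ≤ ∑ y ∈ Z, volume (Metric.ball y (s / c)) := measure_biUnion_finset_le _ _
    _ = ∑ _ ∈ Z, ENNReal.ofReal ((s / c) ^ 2 * V) := by
        refine Finset.sum_congr rfl fun y _ => ?_
        rw [Measure.addHaar_ball _ _ (by positivity), finrank_euclideanSpace, Fintype.card_fin,
          ENNReal.ofReal_mul (by positivity), hV, ENNReal.ofReal_toReal hVtop]
    _ = ENNReal.ofReal (Z.card * ((1 / c) ^ 2 * V) * s ^ 2) := by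
        rw [Finset.sum_const, nsmul_eq_mul, ← ENNReal.ofReal_natCast,
          ← ENNReal.ofReal_mul (by positivity)]
        congr 1; ring

/-- The area of the layer of thickness `δ` around a level is of order `√δ`. -/
lemma volume_layer_le (hℋ : HamiltonianHyp ℋ) (R c : ℝ) :
    ∃ C : ℝ, 0 ≤ C ∧ ∀ s : ℝ, 0 < s →
      volume {x | ℋ x ≤ R ∧ |ℋ x - c| < s ^ 4} ≤ ENNReal.ofReal (C * s ^ 2) := by
  obtain ⟨r, hr⟩ := (hℋ.isCompact_sublevel R).isBounded.subset_closedBall 0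
  have hr' : {x | ℋ x ≤ R} ⊆ Metric.closedBall 0 (max r 0) :=
    hr.trans (Metric.closedBall_subset_closedBall (le_max_left _ _))
  obtain ⟨C₁, h1, hC₁⟩ := lintegral_gradient_sq_le hℋ (le_max_right r 0) c
  obtain ⟨C₂, h2, hC₂⟩ := volume_gradient_lt_le hℋ R
  refine ⟨C₁ + C₂, by positivity, fun s hs => ?_⟩
  set L := Metric.closedBall (0 : Plane) (max r 0) ∩ {x | |ℋ x - c| < s ^ 4} with hL
  have hLm : MeasurableSet L := Metric.isClosed_closedBall.measurableSet.inter
    (isOpen_lt (hℋ.continuous.sub continuous_const).abs continuous_const).measurableSet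
  -- The threshold `s` balances two areas: where the gradient is at least `s`, Chebyshev gives `s⁴ /
  -- s²`; elsewhere discs around the critical points give `s²`.
  have hcheb : volume {x ∈ L | s ≤ ‖gradient ℋ x‖} ≤ ENNReal.ofReal (C₁ * s ^ 2) := by
    have hm : MeasurableSet {x ∈ L | s ≤ ‖gradient ℋ x‖} :=
      hLm.inter (isClosed_le continuous_const hℋ.continuous_gradient.norm).measurableSet
    have h3 : ENNReal.ofReal (s ^ 2) * volume {x ∈ L | s ≤ ‖gradient ℋ x‖}
        ≤ ENNReal.ofReal (s ^ 2) * ENNReal.ofReal (C₁ * s ^ 2) := by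
      calc ENNReal.ofReal (s ^ 2) * volume {x ∈ L | s ≤ ‖gradient ℋ x‖}
          = ∫⁻ _ in {x ∈ L | s ≤ ‖gradient ℋ x‖}, ENNReal.ofReal (s ^ 2) := by
            rw [setLIntegral_const]
        _ ≤ ∫⁻ x in {x ∈ L | s ≤ ‖gradient ℋ x‖}, ENNReal.ofReal (‖gradient ℋ x‖ ^ 2) :=
            setLIntegral_mono' hm fun x hx => ENNReal.ofReal_le_ofReal (by gcongr; exact hx.2)
        _ ≤ ∫⁻ x in L, ENNReal.ofReal (‖gradient ℋ x‖ ^ 2) :=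
            lintegral_mono_set fun x hx => hx.1
        _ ≤ ENNReal.ofReal (C₁ * s ^ 4) := hC₁ _ (by positivity)
        _ = _ := by
            rw [← ENNReal.ofReal_mul (by positivity)]
            congr 1; ring
    exact (ENNReal.mul_le_mul_iff_right (by simpa using hs.ne') ENNReal.ofReal_ne_top).1 h3
  rw [add_mul, ENNReal.ofReal_add (by positivity) (by positivity)]
  refine le_trans (measure_mono fun x hx => ?_)
    ((measure_union_le {x ∈ L | s ≤ ‖gradient ℋ x‖} {x | ℋ x ≤ R ∧ ‖gradient ℋ x‖ < s}).trans
      (add_le_add hcheb (hC₂ s hs)))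
  rcases le_or_gt s ‖gradient ℋ x‖ with h | h
  · exact Or.inl ⟨⟨hr' hx.1, hx.2⟩, h⟩
  · exact Or.inr ⟨hx.1, h⟩

lemma volume_sublevel_lt_top (hℋ : HamiltonianHyp ℋ) (R : ℝ) : volume {x | ℋ x ≤ R} < ∞ :=
  (hℋ.isCompact_sublevel R).measure_lt_top

/-- By the layer cake formula: the function exceeds `t` only in a layer of thickness `t⁻⁴`, of area
of order `t⁻²`, which is integrable at infinity. -/
lemma lintegral_rpow_dist_value_lt_top (hℋ : HamiltonianHyp ℋ) (R c : ℝ) :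
    ∫⁻ x in {x | ℋ x ≤ R}, ENNReal.ofReal (|ℋ x - c| ^ (-(1 / 4) : ℝ)) < ∞ := by
  obtain ⟨C, hC0, hC⟩ := volume_layer_le hℋ R c
  have hDm : MeasurableSet {x | ℋ x ≤ R} :=
    (isClosed_le hℋ.continuous continuous_const).measurableSet
  have hfm : Measurable fun x => |ℋ x - c| ^ (-(1 / 4) : ℝ) := by
    have h1 : Measurable fun x => |ℋ x - c| :=
      (hℋ.continuous.sub continuous_const).abs.measurable
    exact h1.pow_const _
  rw [lintegral_eq_lintegral_meas_lt _ (Eventually.of_forall fun x => by positivity)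
    hfm.aemeasurable]
  have hbound : ∀ t : ℝ, 0 < t → (volume.restrict {x | ℋ x ≤ R})
      {x | t < |ℋ x - c| ^ (-(1 / 4) : ℝ)} ≤ ENNReal.ofReal (C * t ^ (-2 : ℝ)) := by
    intro t ht
    rw [Measure.restrict_apply (measurableSet_lt measurable_const hfm)]
    have h1 : C * t ^ (-2 : ℝ) = C * t⁻¹ ^ 2 := by
      rw [Real.rpow_neg ht.le, inv_pow]; norm_cast
    rw [h1]
    refine (measure_mono fun x hx => ?_).trans (hC t⁻¹ (by positivity))
    have hlt : t < |ℋ x - c| ^ (-(1 / 4) : ℝ) := hx.1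
    refine ⟨hx.2, ?_⟩
    rcases (abs_nonneg (ℋ x - c)).eq_or_lt with h0 | h0
    · rw [← h0]; positivity
    · have h2 : t ^ 4 < (|ℋ x - c| ^ (-(1 / 4) : ℝ)) ^ 4 := by gcongr
      rw [← Real.rpow_mul_natCast h0.le] at h2
      norm_num at h2
      rw [Real.rpow_neg_one] at h2
      rw [inv_pow]
      exact (lt_inv_comm₀ (by positivity) h0).1 h2
  rw [← Ioc_union_Ioi_eq_Ioi zero_le_one,
    lintegral_union measurableSet_Ioi (Ioc_disjoint_Ioi le_rfl), ENNReal.add_lt_top]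
  constructor
  · refine (lintegral_mono (g := fun _ => volume {x | ℋ x ≤ R}) fun t => ?_).trans_lt ?_
    · exact (measure_mono (subset_univ _)).trans_eq (Measure.restrict_apply_univ _)
    · rw [setLIntegral_const, Real.volume_Ioc]
      exact ENNReal.mul_lt_top (volume_sublevel_lt_top hℋ R) ENNReal.ofReal_lt_top
  · refine (setLIntegral_mono' measurableSet_Ioi fun t ht =>
      hbound t (zero_lt_one.trans ht)).trans_lt ?_
    have hint : IntegrableOn (fun t : ℝ => C * t ^ (-2 : ℝ)) (Ioi 1) :=
      (integrableOn_Ioi_rpow_of_lt (by norm_num) one_pos).const_mul C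
    exact hint.lintegral_lt_top

/-- The singular weight of the critical levels is integrable on sublevel sets. -/
theorem lintegral_rpow_critDist_lt_top (hℋ : HamiltonianHyp ℋ) (R : ℝ) :
    ∫⁻ x in {x | ℋ x ≤ R}, ENNReal.ofReal (critDist ℋ (ℋ x) ^ (-(1 / 4) : ℝ)) < ∞ := by
  set Z := (finite_criticalValues hℋ).toFinset
  calc ∫⁻ x in {x | ℋ x ≤ R}, ENNReal.ofReal (critDist ℋ (ℋ x) ^ (-(1 / 4) : ℝ))
      ≤ ∫⁻ x in {x | ℋ x ≤ R}, ∑ c ∈ Z, ENNReal.ofReal (|ℋ x - c| ^ (-(1 / 4) : ℝ)) := by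
        refine lintegral_mono fun x => ?_
        obtain ⟨c, hc, h⟩ := exists_critDist_eq hℋ (ℋ x)
        rw [h]
        exact Finset.single_le_sum
          (f := fun c => ENNReal.ofReal (|ℋ x - c| ^ (-(1 / 4) : ℝ)))
          (fun _ _ => zero_le) ((finite_criticalValues hℋ).mem_toFinset.2 hc)
    _ = ∑ c ∈ Z, ∫⁻ x in {x | ℋ x ≤ R}, ENNReal.ofReal (|ℋ x - c| ^ (-(1 / 4) : ℝ)) := by
        refine lintegral_finsetSum _ fun c _ => ?_
        have h1 : Measurable fun x => |ℋ x - c| :=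
          (hℋ.continuous.sub continuous_const).abs.measurable
        exact (h1.pow_const _).ennreal_ofReal
    _ < ∞ := ENNReal.sum_lt_top.2 fun c _ => lintegral_rpow_dist_value_lt_top hℋ R c

end

noncomputable section

open LevelGraph

/-! ### Estimates along the edges -/

/-- The weighted Cauchy–Schwarz inequality for the integral over an interval. -/
lemma enorm_intervalIntegral_sq_le {F : Type*} [NormedAddCommGroup F] [NormedSpace ℝ F]
    {g : ℝ → F} {s t : ℝ} (hg : IntervalIntegrable g volume s t) {σ : ℝ → ℝ} (hσ : Measurable σ)
    (hσ0 : ∀ x ∈ uIoc s t, 0 < σ x) :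
    ‖∫ x in s..t, g x‖ₑ ^ 2 ≤ (∫⁻ x in uIoc s t, ‖g x‖ₑ ^ 2 * ENNReal.ofReal (σ x)) *
      ∫⁻ x in uIoc s t, ENNReal.ofReal (σ x)⁻¹ := by
  have hgm : AEMeasurable (fun x => ‖g x‖ₑ) (volume.restrict (uIoc s t)) :=
    hg.def'.aestronglyMeasurable.enorm
  have hsq : Measurable fun x => ENNReal.ofReal √(σ x) := hσ.sqrt.ennreal_ofReal
  have hsq' : Measurable fun x => ENNReal.ofReal (√(σ x))⁻¹ := hσ.sqrt.inv.ennreal_ofReal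
  have h1 : ‖∫ x in s..t, g x‖ₑ ≤ ∫⁻ x in uIoc s t, ‖g x‖ₑ := by
    rw [← ofReal_norm, intervalIntegral.norm_integral_eq_norm_integral_uIoc, ofReal_norm]
    exact enorm_integral_le_lintegral_enorm _
  have h2 : ∫⁻ x in uIoc s t, ‖g x‖ₑ = ∫⁻ x in uIoc s t,
      ((fun x => ‖g x‖ₑ * ENNReal.ofReal √(σ x)) * fun x => ENNReal.ofReal (√(σ x))⁻¹) x := by
    refine setLIntegral_congr_fun measurableSet_uIoc fun x hx => ?_
    have h3 := Real.sqrt_pos.2 (hσ0 x hx)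
    simp only [Pi.mul_apply]
    rw [mul_assoc, ← ENNReal.ofReal_mul h3.le, mul_inv_cancel₀ h3.ne', ENNReal.ofReal_one, mul_one]
  have h3 := ENNReal.lintegral_mul_le_Lp_mul_Lq (volume.restrict (uIoc s t))
    Real.HolderConjugate.two_two (hgm.mul hsq.aemeasurable) hsq'.aemeasurable
  have h4 : ∀ A B : ℝ≥0∞, (A ^ (1 / 2 : ℝ) * B ^ (1 / 2 : ℝ)) ^ 2 = A * B := fun A B => by
    rw [mul_pow, ← ENNReal.rpow_mul_natCast, ← ENNReal.rpow_mul_natCast]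
    norm_num
  calc ‖∫ x in s..t, g x‖ₑ ^ 2
      ≤ ((∫⁻ x in uIoc s t, (‖g x‖ₑ * ENNReal.ofReal √(σ x)) ^ (2 : ℝ)) ^ (1 / 2 : ℝ) *
        (∫⁻ x in uIoc s t, ENNReal.ofReal (√(σ x))⁻¹ ^ (2 : ℝ)) ^ (1 / 2 : ℝ)) ^ 2 := by
        gcongr
        exact (h1.trans_eq h2).trans h3
    _ = (∫⁻ x in uIoc s t, (‖g x‖ₑ * ENNReal.ofReal √(σ x)) ^ (2 : ℝ)) *
        ∫⁻ x in uIoc s t, ENNReal.ofReal (√(σ x))⁻¹ ^ (2 : ℝ) := h4 _ _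
    _ = _ := by
        congr 1
        · refine setLIntegral_congr_fun measurableSet_uIoc fun x hx => ?_
          rw [ENNReal.rpow_two, mul_pow, ← ENNReal.ofReal_pow (Real.sqrt_nonneg _),
            Real.sq_sqrt (hσ0 x hx).le]
        · refine setLIntegral_congr_fun measurableSet_uIoc fun x hx => ?_
          rw [ENNReal.rpow_two, ← ENNReal.ofReal_pow (inv_nonneg.2 (Real.sqrt_nonneg _)), inv_pow,
            Real.sq_sqrt (hσ0 x hx).le]

lemma intervalIntegrable_abs_rpow {r : ℝ} (hr : -1 < r) (a b : ℝ) :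
    IntervalIntegrable (fun x : ℝ => |x| ^ r) volume a b := by
  have h1 : ∀ c : ℝ, 0 ≤ c → IntervalIntegrable (fun x : ℝ => |x| ^ r) volume 0 c := fun c hc => by
    refine (intervalIntegral.intervalIntegrable_rpow' hr).congr fun x hx => ?_
    rw [uIoc_of_le hc] at hx
    rw [abs_of_pos hx.1]
  have h2 : ∀ c : ℝ, IntervalIntegrable (fun x : ℝ => |x| ^ r) volume 0 c := fun c => by
    rcases le_total 0 c with h | h
    · exact h1 c h
    · rw [IntervalIntegrable.iff_comp_neg, neg_zero]
      simpa using h1 (-c) (by linarith)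
  exact (h2 a).symm.trans (h2 b)

variable {ℋ : Plane → ℝ}

/-- Complements the exponent `-1/4`: together they make up `critDist⁻¹`, which is not integrable by
itself. -/
lemma lintegral_critDist_rpow_lt_top (hℋ : HamiltonianHyp ℋ) (R : ℝ) :
    ∫⁻ s in Icc 0 R, ENNReal.ofReal (critDist ℋ s ^ (-(3 / 4) : ℝ)) < ∞ := by
  set Z := (finite_criticalValues hℋ).toFinset
  calc ∫⁻ s in Icc 0 R, ENNReal.ofReal (critDist ℋ s ^ (-(3 / 4) : ℝ))
      ≤ ∫⁻ s in Icc 0 R, ∑ c ∈ Z, ENNReal.ofReal (|s - c| ^ (-(3 / 4) : ℝ)) := by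
        refine lintegral_mono fun s => ?_
        obtain ⟨c, hc, h⟩ := exists_critDist_eq hℋ s
        rw [h]
        exact Finset.single_le_sum (f := fun c => ENNReal.ofReal (|s - c| ^ (-(3 / 4) : ℝ)))
          (fun _ _ => zero_le) ((finite_criticalValues hℋ).mem_toFinset.2 hc)
    _ = ∑ c ∈ Z, ∫⁻ s in Icc 0 R, ENNReal.ofReal (|s - c| ^ (-(3 / 4) : ℝ)) := by
        refine lintegral_finsetSum _ fun c _ => ?_
        have h1 : Measurable fun s : ℝ => |s - c| :=
          (continuous_id.sub continuous_const).abs.measurable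
        exact (h1.pow_const _).ennreal_ofReal
    _ < ∞ := ENNReal.sum_lt_top.2 fun c _ => by
        rcases lt_or_ge R 0 with hR | hR
        · rw [Icc_eq_empty (not_le.2 hR)]; simp
        · have h := (intervalIntegrable_abs_rpow (r := -(3 / 4)) (by norm_num) (0 - c)
            (R - c)).comp_sub_right c
          rw [sub_add_cancel, sub_add_cancel, intervalIntegrable_iff_integrableOn_Icc_of_le hR] at h
          exact h.lintegral_lt_top

/-- The data of a function on the graph with weak derivatives along the edges: along every edge
`k` the continuous representative `F k` and its weak derivative `g k`, with a bound for the
Sobolev energy. -/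
structure IsProfile (w : ℝ → ℝ) (M : ℝ) (F g : Edge ℋ → ℝ → ℝ) : Prop where
  continuousOn : ∀ k, ContinuousOn (F k) k.interval
  locallyIntegrableOn : ∀ k, LocallyIntegrableOn (g k) k.interval
  sub_eq : ∀ k, ∀ s ∈ k.interval, ∀ t ∈ k.interval, F k t - F k s = ∫ x in s..t, g k x
  energy_le : ∑' k : Edge ℋ, ∫⁻ z in k.interval,
    (‖F k z‖ₑ ^ 2 * k.period z + ‖g k z‖ₑ ^ 2 * k.alpha z) * ENNReal.ofReal (w z)
      ≤ ENNReal.ofReal M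

/-- A function of finite Sobolev norm has a profile. -/
lemma exists_isProfile (hℋ : HamiltonianHyp ℋ) {W : LevelGraph ℋ → ℝ} {w : ℝ → ℝ}
    (hW : ∀ p, W p = w (height ℋ p)) {f : LevelGraph ℋ → ℝ} {M : ℝ}
    (hf : sobolevNormSq W f < ENNReal.ofReal M) :
    ∃ F g : Edge ℋ → ℝ → ℝ, IsProfile w M F g ∧
      ∀ k : Edge ℋ, ∀ᵐ z, z ∈ k.interval → f (k.point z) = F k z := by
  -- The strict inequality selects one weak derivative from the infimum.
  obtain ⟨g, hg⟩ := iInf_lt_iff.1 hf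
  obtain ⟨hder, hlt⟩ := iInf_lt_iff.1 hg
  choose F hFc hFae hFsub using fun k =>
    (hder k).exists_primitive (k.isOpen_interval hℋ) (k.ordConnected_interval hℋ)
  refine ⟨F, g, ⟨hFc, fun k => (hder k).2.1, hFsub, le_trans (le_of_eq ?_) hlt.le⟩, hFae⟩
  refine tsum_congr fun k => ?_
  refine setLIntegral_congr_fun_ae (k.isOpen_interval hℋ).measurableSet ?_
  filter_upwards [hFae k] with z hz hzk
  rw [hW, Edge.height_point hzk, hz hzk]

section ProfileBounds

variable {w : ℝ → ℝ} {M : ℝ} {F g : Edge ℋ → ℝ → ℝ}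

lemma IsProfile.intervalIntegrable (hℋ : HamiltonianHyp ℋ) (h : IsProfile w M F g) {k : Edge ℋ}
    {s t : ℝ} (hs : s ∈ k.interval) (ht : t ∈ k.interval) :
    IntervalIntegrable (g k) volume s t :=
  LocallyIntegrableOn.intervalIntegrable_of_ordConnected (k.ordConnected_interval hℋ)
    (h.locallyIntegrableOn k) hs ht

lemma IsProfile.lintegral_period_le (h : IsProfile w M F g) (k : Edge ℋ) :
    ∫⁻ z in k.interval, ‖F k z‖ₑ ^ 2 * k.period z * ENNReal.ofReal (w z) ≤ ENNReal.ofReal M := by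
  refine le_trans ?_ ((ENNReal.le_tsum k).trans h.energy_le)
  gcongr
  exact le_self_add

lemma IsProfile.lintegral_alpha_le (h : IsProfile w M F g) (k : Edge ℋ) :
    ∫⁻ z in k.interval, ‖g k z‖ₑ ^ 2 * k.alpha z * ENNReal.ofReal (w z) ≤ ENNReal.ofReal M := by
  refine le_trans ?_ ((ENNReal.le_tsum k).trans h.energy_le)
  gcongr
  exact le_add_self

lemma edge_interval_nonneg (hℋ : HamiltonianHyp ℋ) {k : Edge ℋ} {z : ℝ} (hz : z ∈ k.interval) :
    0 ≤ z := by
  obtain ⟨p, -, rfl⟩ := hz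
  obtain ⟨x, rfl⟩ := surjective_proj p
  exact hℋ.nonneg x

lemma critDist_sub_le (s z : ℝ) : critDist ℋ z - |s - z| ≤ critDist ℋ s := by
  have := Metric.infDist_le_infDist_add_dist (s := criticalValues ℋ) (x := z) (y := s)
  rw [dist_comm, Real.dist_eq] at this
  rw [critDist, critDist]
  linarith

/-- The critical value nearest to `s` lies outside the segment, so one end of the segment lies
between it and `s`. -/
lemma min_critDist_le (hℋ : HamiltonianHyp ℋ) {z m s : ℝ}
    (hgap : Disjoint (uIcc z m) (criticalValues ℋ)) (hs : s ∈ uIcc z m) :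
    min (critDist ℋ z) (critDist ℋ m) ≤ critDist ℋ s := by
  obtain ⟨c, hc, h⟩ := exists_critDist_eq hℋ s
  rw [h]
  have hcn : c ∉ uIcc z m := fun h => Set.disjoint_left.1 hgap h hc
  have h1 := critDist_le (ℋ := ℋ) (z := z) hc
  have h2 := critDist_le (ℋ := ℋ) (z := m) hc
  rw [mem_uIcc] at hs hcn
  push Not at hcn
  rcases hs with hs | hs
  · rcases lt_or_ge c z with h3 | h3
    · refine (min_le_left _ _).trans (h1.trans ?_)
      rw [abs_of_pos (by linarith), abs_of_pos (by linarith)]; linarith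
    · have h4 := hcn.1 h3
      refine (min_le_right _ _).trans (h2.trans ?_)
      rw [abs_of_neg (by linarith), abs_of_neg (by linarith)]; linarith
  · rcases lt_or_ge c m with h3 | h3
    · refine (min_le_right _ _).trans (h2.trans ?_)
      rw [abs_of_pos (by linarith), abs_of_pos (by linarith)]; linarith
    · have h4 := hcn.2 h3
      refine (min_le_left _ _).trans (h1.trans ?_)
      rw [abs_of_neg (by linarith), abs_of_neg (by linarith)]; linarith

/-- The increments of a profile in a region away from the critical values. -/
lemma exists_increment_bound (hℋ : HamiltonianHyp ℋ) (hw : Continuous w) (hw0 : ∀ z, 0 < w z)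
    (M R : ℝ) :
    ∃ C : ℝ, 0 < C ∧ ∀ F g : Edge ℋ → ℝ → ℝ, IsProfile w M F g → ∀ k : Edge ℋ,
      ∀ s ∈ k.interval, ∀ t ∈ k.interval, s ≤ R → t ≤ R → (∀ x ∈ uIcc s t, 0 < critDist ℋ x) →
      ‖F k t - F k s‖ₑ ^ 2 ≤ ENNReal.ofReal C *
        ∫⁻ x in uIoc s t, ENNReal.ofReal (critDist ℋ x)⁻¹ := by
  obtain ⟨c, hc0, hc⟩ := exists_mul_critDist_le_alpha hℋ R
  obtain ⟨w₀, hw₀, hww₀⟩ : ∃ w₀ : ℝ, 0 < w₀ ∧ ∀ z ∈ Icc 0 R, w₀ ≤ w z := by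
    rcases lt_or_ge R 0 with hR | hR
    · exact ⟨1, one_pos, by simp [Icc_eq_empty (not_le.2 hR)]⟩
    · obtain ⟨z, -, hz⟩ := isCompact_Icc.exists_isMinOn (nonempty_Icc.2 hR) hw.continuousOn
      exact ⟨w z, hw0 z, hz⟩
  refine ⟨max M 1 / (c * w₀), by positivity, ?_⟩
  intro F g h k s hs t ht hsR htR hpos
  rw [h.sub_eq k s hs t ht]
  refine (enorm_intervalIntegral_sq_le (h.intervalIntegrable hℋ hs ht)
    (continuous_critDist (ℋ := ℋ)).measurable fun x hx => hpos x (uIoc_subset_uIcc hx)).trans ?_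
  gcongr
  have hsub : uIoc s t ⊆ k.interval :=
    uIoc_subset_uIcc.trans ((k.ordConnected_interval hℋ).uIcc_subset hs ht)
  -- On bounded heights `α_k ≥ c critDist` and `w ≥ w₀`, so the energy controls the derivative in
  -- the weight `critDist`.
  have h1 : ENNReal.ofReal (c * w₀) * ∫⁻ x in uIoc s t, ‖g k x‖ₑ ^ 2 *
      ENNReal.ofReal (critDist ℋ x) ≤ ENNReal.ofReal M := by
    rw [← lintegral_const_mul' _ _ ENNReal.ofReal_ne_top]
    refine le_trans ?_ (h.lintegral_alpha_le k)
    refine le_trans ?_ (lintegral_mono_set hsub)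
    refine setLIntegral_mono' measurableSet_uIoc fun x hx => ?_
    have hxk := hsub hx
    have hxR : x ≤ R := (uIoc_subset_uIcc hx).2.trans (max_le hsR htR)
    calc ENNReal.ofReal (c * w₀) * (‖g k x‖ₑ ^ 2 * ENNReal.ofReal (critDist ℋ x))
        = ‖g k x‖ₑ ^ 2 * ENNReal.ofReal (c * critDist ℋ x) * ENNReal.ofReal w₀ := by
          rw [ENNReal.ofReal_mul hc0.le, ENNReal.ofReal_mul hc0.le]; ring
      _ ≤ ‖g k x‖ₑ ^ 2 * k.alpha x * ENNReal.ofReal (w x) := by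
          gcongr
          · exact hc k x hxk hxR
          · exact hww₀ x ⟨edge_interval_nonneg hℋ hxk, hxR⟩
  rw [ENNReal.ofReal_div_of_pos (by positivity), ENNReal.le_div_iff_mul_le
    (Or.inl (by simpa using by positivity)) (Or.inl ENNReal.ofReal_ne_top), mul_comm]
  exact h1.trans (ENNReal.ofReal_le_ofReal (le_max_left _ _))

/-- The pointwise bound for profiles, with a weak singularity at the critical values. -/
theorem exists_profile_bound (hℋ : HamiltonianHyp ℋ) (hw : Continuous w) (hw0 : ∀ z, 0 < w z)
    (M R : ℝ) :
    ∃ C : ℝ, 0 < C ∧ ∀ F g : Edge ℋ → ℝ → ℝ, IsProfile w M F g → ∀ k : Edge ℋ,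
      ∀ z ∈ k.interval, z ∉ criticalValues ℋ → z ≤ R →
      F k z ^ 2 ≤ C * (1 + critDist ℋ z ^ (-(1 / 4) : ℝ)) := by
  obtain ⟨δ, hδ0, hδ⟩ := exists_gap hℋ
  obtain ⟨K, hK0, hK⟩ := hℋ.exists_gradient_lipschitz
  set R' := R + δ with hR'
  obtain ⟨C₁, hC₁0, hC₁⟩ := exists_increment_bound hℋ hw hw0 M R'
  obtain ⟨w₀, hw₀, hww₀⟩ : ∃ w₀ : ℝ, 0 < w₀ ∧ ∀ z ∈ Icc 0 R', w₀ ≤ w z := by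
    rcases lt_or_ge R' 0 with hR | hR
    · exact ⟨1, one_pos, by simp [Icc_eq_empty (not_le.2 hR)]⟩
    · obtain ⟨z, -, hz⟩ := isCompact_Icc.exists_isMinOn (nonempty_Icc.2 hR) hw.continuousOn
      exact ⟨w z, hw0 z, hz⟩
  set I := (∫⁻ s in Icc 0 R', ENNReal.ofReal (critDist ℋ s ^ (-(3 / 4) : ℝ))).toReal with hI
  have hItop : ∫⁻ s in Icc 0 R', ENNReal.ofReal (critDist ℋ s ^ (-(3 / 4) : ℝ)) ≠ ∞ :=
    (lintegral_critDist_rpow_lt_top hℋ R').ne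
  have hI0 : 0 ≤ I := ENNReal.toReal_nonneg
  -- If `F²` exceeded `Λ` on a whole interval of length `δ / 3`, its energy would be at least `max M
  -- 0 + 1`.
  set Λ := (max M 0 + 1) / (1 / (3 * K) * w₀ * (δ / 3)) with hΛ
  have hΛ0 : 0 < Λ := by positivity
  set D := (δ / 3) ^ (-(1 / 4) : ℝ) with hD
  have hD0 : 0 < D := by positivity
  refine ⟨2 * Λ + 2 * C₁ * I * D + 2 * C₁ * I, by positivity, ?_⟩
  intro F g h k z hz hzc hzR
  -- The edge fills the gap above the last critical value `c` below `z`. The comparison point `m` is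
  -- taken in the middle third of `(c, c + δ)`, at distance at least `δ / 3` from all critical
  -- values.
  obtain ⟨c, hc, hcz, hcgap, hJ⟩ := k.exists_gap_subset hℋ hδ hz hzc
  have hsubJ : Ioo (c + δ / 3) (c + 2 * δ / 3) ⊆ k.interval := fun m hm =>
    (hJ m ⟨by linarith [hm.1], by linarith [hm.2]⟩).2
  have hm_ex : ∃ m ∈ Ioo (c + δ / 3) (c + 2 * δ / 3), F k m ^ 2 ≤ Λ := by
    by_contra! hcon
    have h1 : ENNReal.ofReal (Λ * (1 / (3 * K)) * w₀) * volume (Ioo (c + δ / 3) (c + 2 * δ / 3))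
        ≤ ENNReal.ofReal M := by
      rw [← setLIntegral_const]
      refine le_trans ?_ (h.lintegral_period_le k)
      refine le_trans ?_ (lintegral_mono_set hsubJ)
      refine setLIntegral_mono' measurableSet_Ioo fun m hm => ?_
      have hmk := hsubJ hm
      rw [ENNReal.ofReal_mul (by positivity), ENNReal.ofReal_mul (by positivity)]
      gcongr
      · rw [← ofReal_norm, ← ENNReal.ofReal_pow (norm_nonneg _), Real.norm_eq_abs, sq_abs]
        exact ENNReal.ofReal_le_ofReal (hcon m hm).le
      · exact ofReal_le_period hℋ hK0 hK hmk
      · exact hww₀ m ⟨edge_interval_nonneg hℋ hmk, by linarith [hm.2]⟩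
    rw [Real.volume_Ioo, ← ENNReal.ofReal_mul (by positivity)] at h1
    have h2 : Λ * (1 / (3 * K)) * w₀ * (c + 2 * δ / 3 - (c + δ / 3)) = max M 0 + 1 := by
      rw [hΛ]; field_simp; ring
    rw [h2, ENNReal.ofReal_le_ofReal_iff'] at h1
    rcases h1 with h1 | h1
    · linarith [le_max_left M 0]
    · linarith [le_max_right M 0]
  obtain ⟨m, hm, hmΛ⟩ := hm_ex
  obtain ⟨hgap, hmk⟩ := hJ m ⟨by linarith [hm.1], by linarith [hm.2]⟩
  have hmR : m ≤ R' := by linarith [hm.2]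
  have hzR' : z ≤ R' := by linarith
  have hmd : δ / 3 ≤ critDist ℋ m := by
    obtain ⟨v, hv, hvm⟩ := exists_critDist_eq hℋ m
    rw [hvm]
    rcases le_or_gt v c with h1 | h1
    · rw [abs_of_pos (by linarith [hm.1])]; linarith [hm.1]
    · have := hδ c hc v hv h1
      rw [abs_of_neg (by linarith [hm.2])]; linarith [hm.2]
  have hzd : 0 < critDist ℋ z := critDist_pos hℋ hzc
  set η := min (critDist ℋ z) (δ / 3) with hη
  have hη0 : 0 < η := lt_min hzd (by positivity)
  have hηle : ∀ x ∈ uIcc z m, η ≤ critDist ℋ x := fun x hx =>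
    (min_le_min le_rfl hmd).trans (min_critDist_le hℋ hgap hx)
  have hηpow : η ^ (-(1 / 4) : ℝ) ≤ critDist ℋ z ^ (-(1 / 4) : ℝ) + D := by
    rcases min_choice (critDist ℋ z) (δ / 3) with h1 | h1 <;> rw [hη, h1]
    · linarith
    · have : 0 ≤ critDist ℋ z ^ (-(1 / 4) : ℝ) := by positivity
      linarith
  -- Of `critDist⁻¹` the power `-1/4` is taken out at its largest value, and the power `-3/4` is
  -- integrated.
  have hint : ∫⁻ x in uIoc z m, ENNReal.ofReal (critDist ℋ x)⁻¹
      ≤ ENNReal.ofReal (η ^ (-(1 / 4) : ℝ) * I) := by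
    calc ∫⁻ x in uIoc z m, ENNReal.ofReal (critDist ℋ x)⁻¹
        ≤ ∫⁻ x in uIoc z m, ENNReal.ofReal (η ^ (-(1 / 4) : ℝ)) *
            ENNReal.ofReal (critDist ℋ x ^ (-(3 / 4) : ℝ)) := by
          refine setLIntegral_mono' measurableSet_uIoc fun x hx => ?_
          have h1 := hηle x (uIoc_subset_uIcc hx)
          have h2 : 0 < critDist ℋ x := hη0.trans_le h1
          rw [← ENNReal.ofReal_mul (by positivity)]
          refine ENNReal.ofReal_le_ofReal ?_
          calc (critDist ℋ x)⁻¹ = critDist ℋ x ^ (-(1 / 4) : ℝ) * critDist ℋ x ^ (-(3 / 4) : ℝ) := by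
                rw [← Real.rpow_add h2, ← Real.rpow_neg_one]; norm_num
            _ ≤ η ^ (-(1 / 4) : ℝ) * critDist ℋ x ^ (-(3 / 4) : ℝ) := by
                refine mul_le_mul_of_nonneg_right ?_ (by positivity)
                exact Real.rpow_le_rpow_of_nonpos hη0 h1 (by norm_num)
      _ = ENNReal.ofReal (η ^ (-(1 / 4) : ℝ)) *
            ∫⁻ x in uIoc z m, ENNReal.ofReal (critDist ℋ x ^ (-(3 / 4) : ℝ)) :=
          lintegral_const_mul' _ _ ENNReal.ofReal_ne_top
      _ ≤ ENNReal.ofReal (η ^ (-(1 / 4) : ℝ)) *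
            ∫⁻ x in Icc 0 R', ENNReal.ofReal (critDist ℋ x ^ (-(3 / 4) : ℝ)) := by
          gcongr
          refine uIoc_subset_uIcc.trans (fun x hx => ⟨?_, hx.2.trans (max_le hzR' hmR)⟩)
          exact (le_min (edge_interval_nonneg hℋ hz) (edge_interval_nonneg hℋ hmk)).trans hx.1
      _ = ENNReal.ofReal (η ^ (-(1 / 4) : ℝ) * I) := by
          rw [ENNReal.ofReal_mul (by positivity), hI, ENNReal.ofReal_toReal hItop]
  have hinc := hC₁ F g h k z hz m hmk hzR' hmR fun x hx => hη0.trans_le (hηle x hx)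
  have hinc' : (F k m - F k z) ^ 2 ≤ C₁ * (η ^ (-(1 / 4) : ℝ) * I) := by
    have h1 := hinc.trans (mul_le_mul_right hint _)
    rw [← ENNReal.ofReal_mul hC₁0.le, ← ofReal_norm, ← ENNReal.ofReal_pow (norm_nonneg _),
      Real.norm_eq_abs, sq_abs] at h1
    exact (ENNReal.ofReal_le_ofReal_iff (by positivity)).1 h1
  have hinc'' : (F k m - F k z) ^ 2 ≤ C₁ * I * (critDist ℋ z ^ (-(1 / 4) : ℝ) + D) := by
    refine hinc'.trans ?_
    rw [mul_assoc, mul_comm _ I]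
    gcongr
  have hP : 0 ≤ critDist ℋ z ^ (-(1 / 4) : ℝ) := by positivity
  have h5 : F k z ^ 2 ≤ 2 * F k m ^ 2 + 2 * (F k m - F k z) ^ 2 := by
    nlinarith [sq_nonneg (2 * F k m - F k z)]
  have h6 : 0 ≤ Λ * critDist ℋ z ^ (-(1 / 4) : ℝ) := by positivity
  have h7 : 0 ≤ C₁ * I * D * critDist ℋ z ^ (-(1 / 4) : ℝ) := by positivity
  have h8 : 0 ≤ C₁ * I := by positivity
  nlinarith

end ProfileBounds

end

noncomputable section

open LevelGraph

/-! ### Functions on the graph and functions on the plane -/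

variable {ℋ : Plane → ℝ}

lemma volume_preimage_criticalValues (hℋ : HamiltonianHyp ℋ) :
    volume (ℋ ⁻¹' criticalValues ℋ) = 0 := by
  have hE : MeasurableSet {x | gradient ℋ x ≠ 0} :=
    (isOpen_ne.preimage hℋ.continuous_gradient).measurableSet
  refine measure_mono_null (t := {x | gradient ℋ x = 0} ∪
    ({x | gradient ℋ x ≠ 0} ∩ ℋ ⁻¹' criticalValues ℋ)) (fun x hx => ?_) (measure_union_null
      (hℋ.finite_critical.measure_zero _) (volume_inter_preimage_eq_zero hℋ hE (fun x hx => hx)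
        ((finite_criticalValues hℋ).measure_zero _)))
  by_cases h : gradient ℋ x = 0
  · exact Or.inl h
  · exact Or.inr ⟨h, hx⟩

/-- Almost every point of the plane lies over an edge, at a height that is not critical. -/
lemma ae_exists_edge (hℋ : HamiltonianHyp ℋ) :
    ∀ᵐ x : Plane, ℋ x ∉ criticalValues ℋ ∧ ∃ k : Edge ℋ, proj ℋ x ∈ k.1 := by
  filter_upwards [measure_eq_zero_iff_ae_notMem.1 (volume_preimage_criticalValues hℋ)] with x hx
  exact ⟨hx, Edge.exists_mem (notMem_vertices (p := proj ℋ x) hx)⟩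

lemma measurableSet_over_edge (hℋ : HamiltonianHyp ℋ) (k : Edge ℋ) :
    MeasurableSet (proj ℋ ⁻¹' k.1) :=
  ((k.isOpen hℋ).preimage continuous_proj).measurableSet

lemma levelDensity_over_edge (k : Edge ℋ) (z : ℝ) :
    levelDensity ℋ (proj ℋ ⁻¹' k.1) z = k.period z := by
  rw [levelDensity, inter_comm]
  rfl

lemma mem_interval_of_proj {k : Edge ℋ} {x : Plane} (hx : proj ℋ x ∈ k.1) : ℋ x ∈ k.interval :=
  mem_image_of_mem (height ℋ) hx

/-- `F` represents `f` along the edges. -/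
def Represents (f : LevelGraph ℋ → ℝ) (F : Edge ℋ → ℝ → ℝ) : Prop :=
  ∀ k : Edge ℋ, ∀ᵐ z, z ∈ k.interval → f (k.point z) = F k z

/-- Over an edge the gradient does not vanish, so a null set of exceptional heights has a null
preimage in the plane. -/
lemma Represents.ae_eq (hℋ : HamiltonianHyp ℋ) {f : LevelGraph ℋ → ℝ} {F : Edge ℋ → ℝ → ℝ}
    (h : Represents f F) : ∀ᵐ x : Plane, ∀ k : Edge ℋ, proj ℋ x ∈ k.1 →
      f (proj ℋ x) = F k (ℋ x) := by
  have := finite_edge hℋ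
  rw [ae_all_iff]
  intro k
  have hnull := volume_inter_preimage_eq_zero hℋ (measurableSet_over_edge hℋ k)
    (fun x hx => gradient_ne_zero_of_proj (k.subset hx)) (ae_iff.1 (h k))
  filter_upwards [measure_eq_zero_iff_ae_notMem.1 hnull] with x hx hxk
  by_contra hne
  refine hx ⟨hxk, fun h => hne ?_⟩
  rw [← h (mem_interval_of_proj hxk)]
  congr 1
  exact (Edge.point_height hℋ hxk).symm

/-- The weighted `L²` norm of a function on the graph is controlled by the Sobolev energy. -/
lemma lintegral_proj_sq_le (hℋ : HamiltonianHyp ℋ) {w : ℝ → ℝ} (hw : Continuous w) {M : ℝ}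
    {f : LevelGraph ℋ → ℝ} {F g : Edge ℋ → ℝ → ℝ} (h : IsProfile w M F g)
    (hf : Represents f F) :
    ∫⁻ x, ‖f (proj ℋ x)‖ₑ ^ 2 * ENNReal.ofReal (w (ℋ x)) ≤ 3 * ENNReal.ofReal M := by
  classical
  have := finite_edge hℋ
  -- Extension of `F k` by zero makes the integrand measurable on the whole line, as the coarea
  -- inequality requires.
  set φ : Edge ℋ → ℝ → ℝ≥0∞ := fun k z =>
    ‖k.interval.piecewise (F k) 0 z‖ₑ ^ 2 * ENNReal.ofReal (w z) with hφ
  have hφm : ∀ k, Measurable (φ k) := fun k =>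
    ((((h.continuousOn k).measurable_piecewise continuousOn_const
      (k.isOpen_interval hℋ).measurableSet).enorm).pow_const 2).mul hw.measurable.ennreal_ofReal
  have hU : (⋃ k : Edge ℋ, proj ℋ ⁻¹' k.1) =ᵐ[volume] univ := by
    rw [ae_eq_univ]
    refine measure_mono_null ?_ (ae_iff.1 (ae_exists_edge hℋ))
    intro x hx hx'
    obtain ⟨k, hk⟩ := hx'.2
    exact hx (mem_iUnion_of_mem k hk)
  calc ∫⁻ x, ‖f (proj ℋ x)‖ₑ ^ 2 * ENNReal.ofReal (w (ℋ x))
      = ∫⁻ x in ⋃ k : Edge ℋ, proj ℋ ⁻¹' k.1,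
          ‖f (proj ℋ x)‖ₑ ^ 2 * ENNReal.ofReal (w (ℋ x)) := by
        rw [setLIntegral_congr hU, setLIntegral_univ]
    _ ≤ ∑' k : Edge ℋ, ∫⁻ x in proj ℋ ⁻¹' k.1,
          ‖f (proj ℋ x)‖ₑ ^ 2 * ENNReal.ofReal (w (ℋ x)) := lintegral_iUnion_le _ _
    _ = ∑' k : Edge ℋ, ∫⁻ x in proj ℋ ⁻¹' k.1, φ k (ℋ x) := by
        refine tsum_congr fun k => setLIntegral_congr_fun_ae (measurableSet_over_edge hℋ k) ?_
        filter_upwards [hf.ae_eq hℋ] with x hx hxk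
        simp only [hφ]
        rw [piecewise_eq_of_mem _ _ _ (mem_interval_of_proj hxk), hx k hxk]
    _ ≤ ∑' k : Edge ℋ, 3 * ∫⁻ z, φ k z * k.period z := by
        refine ENNReal.tsum_le_tsum fun k => ?_
        have h1 := lintegral_comp_height_le hℋ (measurableSet_over_edge hℋ k)
          (fun x hx => gradient_ne_zero_of_proj (k.subset hx)) (hφm k)
        simpa only [levelDensity_over_edge] using h1
    _ ≤ ∑' k : Edge ℋ, 3 * ∫⁻ z in k.interval,
          (‖F k z‖ₑ ^ 2 * k.period z + ‖g k z‖ₑ ^ 2 * k.alpha z) * ENNReal.ofReal (w z) := by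
        refine ENNReal.tsum_le_tsum fun k => ?_
        rw [← lintegral_indicator (k.isOpen_interval hℋ).measurableSet]
        gcongr with z
        by_cases hz : z ∈ k.interval
        · rw [indicator_of_mem hz]
          simp only [hφ]
          rw [piecewise_eq_of_mem _ _ _ hz, mul_right_comm]
          gcongr
          exact le_self_add
        · simp only [hφ]
          rw [indicator_of_notMem hz, piecewise_eq_of_notMem _ _ _ hz]
          simp
    _ = 3 * ∑' k : Edge ℋ, ∫⁻ z in k.interval,
          (‖F k z‖ₑ ^ 2 * k.period z + ‖g k z‖ₑ ^ 2 * k.alpha z) * ENNReal.ofReal (w z) :=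
        ENNReal.tsum_mul_left
    _ ≤ 3 * ENNReal.ofReal M := by gcongr; exact h.energy_le

/-! ### Discretization of Sobolev functions on the graph -/

lemma volume_critDist_lt_le (hℋ : HamiltonianHyp ℋ) (R : ℝ) :
    ∃ C : ℝ, 0 ≤ C ∧ ∀ s : ℝ, 0 < s →
      volume {x | ℋ x ≤ R ∧ critDist ℋ (ℋ x) < s ^ 4} ≤ ENNReal.ofReal (C * s ^ 2) := by
  choose C hC0 hC using fun c => volume_layer_le hℋ R c
  set Z := (finite_criticalValues hℋ).toFinset
  refine ⟨∑ c ∈ Z, C c, Finset.sum_nonneg fun c _ => hC0 c, fun s hs => ?_⟩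
  calc volume {x | ℋ x ≤ R ∧ critDist ℋ (ℋ x) < s ^ 4}
      ≤ volume (⋃ c ∈ Z, {x | ℋ x ≤ R ∧ |ℋ x - c| < s ^ 4}) := by
        refine measure_mono fun x hx => ?_
        obtain ⟨c, hc, h⟩ := exists_critDist_eq hℋ (ℋ x)
        exact mem_biUnion ((finite_criticalValues hℋ).mem_toFinset.2 hc) ⟨hx.1, h ▸ hx.2⟩
    _ ≤ ∑ c ∈ Z, volume {x | ℋ x ≤ R ∧ |ℋ x - c| < s ^ 4} := measure_biUnion_finset_le _ _
    _ ≤ ∑ c ∈ Z, ENNReal.ofReal (C c * s ^ 2) := Finset.sum_le_sum fun c _ => hC c s hs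
    _ = ENNReal.ofReal ((∑ c ∈ Z, C c) * s ^ 2) := by
        rw [← ENNReal.ofReal_sum_of_nonneg fun c _ => mul_nonneg (hC0 c) (sq_nonneg s),
          Finset.sum_mul]

/-- Small layers around the critical levels carry little of the singular weight. -/
lemma exists_layer_lintegral_lt (hℋ : HamiltonianHyp ℋ) (R : ℝ) {C : ℝ} (hC : 0 ≤ C)
    {ε : ℝ≥0∞} (hε : ε ≠ 0) :
    ∃ η : ℝ, 0 < η ∧ ∫⁻ x in {x | ℋ x ≤ R ∧ critDist ℋ (ℋ x) < η},
      ENNReal.ofReal (C * (1 + critDist ℋ (ℋ x) ^ (-(1 / 4) : ℝ))) < ε := by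
  set D := {x | ℋ x ≤ R} with hD
  have hfin : ∫⁻ x in D, ENNReal.ofReal (C * (1 + critDist ℋ (ℋ x) ^ (-(1 / 4) : ℝ))) ≠ ∞ := by
    have h1 : ∀ x, ENNReal.ofReal (C * (1 + critDist ℋ (ℋ x) ^ (-(1 / 4) : ℝ)))
        = ENNReal.ofReal C * (1 + ENNReal.ofReal (critDist ℋ (ℋ x) ^ (-(1 / 4) : ℝ))) := fun x => by
      have := critDist_nonneg (ℋ := ℋ) (ℋ x)
      rw [ENNReal.ofReal_mul hC, ENNReal.ofReal_add zero_le_one (by positivity),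
        ENNReal.ofReal_one]
    simp only [h1]
    rw [lintegral_const_mul' _ _ ENNReal.ofReal_ne_top, lintegral_add_left measurable_const,
      setLIntegral_one]
    exact (ENNReal.mul_lt_top ENNReal.ofReal_lt_top (ENNReal.add_lt_top.2
      ⟨volume_sublevel_lt_top hℋ R, lintegral_rpow_critDist_lt_top hℋ R⟩)).ne
  -- Absolute continuity of the integral: it is enough that the layer has small area.
  obtain ⟨δ, hδ, hsmall⟩ := exists_pos_setLIntegral_lt_of_measure_lt hfin hε
  obtain ⟨C', hC', hvol⟩ := volume_critDist_lt_le hℋ R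
  have hlim : Tendsto (fun s : ℝ => ENNReal.ofReal (C' * s ^ 2)) (𝓝[>] 0) (𝓝 0) := by
    have : Tendsto (fun s : ℝ => ENNReal.ofReal (C' * s ^ 2)) (𝓝 0)
        (𝓝 (ENNReal.ofReal (C' * 0 ^ 2))) :=
      (ENNReal.continuous_ofReal.comp (by fun_prop)).tendsto 0
    simp only [ne_eq, OfNat.ofNat_ne_zero, not_false_eq_true, zero_pow, mul_zero,
      ENNReal.ofReal_zero] at this
    exact this.mono_left nhdsWithin_le_nhds
  obtain ⟨s, hs, hs0⟩ := ((hlim.eventually_lt_const hδ).and self_mem_nhdsWithin).exists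
  refine ⟨s ^ 4, pow_pos hs0 4, ?_⟩
  have hDm : MeasurableSet D := (isClosed_le hℋ.continuous continuous_const).measurableSet
  have hNm : MeasurableSet {x | critDist ℋ (ℋ x) < s ^ 4} :=
    (isOpen_lt (continuous_critDist.comp hℋ.continuous) continuous_const).measurableSet
  have hset : {x | ℋ x ≤ R ∧ critDist ℋ (ℋ x) < s ^ 4} = {x | critDist ℋ (ℋ x) < s ^ 4} ∩ D := by
    ext x; exact and_comm
  rw [hset, ← Measure.restrict_restrict hNm]
  refine hsmall _ ?_
  rw [Measure.restrict_apply hNm, ← hset]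
  exact (hvol s hs0).trans_lt hs

lemma enorm_sq_eq_ofReal (c : ℝ) : ‖c‖ₑ ^ 2 = ENNReal.ofReal (c ^ 2) := by
  rw [← ofReal_norm, ← ENNReal.ofReal_pow (norm_nonneg _), Real.norm_eq_abs, sq_abs]

lemma enorm_sub_sq_le (a b : ℝ) : ‖a - b‖ₑ ^ 2 ≤ 2 * (‖a‖ₑ ^ 2 + ‖b‖ₑ ^ 2) := by
  rw [enorm_sq_eq_ofReal, enorm_sq_eq_ofReal, enorm_sq_eq_ofReal,
    ← ENNReal.ofReal_add (sq_nonneg _) (sq_nonneg _), ← ENNReal.ofReal_ofNat 2,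
    ← ENNReal.ofReal_mul zero_le_two]
  exact ENNReal.ofReal_le_ofReal (by nlinarith [sq_nonneg (a + b)])

/-- Up to a small error in the weaker weighted norm, a profile of bounded energy is determined by
its values at finitely many points of the graph. -/
theorem exists_discretization (hℋ : HamiltonianHyp ℋ) {θ : ℝ → ℝ} (hθ : Continuous θ)
    (hθ0 : ∀ z, 0 < θ z) {B : ℝ} (hB : ∀ z, θ z ≤ B) (hlim : Tendsto θ atTop (𝓝 0)) (M : ℝ)
    {ε : ℝ} (hε : 0 < ε) :
    ∃ (S : Set (Edge ℋ × ℝ)) (C κ : ℝ), S.Finite ∧ 0 < κ ∧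
      (∀ F g : Edge ℋ → ℝ → ℝ, IsProfile (fun z => √(θ z)) M F g →
        ∀ p ∈ S, |F p.1 p.2| ≤ C) ∧
      ∀ (f f' : LevelGraph ℋ → ℝ) (F g F' g' : Edge ℋ → ℝ → ℝ), Measurable f →
        IsProfile (fun z => √(θ z)) M F g → IsProfile (fun z => √(θ z)) M F' g' →
        Represents f F → Represents f' F' → (∀ p ∈ S, |F p.1 p.2 - F' p.1 p.2| ≤ κ) →
        ∫⁻ x, ‖f (proj ℋ x) - f' (proj ℋ x)‖ₑ ^ 2 * ENNReal.ofReal (θ (ℋ x))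
          ≤ ENNReal.ofReal ε := by
  have := finite_edge hℋ
  have hw : Continuous fun z => √(θ z) := hθ.sqrt
  have hw0 : ∀ z, 0 < √(θ z) := fun z => Real.sqrt_pos.2 (hθ0 z)
  have hB0 : 0 < B := (hθ0 0).trans_le (hB 0)
  -- Where `√θ ≤ ε₁` one has `θ ≤ ε₁ √θ`, and the difference costs at most `2 ε₁ (3 M + 3 M)`; this
  -- is to be at most `ε / 3`.
  set ε₁ := ε / (36 * max M 1) with hε₁
  have hε₁0 : 0 < ε₁ := by positivity
  obtain ⟨R, hR⟩ := eventually_atTop.1 (hlim.eventually_lt_const (show 0 < ε₁ ^ 2 by positivity))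
  obtain ⟨C₂, hC₂0, hC₂⟩ := exists_profile_bound hℋ hw hw0 M R
  obtain ⟨C₁, hC₁0, hC₁⟩ := exists_increment_bound hℋ hw hw0 M R
  -- The squared difference of two profiles is at most twice the sum of their squares, hence the 4;
  -- `B` bounds the weight.
  obtain ⟨η, hη0, hη⟩ := exists_layer_lintegral_lt hℋ R (C := 4 * C₂ * B) (by positivity)
    (ε := ENNReal.ofReal (ε / 3)) (by simpa using hε)
  set V := (volume {x | ℋ x ≤ R}).toReal with hV
  have hV0 : 0 ≤ V := ENNReal.toReal_nonneg
  have hVtop := (volume_sublevel_lt_top hℋ R).ne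
  -- In the core the profiles will differ by at most `3 κ`, so the error is `9 κ² B V ≤ ε / 3`.
  set κ := √(ε / 3 / (9 * B * (V + 1))) with hκ
  have hκ0 : 0 < κ := Real.sqrt_pos.2 (by positivity)
  have hκsq : κ ^ 2 = ε / 3 / (9 * B * (V + 1)) := Real.sq_sqrt (by positivity)
  -- The mesh keeps the grid point below `z` at distance at least `η / 2` from the critical values,
  -- and makes the squared increment `C₁ h / (η / 2)` at most `κ²`.
  set h := min (η / 2) (κ ^ 2 * η / (2 * C₁)) with hh
  have hh0 : 0 < h := lt_min (by positivity) (by positivity)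
  set S : Set (Edge ℋ × ℝ) := {p | p.2 ∈ p.1.interval ∧ p.2 ≤ R ∧ η / 2 ≤ critDist ℋ p.2 ∧
    ∃ n : ℕ, p.2 = n * h} with hS
  have hSfin : S.Finite := by
    refine (finite_univ.prod ((finite_Iic ⌊R / h⌋₊).image fun n : ℕ => n * h)).subset ?_
    rintro ⟨k, q⟩ ⟨-, hqR, -, n, rfl⟩
    refine ⟨mem_univ _, n, Nat.le_floor ?_, rfl⟩
    rwa [le_div_iff₀ hh0]
  set C₃ := √(C₂ * (1 + (η / 2) ^ (-(1 / 4) : ℝ)))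
  refine ⟨S, C₃, κ, hSfin, hκ0, ?_, ?_⟩
  · rintro F g hF ⟨k, q⟩ ⟨hqk, hqR, hqη, -⟩
    have hqc : q ∉ criticalValues ℋ := fun hc => by
      have := critDist_le (z := q) hc
      rw [sub_self, abs_zero] at this
      linarith [show η / 2 ≤ critDist ℋ q from hqη]
    refine Real.abs_le_sqrt ((hC₂ F g hF k q hqk hqc hqR).trans ?_)
    exact mul_le_mul_of_nonneg_left (add_le_add le_rfl
      (Real.rpow_le_rpow_of_nonpos (by positivity) hqη (by norm_num))) hC₂0.le
  intro f f' F g F' g' hf hF hF' hfF hfF' hclose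
  have hcore : ∀ k : Edge ℋ, ∀ z ∈ k.interval, z ≤ R → η ≤ critDist ℋ z →
      |F k z - F' k z| ≤ 3 * κ := by
    intro k z hz hzR hzη
    have hz0 := edge_interval_nonneg hℋ hz
    set q := (⌊z / h⌋₊ : ℝ) * h with hq
    have hqz : q ≤ z := by
      rw [hq, ← le_div_iff₀ hh0]
      exact Nat.floor_le (by positivity)
    have hzq : z - q ≤ h := by
      have := (Nat.lt_floor_add_one (z / h)).le
      rw [div_le_iff₀ hh0, add_mul, one_mul] at this
      linarith
    have hdist : ∀ x ∈ uIcc z q, η / 2 ≤ critDist ℋ x := by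
      intro x hx
      rw [uIcc_of_ge hqz] at hx
      have h1 := critDist_sub_le (ℋ := ℋ) x z
      rw [abs_of_nonpos (by linarith [hx.2])] at h1
      have h2 : h ≤ η / 2 := min_le_left _ _
      linarith [hx.1]
    have hgap : Disjoint (uIcc z q) (criticalValues ℋ) := by
      rw [Set.disjoint_left]
      intro x hx hxc
      have h1 := critDist_le (z := x) hxc
      rw [sub_self, abs_zero] at h1
      linarith [hdist x hx]
    have hqk : q ∈ k.interval := Edge.mem_interval_of_gap hℋ hz hgap
    have hqS : (k, q) ∈ S :=
      ⟨hqk, hqz.trans hzR, hdist q right_mem_uIcc, ⌊z / h⌋₊, rfl⟩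
    have hinc : ∀ G G' : Edge ℋ → ℝ → ℝ, IsProfile (fun z => √(θ z)) M G G' →
        |G k q - G k z| ≤ κ := by
      intro G G' hG
      have h1 := hC₁ G G' hG k z hz q hqk hzR (hqz.trans hzR)
        fun x hx => (half_pos hη0).trans_le (hdist x hx)
      have h2 : ∫⁻ x in uIoc z q, ENNReal.ofReal (critDist ℋ x)⁻¹
          ≤ ENNReal.ofReal ((η / 2)⁻¹ * h) := by
        calc ∫⁻ x in uIoc z q, ENNReal.ofReal (critDist ℋ x)⁻¹
            ≤ ∫⁻ _ in uIoc z q, ENNReal.ofReal (η / 2)⁻¹ := by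
              refine setLIntegral_mono' measurableSet_uIoc fun x hx => ?_
              refine ENNReal.ofReal_le_ofReal ?_
              exact inv_anti₀ (by positivity) (hdist x (uIoc_subset_uIcc hx))
          _ = ENNReal.ofReal (η / 2)⁻¹ * ENNReal.ofReal (z - q) := by
              rw [setLIntegral_const, uIoc_of_ge hqz, Real.volume_Ioc]
          _ ≤ _ := by
              rw [← ENNReal.ofReal_mul (by positivity)]
              gcongr
      have h3 := h1.trans (mul_le_mul_right h2 _)
      rw [← ENNReal.ofReal_mul hC₁0.le, ← ofReal_norm, ← ENNReal.ofReal_pow (norm_nonneg _),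
        Real.norm_eq_abs, ENNReal.ofReal_le_ofReal_iff (by positivity)] at h3
      refine (abs_le_of_sq_le_sq' ?_ hκ0.le).2
      refine h3.trans ?_
      calc C₁ * ((η / 2)⁻¹ * h) ≤ C₁ * ((η / 2)⁻¹ * (κ ^ 2 * η / (2 * C₁))) := by
            gcongr
            exact min_le_right _ _
        _ = κ ^ 2 := by field_simp
    have h1 := hclose _ hqS
    have h2 := hinc F g hF
    have h3 := hinc F' g' hF'
    rw [abs_le] at *
    constructor <;> linarith [h1.1, h1.2, h2.1, h2.2, h3.1, h3.2]
  set u : Plane → ℝ≥0∞ := fun x =>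
    ‖f (proj ℋ x) - f' (proj ℋ x)‖ₑ ^ 2 * ENNReal.ofReal (θ (ℋ x)) with hu
  have hae : ∀ᵐ x : Plane, ∃ k : Edge ℋ, proj ℋ x ∈ k.1 ∧ ℋ x ∉ criticalValues ℋ ∧
      f (proj ℋ x) = F k (ℋ x) ∧ f' (proj ℋ x) = F' k (ℋ x) := by
    filter_upwards [ae_exists_edge hℋ, hfF.ae_eq hℋ, hfF'.ae_eq hℋ] with x hx h1 h2
    obtain ⟨hxc, k, hk⟩ := hx
    exact ⟨k, hk, hxc, h1 k hk, h2 k hk⟩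
  have husq : ∀ x, u x = ENNReal.ofReal ((f (proj ℋ x) - f' (proj ℋ x)) ^ 2 * θ (ℋ x)) := fun x => by
    simp only [hu]
    rw [ENNReal.ofReal_mul (sq_nonneg _), ← ofReal_norm, ← ENNReal.ofReal_pow (norm_nonneg _),
      Real.norm_eq_abs, sq_abs]
  have hDm : MeasurableSet {x | ℋ x ≤ R} :=
    (isClosed_le hℋ.continuous continuous_const).measurableSet
  have hNm : MeasurableSet {x | critDist ℋ (ℋ x) < η} :=
    (isOpen_lt (continuous_critDist.comp hℋ.continuous) continuous_const).measurableSet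
  have hA : ∫⁻ x in {x | ℋ x ≤ R}ᶜ, u x ≤ ENNReal.ofReal (ε / 3) := by
    calc ∫⁻ x in {x | ℋ x ≤ R}ᶜ, u x
        ≤ ∫⁻ x in {x | ℋ x ≤ R}ᶜ, ENNReal.ofReal (2 * ε₁) *
            (‖f (proj ℋ x)‖ₑ ^ 2 * ENNReal.ofReal √(θ (ℋ x))
              + ‖f' (proj ℋ x)‖ₑ ^ 2 * ENNReal.ofReal √(θ (ℋ x))) := by
          refine setLIntegral_mono' hDm.compl fun x hx => ?_
          have h1 : θ (ℋ x) < ε₁ ^ 2 := hR _ (not_le.1 (show ¬ ℋ x ≤ R from hx)).le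
          have h2 : √(θ (ℋ x)) ≤ ε₁ := by
            rw [← Real.sqrt_sq hε₁0.le]
            exact Real.sqrt_le_sqrt h1.le
          have h3 : θ (ℋ x) ≤ ε₁ * √(θ (ℋ x)) := by
            nth_rewrite 1 [← Real.mul_self_sqrt (hθ0 (ℋ x)).le]
            gcongr
          calc u x ≤ 2 * (‖f (proj ℋ x)‖ₑ ^ 2 + ‖f' (proj ℋ x)‖ₑ ^ 2) *
                ENNReal.ofReal (ε₁ * √(θ (ℋ x))) := by
                simp only [hu]
                gcongr
                exact enorm_sub_sq_le _ _
            _ = _ := by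
                rw [ENNReal.ofReal_mul hε₁0.le, ENNReal.ofReal_mul zero_le_two,
                  ENNReal.ofReal_ofNat]
                ring
      _ ≤ ∫⁻ x, ENNReal.ofReal (2 * ε₁) *
            (‖f (proj ℋ x)‖ₑ ^ 2 * ENNReal.ofReal √(θ (ℋ x))
              + ‖f' (proj ℋ x)‖ₑ ^ 2 * ENNReal.ofReal √(θ (ℋ x))) := setLIntegral_le_lintegral _ _
      _ ≤ ENNReal.ofReal (2 * ε₁) * (3 * ENNReal.ofReal M + 3 * ENNReal.ofReal M) := by
          rw [lintegral_const_mul' _ _ ENNReal.ofReal_ne_top]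
          gcongr
          rw [lintegral_add_left]
          · exact add_le_add (lintegral_proj_sq_le hℋ hw hF hfF)
              (lintegral_proj_sq_le hℋ hw hF' hfF')
          · exact ((hf.comp continuous_proj.measurable).enorm.pow_const 2).mul
              (hw.comp hℋ.continuous).measurable.ennreal_ofReal
      _ ≤ ENNReal.ofReal (ε / 3) := by
          calc ENNReal.ofReal (2 * ε₁) * (3 * ENNReal.ofReal M + 3 * ENNReal.ofReal M)
              ≤ ENNReal.ofReal (2 * ε₁) * (ENNReal.ofReal 3 * ENNReal.ofReal (max M 1)
                + ENNReal.ofReal 3 * ENNReal.ofReal (max M 1)) := by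
                rw [ENNReal.ofReal_ofNat]
                gcongr <;> exact le_max_left _ _
            _ = ENNReal.ofReal (ε / 3) := by
                rw [← ENNReal.ofReal_mul (by norm_num), ← ENNReal.ofReal_add (by positivity)
                  (by positivity), ← ENNReal.ofReal_mul (by positivity)]
                congr 1
                rw [hε₁]; field_simp; ring
  have hN : ∫⁻ x in {x | ℋ x ≤ R ∧ critDist ℋ (ℋ x) < η}, u x ≤ ENNReal.ofReal (ε / 3) := by
    refine le_trans (setLIntegral_mono_ae' (hDm.inter hNm) ?_) hη.le
    filter_upwards [hae] with x hx hxN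
    obtain ⟨k, hk, hxc, h1, h2⟩ := hx
    rw [husq, h1, h2]
    refine ENNReal.ofReal_le_ofReal ?_
    have h3 := hC₂ F g hF k _ (mem_interval_of_proj hk) hxc hxN.1
    have h4 := hC₂ F' g' hF' k _ (mem_interval_of_proj hk) hxc hxN.1
    have h5 : (F k (ℋ x) - F' k (ℋ x)) ^ 2
        ≤ 4 * C₂ * (1 + critDist ℋ (ℋ x) ^ (-(1 / 4) : ℝ)) := by
      nlinarith [sq_nonneg (F k (ℋ x) + F' k (ℋ x))]
    calc (F k (ℋ x) - F' k (ℋ x)) ^ 2 * θ (ℋ x)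
        ≤ 4 * C₂ * (1 + critDist ℋ (ℋ x) ^ (-(1 / 4) : ℝ)) * B :=
          mul_le_mul h5 (hB _) (hθ0 _).le ((sq_nonneg _).trans h5)
      _ = _ := by ring
  have hC : ∫⁻ x in {x | ℋ x ≤ R ∧ η ≤ critDist ℋ (ℋ x)}, u x ≤ ENNReal.ofReal (ε / 3) := by
    calc ∫⁻ x in {x | ℋ x ≤ R ∧ η ≤ critDist ℋ (ℋ x)}, u x
        ≤ ∫⁻ _ in {x | ℋ x ≤ R ∧ η ≤ critDist ℋ (ℋ x)}, ENNReal.ofReal (9 * κ ^ 2 * B) := by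
          refine setLIntegral_mono_ae' (hDm.inter (isClosed_le continuous_const
            (continuous_critDist.comp hℋ.continuous)).measurableSet) ?_
          filter_upwards [hae] with x hx hxC
          obtain ⟨k, hk, hxc, h1, h2⟩ := hx
          rw [husq, h1, h2]
          refine ENNReal.ofReal_le_ofReal ?_
          have h3 := hcore k _ (mem_interval_of_proj hk) hxC.1 hxC.2
          have h4 : (F k (ℋ x) - F' k (ℋ x)) ^ 2 ≤ 9 * κ ^ 2 := by
            rw [← sq_abs]
            calc |F k (ℋ x) - F' k (ℋ x)| ^ 2 ≤ (3 * κ) ^ 2 := by gcongr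
              _ = 9 * κ ^ 2 := by ring
          exact mul_le_mul h4 (hB _) (hθ0 _).le (by positivity)
      _ ≤ ENNReal.ofReal (9 * κ ^ 2 * B) * volume {x | ℋ x ≤ R} := by
          rw [setLIntegral_const]
          gcongr
          exact fun h => h.1
      _ = ENNReal.ofReal (9 * κ ^ 2 * B * V) := by
          rw [ENNReal.ofReal_mul (show 0 ≤ 9 * κ ^ 2 * B by positivity), hV,
            ENNReal.ofReal_toReal hVtop]
      _ ≤ ENNReal.ofReal (ε / 3) := by
          refine ENNReal.ofReal_le_ofReal ?_
          rw [hκsq]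
          calc 9 * (ε / 3 / (9 * B * (V + 1))) * B * V = ε / 3 * (V / (V + 1)) := by field_simp
            _ ≤ ε / 3 * 1 := by
                gcongr
                rw [div_le_one (by positivity)]
                linarith
            _ = ε / 3 := mul_one _
  have hcov : (univ : Set Plane) = {x | ℋ x ≤ R}ᶜ ∪
      ({x | ℋ x ≤ R ∧ critDist ℋ (ℋ x) < η} ∪ {x | ℋ x ≤ R ∧ η ≤ critDist ℋ (ℋ x)}) := by
    ext x
    simp only [mem_univ, true_iff]
    by_cases h1 : ℋ x ≤ R
    · rcases lt_or_ge (critDist ℋ (ℋ x)) η with h2 | h2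
      · exact Or.inr (Or.inl ⟨h1, h2⟩)
      · exact Or.inr (Or.inr ⟨h1, h2⟩)
    · exact Or.inl h1
  calc ∫⁻ x, u x ≤ ENNReal.ofReal (ε / 3) + (ENNReal.ofReal (ε / 3) + ENNReal.ofReal (ε / 3)) := by
        rw [← setLIntegral_univ, hcov]
        refine (lintegral_union_le _ _ _).trans (add_le_add hA ?_)
        exact (lintegral_union_le _ _ _).trans (add_le_add hN hC)
    _ = ENNReal.ofReal ε := by
        rw [← ENNReal.ofReal_add (by positivity) (by positivity),
          ← ENNReal.ofReal_add (by positivity) (by positivity)]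
        congr 1; ring

end

noncomputable section

open LevelGraph

/-! ### Hölder continuity in time -/

/-- A curve of finite energy is Hölder continuous of exponent `1/2`. -/
lemma norm_sub_sq_le_of_timeEnergy_lt {F : Type*} [NormedAddCommGroup F] [NormedSpace ℝ F]
    [CompleteSpace F] {T : ℝ} (hT : 0 < T) {Φ : C(Icc (0 : ℝ) T, F)} {K : ℝ} (hK : 0 < K)
    (h : timeEnergy hT.le Φ < ENNReal.ofReal K) (s t : Icc (0 : ℝ) T) :
    ‖Φ t - Φ s‖ ^ 2 ≤ K * |(t : ℝ) - s| := by
  obtain ⟨Ψ, hΨ⟩ := iInf_lt_iff.1 h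
  obtain ⟨hweak, hE⟩ := iInf_lt_iff.1 hΨ
  set u := IccExtend hT.le Φ with hu
  have huc : Continuous u := Φ.continuous.Icc_extend'
  have hsub : Ioo 0 T ×ˢ Ioo 0 T ⊆ {p : ℝ × ℝ | ‖u p.2 - u p.1‖ ^ 2 ≤ K * |p.2 - p.1|} := by
    rintro ⟨a, b⟩ ⟨ha, hb⟩
    show ‖u b - u a‖ ^ 2 ≤ K * |b - a|
    have hint := LocallyIntegrableOn.intervalIntegrable_of_ordConnected ordConnected_Ioo
      hweak.2.1 ha hb
    have h1 := enorm_intervalIntegral_sq_le hint (σ := fun _ => 1) measurable_const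
      fun _ _ => one_pos
    rw [← hweak.sub_eq_integral isOpen_Ioo ordConnected_Ioo huc.continuousOn ha hb] at h1
    simp only [ENNReal.ofReal_one, mul_one, inv_one, setLIntegral_one] at h1
    have h2 : ∫⁻ x in uIoc a b, ‖Ψ x‖ₑ ^ 2 ≤ ENNReal.ofReal K :=
      (lintegral_mono_set (uIoc_subset_uIcc.trans
        (ordConnected_Ioo.uIcc_subset ha hb))).trans hE.le
    have h3 : volume (uIoc a b) = ENNReal.ofReal |b - a| := by
      rw [uIoc, Real.volume_Ioc, max_sub_min_eq_abs]
    rw [h3] at h1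
    have h4 := h1.trans (mul_le_mul_left h2 _)
    rwa [← ENNReal.ofReal_mul hK.le, ← ofReal_norm, ← ENNReal.ofReal_pow (norm_nonneg _),
      ENNReal.ofReal_le_ofReal_iff (by positivity)] at h4
  -- The weak derivative lives on the open interval; continuity carries the estimate to the end
  -- points.
  have hcl : IsClosed {p : ℝ × ℝ | ‖u p.2 - u p.1‖ ^ 2 ≤ K * |p.2 - p.1|} :=
    isClosed_le (by fun_prop) (by fun_prop)
  have hmem : ((s : ℝ), (t : ℝ)) ∈ closure (Ioo 0 T ×ˢ Ioo 0 T) := by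
    rw [closure_prod_eq, closure_Ioo hT.ne]
    exact ⟨s.2, t.2⟩
  have := closure_minimal hsub hcl hmem
  simpa only [mem_ofPred_eq, hu, IccExtend_val] using this

/-! ### The weight and the measures on the graph -/

variable {ℋ : Plane → ℝ}

/-- The weight is a continuous function of the height, which tends to zero at infinity. -/
lemma WeightHyp.exists_continuous (hℋ : HamiltonianHyp ℋ) {γ : LevelGraph ℋ → ℝ}
    (hγ : WeightHyp γ) (hγ_lim : VanishesAtInfinity γ) :
    ∃ (θ : ℝ → ℝ) (B : ℝ), Continuous θ ∧ (∀ z, 0 < θ z) ∧ (∀ z, θ z ≤ B) ∧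
      Tendsto θ atTop (𝓝 0) ∧ ∀ p, γ p = θ (height ℋ p) := by
  obtain ⟨ϑ, ϑ', -, hγϑ, hpos, ⟨B, hB⟩, hd, -, -⟩ := hγ.profile
  have hheight : ∀ p, 0 ≤ height ℋ p := fun p => by
    obtain ⟨x, rfl⟩ := surjective_proj p
    rw [height_proj]
    exact hℋ.nonneg x
  have hmax : ∀ z : ℝ, 0 ≤ max z 0 := fun z => le_max_right _ _
  have heq : ∀ p, γ p = ϑ (max (height ℋ p) 0) := fun p => by
    rw [max_eq_left (hheight p), hγϑ]
  -- Freezing `ϑ` at its value at `0` on the negative half-line extends it without changing it at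
  -- any height.
  refine ⟨fun z => ϑ (max z 0), B, ?_, fun z => hpos _ (hmax z), fun z => hB _ (hmax z), ?_, heq⟩
  · have hc : ContinuousOn ϑ (Ici 0) := fun z hz => (hd z hz).continuousWithinAt
    exact hc.comp_continuous (continuous_id.max continuous_const) hmax
  obtain ⟨Z, hZ⟩ := (finite_criticalValues hℋ).bddAbove
  -- Above all critical values a single edge contains every height, so it is unbounded and the decay
  -- hypothesis applies to it.
  have hz0 : Z < max Z 0 + 1 := by linarith [le_max_left Z 0]
  obtain ⟨x, hx⟩ := hℋ.exists_eq (z := max Z 0 + 1) (by positivity)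
  have hxc : height ℋ (proj ℋ x) ∉ criticalValues ℋ := fun h => by
    rw [height_proj, hx] at h
    exact absurd (hZ h) (not_le.2 hz0)
  obtain ⟨k, hk⟩ := Edge.exists_mem (notMem_vertices hxc)
  have hxk : max Z 0 + 1 ∈ k.interval := ⟨_, hk, (height_proj x).trans hx⟩
  have hall : ∀ q, max Z 0 + 1 ≤ q → q ∈ k.interval := fun q hq =>
    Edge.mem_interval_of_gap hℋ hxk <| Set.disjoint_left.2 fun y hy hyc => by
      rw [uIcc_of_le hq] at hy
      exact absurd (hZ hyc) (not_le.2 (hz0.trans_le hy.1))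
  have hunb : ¬ BddAbove k.interval := fun ⟨b, hb⟩ => by
    have := hb (hall (max (max Z 0 + 1) (b + 1)) (le_max_left _ _))
    linarith [le_max_right (max Z 0 + 1) (b + 1)]
  rw [tendsto_order]
  refine ⟨fun a ha => Eventually.of_forall fun z => ha.trans (hpos _ (hmax z)), fun a ha => ?_⟩
  obtain ⟨R, hR⟩ := ((hγ_lim k hunb).eventually_lt_const ha).exists
  filter_upwards [eventually_gt_atTop R, eventually_ge_atTop (max Z 0 + 1)] with z hzR hzZ
  have hzk := hall z hzZ
  -- A real supremum dominates its family only when the family is bounded; otherwise it has a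
  -- default value.
  have hbdd : BddAbove (range fun p : {p : LevelGraph ℋ // p ∈ k.1 ∧ R < height ℋ p} => γ p) :=
    ⟨B, by rintro _ ⟨p, rfl⟩; exact (hγϑ p).trans_le (hB _ (hheight p))⟩
  have h1 := le_ciSup hbdd ⟨k.point z, Edge.point_mem hzk, by rwa [Edge.height_point hzk]⟩
  refine lt_of_le_of_lt ?_ hR
  have h2 := heq (k.point z)
  rw [Edge.height_point hzk] at h2
  exact h2 ▸ h1

lemma lintegral_graphMeasure (hℋ : HamiltonianHyp ℋ) {W : LevelGraph ℋ → ℝ} {w : ℝ → ℝ}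
    (hw : Continuous w) (hW : ∀ p, W p = w (height ℋ p)) {φ : LevelGraph ℋ → ℝ≥0∞}
    (hφ : Measurable φ) :
    ∫⁻ p, φ p ∂graphMeasure W = ∫⁻ x, φ (proj ℋ x) * ENNReal.ofReal (w (ℋ x)) := by
  have hWm : Measurable fun x => ENNReal.ofReal (W (proj ℋ x)) := by
    simp only [hW, height_proj]
    exact (hw.comp hℋ.continuous).measurable.ennreal_ofReal
  rw [graphMeasure, lintegral_map hφ continuous_proj.measurable]
  refine (lintegral_withDensity_eq_lintegral_mul _ hWm
    (hφ.comp continuous_proj.measurable)).trans ?_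
  refine lintegral_congr fun x => ?_
  simp only [Pi.mul_apply, hW, height_proj, Function.comp_apply]
  exact mul_comm _ _

lemma graphMeasure_le_smul {W W' : LevelGraph ℋ → ℝ} {c : ℝ} (hc : 0 ≤ c)
    (h : ∀ p, W p ≤ c * W' p) :
    graphMeasure W ≤ ENNReal.ofReal c • graphMeasure W' := by
  rw [graphMeasure, graphMeasure, ← Measure.map_smul, ← withDensity_smul' _ _ ENNReal.ofReal_ne_top]
  refine Measure.map_mono (withDensity_mono (Eventually.of_forall fun x => ?_))
    continuous_proj.measurable
  rw [Pi.smul_apply, smul_eq_mul, ← ENNReal.ofReal_mul hc]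
  exact ENNReal.ofReal_le_ofReal (h _)

/-- Functions of bounded Sobolev norm for the weight `√γ` are totally bounded for the weight `γ`. -/
theorem totallyBounded_sobolevBall (hℋ : HamiltonianHyp ℋ) {γ : LevelGraph ℋ → ℝ} {θ : ℝ → ℝ}
    (hθ : Continuous θ) (hθ0 : ∀ z, 0 < θ z) {B : ℝ} (hB : ∀ z, θ z ≤ B)
    (hlim : Tendsto θ atTop (𝓝 0)) (hγθ : ∀ p, γ p = θ (height ℋ p)) (M : ℝ) :
    TotallyBounded {h : GraphL2 γ | ∃ f : GraphL2 (fun p => √(γ p)),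
      sobolevNormSq (fun p => √(γ p)) f < ENNReal.ofReal M ∧
        (h : LevelGraph ℋ → ℝ) =ᵐ[graphMeasure γ] f} := by
  refine Metric.totallyBounded_of_finite_discretization fun ε hε => ?_
  obtain ⟨S, C, κ, hS, hκ, hbound, hclose⟩ := exists_discretization hℋ hθ hθ0 hB hlim M
    (ε := (ε / 2) ^ 2) (by positivity)
  have := hS.to_subtype
  have hchoice : ∀ h : {h : GraphL2 γ | ∃ f : GraphL2 (fun p => √(γ p)),
      sobolevNormSq (fun p => √(γ p)) f < ENNReal.ofReal M ∧
        (h : LevelGraph ℋ → ℝ) =ᵐ[graphMeasure γ] f},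
      ∃ (f : LevelGraph ℋ → ℝ) (F g : Edge ℋ → ℝ → ℝ), Measurable f ∧
        (h : LevelGraph ℋ → ℝ) =ᵐ[graphMeasure γ] f ∧
        IsProfile (fun z => √(θ z)) M F g ∧ Represents f F := by
    rintro ⟨h, f, hf, hfh⟩
    obtain ⟨F, g, hF, hfF⟩ := exists_isProfile hℋ (w := fun z => √(θ z))
      (fun p => by rw [hγθ]) hf
    exact ⟨f, F, g, (Lp.stronglyMeasurable f).measurable, hfh, hF, hfF⟩
  choose f F g hfm hfh hF hfF using hchoice
  -- The samples rounded to multiples of `κ` form a finite set of labels, and equal labels force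
  -- samples within `κ`.
  have hval : ∀ h, ∀ p : S, ⌊F h p.1.1 p.1.2 / κ⌋ ∈ Icc ⌊-C / κ⌋ ⌊C / κ⌋ := fun h p => by
    have h1 := abs_le.1 (hbound _ _ (hF h) p.1 p.2)
    exact ⟨Int.floor_mono (by gcongr; exact h1.1), Int.floor_mono (by gcongr; exact h1.2)⟩
  have := Fintype.ofFinite S
  classical
  refine ⟨S → Icc ⌊-C / κ⌋ ⌊C / κ⌋, inferInstance, fun h p => ⟨_, hval h p⟩, fun h h' heq => ?_⟩
  have hnear : ∀ p ∈ S, |F h p.1 p.2 - F h' p.1 p.2| ≤ κ := fun p hp => by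
    have h1 : ⌊F h p.1 p.2 / κ⌋ = ⌊F h' p.1 p.2 / κ⌋ :=
      congrArg Subtype.val (congrFun heq ⟨p, hp⟩)
    have h2 := (Int.abs_sub_lt_one_of_floor_eq_floor h1).le
    rwa [← sub_div, abs_div, abs_of_pos hκ, div_le_one hκ] at h2
  have h1 := hclose (f h) (f h') (F h) (g h) (F h') (g h') (hfm h) (hF h) (hF h') (hfF h) (hfF h')
    hnear
  have h2 : edist (h : GraphL2 γ) h' ≤ ENNReal.ofReal (ε / 2) := by
    have h3 : eLpNorm ((h : GraphL2 γ) - (h' : GraphL2 γ) : LevelGraph ℋ → ℝ) 2 (graphMeasure γ)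
        = eLpNorm (f h - f h') 2 (graphMeasure γ) := eLpNorm_congr_ae ((hfh h).sub (hfh h'))
    rw [Lp.edist_def, h3, eLpNorm_eq_lintegral_rpow_enorm_toReal two_ne_zero ENNReal.ofNat_ne_top]
    have h4 : ∫⁻ p, ‖(f h - f h') p‖ₑ ^ 2 ∂graphMeasure γ ≤ ENNReal.ofReal ((ε / 2) ^ 2) := by
      rw [lintegral_graphMeasure hℋ hθ hγθ (((hfm h).sub (hfm h')).enorm.pow_const 2)]
      exact h1
    simp only [ENNReal.toReal_ofNat, ENNReal.rpow_ofNat]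
    calc (∫⁻ p, ‖(f h - f h') p‖ₑ ^ 2 ∂graphMeasure γ) ^ (1 / 2 : ℝ)
        ≤ ENNReal.ofReal ((ε / 2) ^ 2) ^ (1 / 2 : ℝ) := by gcongr
      _ = ENNReal.ofReal (ε / 2) := by
          rw [ENNReal.ofReal_rpow_of_nonneg (sq_nonneg _) (by norm_num), ← Real.sqrt_eq_rpow,
            Real.sqrt_sq (by positivity)]
  rw [edist_le_ofReal (by positivity)] at h2
  exact h2.trans_lt (half_lt_self hε)

end

/-! ### Change of measure and Arzelà–Ascoli for Hölder curves. -/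

noncomputable section

/-- A function that is square integrable for a measure is square integrable for every dominated
measure, with control of the norms. -/
lemma exists_lipschitzWith_toLp {α : Type*} {m : MeasurableSpace α} {μ ν : Measure α} {c : ℝ≥0∞}
    (hc : c ≠ ∞) (h : ν ≤ c • μ) :
    ∃ (K : NNReal) (L : Lp ℝ 2 μ → Lp ℝ 2 ν), LipschitzWith K L ∧
      ∀ f, (L f : α → ℝ) =ᵐ[ν] f := by
  have hmem : ∀ f : Lp ℝ 2 μ, MemLp f 2 ν := fun f => (Lp.memLp f).of_measure_le_smul hc h
  refine ⟨(c ^ (1 / 2 : ℝ)).toNNReal, fun f => (hmem f).toLp f, fun f g => ?_,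
    fun f => (hmem f).coeFn_toLp⟩
  rw [ENNReal.coe_toNNReal (ENNReal.rpow_ne_top_of_nonneg (by norm_num) hc), Lp.edist_def,
    Lp.edist_def]
  calc eLpNorm ((hmem f).toLp f - (hmem g).toLp g : α → ℝ) 2 ν
      = eLpNorm (f - g : α → ℝ) 2 ν :=
        eLpNorm_congr_ae ((hmem f).coeFn_toLp.sub (hmem g).coeFn_toLp)
    _ ≤ eLpNorm (f - g : α → ℝ) 2 (c • μ) := eLpNorm_mono_measure _ h
    _ = _ := by
        rw [eLpNorm_smul_measure_of_ne_top ENNReal.ofNat_ne_top, smul_eq_mul]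
        norm_num

/-- A family of curves with values in a totally bounded set and with a common Hölder modulus of
continuity is precompact. -/
lemma isCompact_closure_of_holder {F : Type*} [NormedAddCommGroup F] [CompleteSpace F] {T : ℝ}
    {A : Set C(Icc (0 : ℝ) T, F)} {s : Set F} (hs : TotallyBounded s) {K : ℝ}
    (hA : ∀ Ψ ∈ A, ∀ t, Ψ t ∈ s)
    (hK : ∀ Ψ ∈ A, ∀ a b, dist (Ψ a) (Ψ b) ≤ K * √(dist a b)) : IsCompact (closure A) := by
  set e := ContinuousMap.isometryEquivBoundedOfCompact (Icc (0 : ℝ) T) F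
  have hcomp : IsCompact (closure (e '' A)) := by
    refine BoundedContinuousFunction.arzela_ascoli (closure s)
      (hs.closure.isCompact_of_isClosed isClosed_closure) _ ?_ ?_
    · rintro _ t ⟨Ψ, hΨ, rfl⟩
      exact subset_closure (hA Ψ hΨ t)
    · refine Metric.equicontinuous_of_continuity_modulus (fun r => K * √r) ?_ _ ?_
      · have : Tendsto (fun r : ℝ => K * √r) (𝓝 0) (𝓝 (K * √0)) :=
          (continuous_const.mul Real.continuous_sqrt).tendsto 0
        simpa using this
      · rintro a b ⟨_, Ψ, hΨ, rfl⟩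
        exact hK Ψ hΨ a b
  have himg : closure (e '' A) = e '' closure A := (e.toHomeomorph.image_closure A).symm
  rw [himg] at hcomp
  exact e.toHomeomorph.isCompact_image.1 hcomp

end

/-- The two `L²` spaces consist of classes for different measures, so the inclusion is expressed by
almost everywhere equality at every time. -/
theorem mainTheorem6 (ℋ : Plane → ℝ) (hℋ : HamiltonianHyp ℋ) (γ : LevelGraph ℋ → ℝ)
    (hγ : WeightHyp γ) (hγ_lim : VanishesAtInfinity γ) (T : ℝ) (hT : 0 < T)
    (M : ℝ) (hM : 0 < M) :
    (∀ Φ ∈ energySet hT.le M (fun p => √(γ p)), ∃ Ψ : C(Icc (0 : ℝ) T, GraphL2 γ),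
      ∀ t, (Ψ t : LevelGraph ℋ → ℝ) =ᵐ[graphMeasure γ] Φ t) ∧
    IsCompact (closure {Ψ : C(Icc (0 : ℝ) T, GraphL2 γ) |
      ∃ Φ ∈ energySet hT.le M (fun p => √(γ p)),
        ∀ t, (Ψ t : LevelGraph ℋ → ℝ) =ᵐ[graphMeasure γ] Φ t}) := by
  obtain ⟨θ, B, hθ, hθ0, hB, hlim, hγθ⟩ := hγ.exists_continuous hℋ hγ_lim
  have hle : graphMeasure γ ≤ ENNReal.ofReal √B • graphMeasure (fun p => √(γ p)) :=
    graphMeasure_le_smul (Real.sqrt_nonneg B) fun p => by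
      have h0 : 0 ≤ γ p := by rw [hγθ]; exact (hθ0 _).le
      nth_rewrite 1 [← Real.mul_self_sqrt h0]
      have : γ p ≤ B := by rw [hγθ]; exact hB _
      gcongr
  obtain ⟨K, L, hL, hLae⟩ := exists_lipschitzWith_toLp ENNReal.ofReal_ne_top hle
  refine ⟨fun Φ _ => ⟨⟨fun t => L (Φ t), hL.continuous.comp Φ.continuous⟩, fun t => hLae _⟩, ?_⟩
  -- The energies are infima that need not be attained; the margin gives the strict bounds needed to
  -- select derivatives.
  have hlt : ENNReal.ofReal M < ENNReal.ofReal (M + 1) :=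
    (ENNReal.ofReal_lt_ofReal_iff (by positivity)).2 (lt_add_one M)
  refine isCompact_closure_of_holder
    (totallyBounded_sobolevBall hℋ hθ hθ0 hB hlim hγθ (M + 1)) (K := K * √(M + 1)) ?_ ?_
  · rintro Ψ ⟨Φ, hΦ, hΨ⟩ t
    refine ⟨Φ t, lt_of_le_of_lt ?_ hlt, hΨ t⟩
    exact (le_iSup (fun t => sobolevNormSq (fun p => √(γ p)) (Φ t)) t).trans
      (le_self_add.trans hΦ)
  · rintro Ψ ⟨Φ, hΦ, hΨ⟩ a b
    -- Almost everywhere equality determines `Ψ`, so it inherits the Hölder modulus of `Φ` through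
    -- the Lipschitz map `L`.
    have hΨL : ∀ t, Ψ t = L (Φ t) := fun t => Lp.ext ((hΨ t).trans (hLae _).symm)
    have h1 := norm_sub_sq_le_of_timeEnergy_lt hT (K := M + 1) (by positivity)
      ((le_add_self.trans (show _ ≤ _ from hΦ)).trans_lt hlt) b a
    have h2 : dist (Φ a) (Φ b) ≤ √(M + 1) * √(dist a b) := by
      rw [← Real.sqrt_mul (by positivity), dist_eq_norm, Subtype.dist_eq, Real.dist_eq]
      exact Real.le_sqrt_of_sq_le h1
    rw [hΨL, hΨL, mul_assoc]
    exact (hL.dist_le_mul _ _).trans (by gcongr)
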